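/- Let $N$ be the quotient of $]-1,1[\,\times S^2$ (with the standard product metric) by the orientation-preserving isometric involution $(t,\omega)\mapsto(-t,-\omega)$, let $\pi:\,]-1,1[\,\times S^2\to N$ be the projection, and give $N$ the Riemannian metric for which $\pi$ is a local isometry; $N$ is orientable. Let $t_j\in\,]0,1[$, $j\in\mathbb N$, be a non-increasing sequence with $t_j\downarrow 0$, and set $$\Sigma^j:=\pi(\{t_j\}\times S^2),\qquad \Gamma:=\pi(\{0\}\times S^2).$$ Then: 1. Each $\Sigma^j$ is a smoothly embedded, totally geodesic, minimal sphere of finite area, and $\Gamma$ is a smoothly embedded real projective plane of finite area. More precisely, $\omega\mapsto\pi(t_j,\omega)$ is a smooth embedding of $S^2$ with image $\Sigma^j$, and $\pm\omega\mapsto\pi(0,\omega)$ is a smooth embedding of $S^2/\{\pm1\}$ with image $\Gamma$. 2. The sequence $(\Sigma^j)$ is almost minimizing in sufficiently small annuli: there is a function $r:N\to\,]0,\infty[$ such that for every $x\in N$ and all $0<\tau<\sigma\le r(x)$, for all sufficiently large $j$ the surface $\Sigma^j$ is $\frac1j$-almost minimizing in the annulus $B_\sigma(x)\setminus\overline B_\tau(x)$;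 and the (smooth) surfaces $\Sigma^j$ converge as varifolds to a stationary varifold. Here a surface $\Sigma$ is $\varepsilon$-almost minimizing in an open set $U$ if there is no smooth isotopy $\psi:[0,1]\times N\to N$ (that is, a smooth map with $\psi(0,\cdot)=\mathrm{id}$ and all $\psi(s,\cdot)$ diffeomorphisms) which fixes $N\setminus U$ pointwise and satisfies $\mathcal H^2(\psi(s,\Sigma))\le\mathcal H^2(\Sigma)+\varepsilon/8$ for all $s\in[0,1]$ and $\mathcal H^2(\psi(1,\Sigma))\le\mathcal H^2(\Sigma)-\varepsilon$. 3. $\Sigma^j$ converges to $2\Gamma$ in the sense of varifolds: $\int_{\Sigma^j}\varphi(x,T_x\Sigma^j)\,d\mathcal H^2\to 2\int_\Gamma\varphi(x,T_x\Gamma)\,d\mathcal H^2$ for every continuous function $\varphi$ with compact support on the bundle of tangent $2$-planes of $N$. 4. Let the genus $\mathrm{gen}$ of a connected compact surface be the number of handles (if it is orientable), respectively of cross caps (if it is not orientable), which have to be attached to a sphere in order to get a surface homeomorphic to it. Then $\Sigma^j$ is orientable with $\mathrm{gen}(\Sigma^j)=0$ for every $j$, and $\Gamma$ is non-orientable with $\mathrm{gen}(\Gamma)=1$.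 Hence $\mathrm{gen}(\Gamma)\le\liminf_{j\to\infty}\mathrm{gen}(\Sigma^j)$ fails, and so does, for the varifold limit $\sum_i n_i\Gamma^i=2\Gamma$ of the almost minimizing sequence $(\Sigma^j)$, the estimate $$\sum_{\Gamma^i\ \mathrm{orientable}} n_i\,\mathrm{gen}(\Gamma^i)+\frac12\sum_{\Gamma^i\ \mathrm{non\text{-}orientable}} n_i\,\mathrm{gen}(\Gamma^i)\;\le\;\liminf_{j\to\infty}\mathrm{gen}(\Sigma^j).$$ -/

import Mathlib

open scoped Manifold ContDiff Topology Bundle ENNReal NNReal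
open Set
set_option linter.unusedSectionVars false

namespace GenusBound

/-! ### Quotients of manifolds -/

section QuotientManifold

variable {M : Type*} [TopologicalSpace M]
  {G : Type*} [Group G] [MulAction G M]
  [ProperlyDiscontinuousSMul G M] [ContinuousConstSMul G M] [IsCancelSMul G M]
  [T2Space M] [LocallyCompactSpace M]
  {H : Type*} [TopologicalSpace H] [ChartedSpace H M]
  {E : Type*} [NormedAddCommGroup E] [NormedSpace ℝ E]
  (I : ModelWithCorners ℝ E H) (n : ℕ∞ω)

variable (M G) in
/-- The projection onto the quotient by a group action. -/
def quotientProj : M → MulAction.orbitRel.Quotient G M := Quotient.mk _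

theorem quotientProj_surjective : Function.Surjective (quotientProj M G) := Quotient.mk_surjective

theorem quotientProj_eq_iff {p q : M} :
    quotientProj M G p = quotientProj M G q ↔ ∃ g : G, g • q = p := by
  unfold quotientProj
  rw [Quotient.eq]
  exact MulAction.orbitRel_apply

theorem isLocalHomeomorph_quotientProj : IsLocalHomeomorph (quotientProj M G) :=
  isQuotientCoveringMap_quotientMk_of_properlyDiscontinuousSMul.isCoveringMap.isLocalHomeomorph

/-- Two local inverses of the projection differ locally by an element of the group. -/
theorem localInverse_comp_proj_eventuallyEq (q p : M)
    (hp : quotientProj M G p ∈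
      ((isLocalHomeomorph_quotientProj (M := M) (G := G)).localInverseAt q).source) :
    ∃ g : G, (fun y => (isLocalHomeomorph_quotientProj (M := M) (G := G)).localInverseAt q
      (quotientProj M G y)) =ᶠ[𝓝 p] (fun y => g • y) := by
  set hl := isLocalHomeomorph_quotientProj (M := M) (G := G)
  set σ := hl.localInverseAt q
  have h1 : quotientProj M G (σ (quotientProj M G p)) = quotientProj M G p :=
    hl.apply_localInverseAt_of_mem hp
  obtain ⟨g, hg⟩ := quotientProj_eq_iff.1 h1
  refine ⟨g, ?_⟩
  have hpc : ContinuousAt (quotientProj M G) p := hl.continuous.continuousAt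
  have hsrc : ∀ᶠ y in 𝓝 p, quotientProj M G y ∈ σ.source :=
    hpc (σ.open_source.mem_nhds hp)
  have hgt : ∀ᶠ y in 𝓝 p, g • y ∈ σ.target := by
    have : ContinuousAt (fun y : M => g • y) p := (continuous_const_smul g).continuousAt
    refine this (σ.open_target.mem_nhds ?_)
    change g • p ∈ σ.target
    rw [hg]
    exact σ.map_source hp
  filter_upwards [hsrc, hgt] with y hy hy'
  refine hl.injOn_localInverseAt_target (x := q) (σ.map_source hy) hy' ?_
  rw [hl.apply_localInverseAt_of_mem hy]
  exact (quotientProj_eq_iff.2 ⟨g, rfl⟩).symm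

variable (M G) in
theorem isManifold_quotient [IsManifold I n M]
    (hG : ∀ g : G, ContMDiff I I n (fun p : M => g • p)) :
    IsManifold I n (MulAction.orbitRel.Quotient G M) := by
  set hl := isLocalHomeomorph_quotientProj (M := M) (G := G) with hhl
  have key : ∀ q q' : M, ContMDiffOn I I n
      ((hl.localInverseAt q ≫ₕ chartAt H q).symm ≫ₕ (hl.localInverseAt q' ≫ₕ chartAt H q'))
      ((hl.localInverseAt q ≫ₕ chartAt H q).symm ≫ₕ
        (hl.localInverseAt q' ≫ₕ chartAt H q')).source := by
    intro q q' x hx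
    simp only [mfld_simps, IsLocalHomeomorph.localInverseAt_symm] at hx
    obtain ⟨⟨hx1, hx2⟩, hx3, hx4⟩ := hx
    obtain ⟨g, hg⟩ := localInverse_comp_proj_eventuallyEq q' _ hx3
    have hsm : ContMDiffAt I I n (chartAt H q).symm x :=
      (contMDiffOn_chart_symm (I := I) (n := n) (x := q)).contMDiffAt
        ((chartAt H q).open_target.mem_nhds hx1)
    have hch : ContMDiffAt I I n (chartAt H q')
        (g • ((chartAt H q).symm x)) := by
      refine (contMDiffOn_chart (I := I) (n := n) (x := q')).contMDiffAt
        ((chartAt H q').open_source.mem_nhds ?_)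
      rw [← hg.eq_of_nhds]
      exact hx4
    have hcomp : ContMDiffAt I I n
        (chartAt H q' ∘ (fun p : M => g • p) ∘ (chartAt H q).symm) x :=
      ContMDiffAt.comp x hch (((hG g) _).comp x hsm)
    refine (hcomp.congr_of_eventuallyEq ?_).contMDiffWithinAt
    have h2 := hsm.continuousAt.eventually hg
    filter_upwards [h2] with y hy
    simp only [mfld_simps, IsLocalHomeomorph.localInverseAt_symm, Function.comp]
    exact congrArg _ hy
  refine isManifold_of_contDiffOn I n _ ?_
  rintro _ _ ⟨q, rfl⟩ ⟨q', rfl⟩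
  rw [← contMDiffOn_iff_contDiffOn]
  refine I.contMDiff.comp_contMDiffOn ?_
  refine (key _ _).comp (I.contMDiffOn_symm.mono inter_subset_right) ?_
  exact fun y hy => hy.1

theorem contMDiff_quotientProj [IsManifold I n M]
    (hG : ∀ g : G, ContMDiff I I n (fun p : M => g • p)) :
    ContMDiff I I n (quotientProj M G) := by
  have := isManifold_quotient M G I n hG
  set hl := isLocalHomeomorph_quotientProj (M := M) (G := G) with hhl
  intro p
  set x := quotientProj M G p with hx
  let q : M := (quotientProj_surjective (M := M) (G := G)).hasRightInverse.choose x
  have hchart : chartAt H x = hl.localInverseAt q ≫ₕ chartAt H q := rfl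
  have hxs : x ∈ (chartAt H x).source := mem_chart_source H x
  have hxs' := hxs
  rw [hchart] at hxs'
  simp only [mfld_simps] at hxs'
  obtain ⟨g, hg⟩ := localInverse_comp_proj_eventuallyEq q p hxs'.1
  have hch : ContMDiffAt I I n (chartAt H q) (g • p) := by
    refine (contMDiffOn_chart (I := I) (n := n) (x := q)).contMDiffAt
      ((chartAt H q).open_source.mem_nhds ?_)
    rw [← hg.eq_of_nhds]
    exact hxs'.2
  have h1 : ContMDiffAt I I n (chartAt H x ∘ quotientProj M G) p := by
    have h0 : ContMDiffAt I I n (chartAt H q ∘ (fun p : M => g • p)) p :=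
      ContMDiffAt.comp p hch ((hG g) p)
    refine h0.congr_of_eventuallyEq ?_
    filter_upwards [hg] with y hy
    rw [hchart]
    exact congrArg (chartAt H q) hy
  have h2 : ContMDiffAt I I n (chartAt H x).symm (chartAt H x (quotientProj M G p)) :=
    (contMDiffOn_chart_symm (I := I) (n := n) (x := x)).contMDiffAt
      ((chartAt H x).open_target.mem_nhds ((chartAt H x).map_source hxs))
  have h3 : ContMDiffAt I I n ((chartAt H x).symm ∘ (chartAt H x ∘ quotientProj M G)) p :=
    ContMDiffAt.comp p h2 h1
  refine h3.congr_of_eventuallyEq ?_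
  have hpc : ContinuousAt (quotientProj M G) p := hl.continuous.continuousAt
  filter_upwards [hpc ((chartAt H x).open_source.mem_nhds hxs)] with y hy
  exact ((chartAt H x).left_inv hy).symm

theorem contMDiffOn_localInverse_quotientProj [IsManifold I n M]
    (hG : ∀ g : G, ContMDiff I I n (fun p : M => g • p)) (p : M) :
    ContMDiffOn I I n ((isLocalHomeomorph_quotientProj (M := M) (G := G)).localInverseAt p)
      ((isLocalHomeomorph_quotientProj (M := M) (G := G)).localInverseAt p).source := by
  have := isManifold_quotient M G I n hG
  set hl := isLocalHomeomorph_quotientProj (M := M) (G := G) with hhl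
  intro x hx
  refine ContMDiffAt.contMDiffWithinAt ?_
  let q : M := (quotientProj_surjective (M := M) (G := G)).hasRightInverse.choose x
  have hchart : chartAt H x = hl.localInverseAt q ≫ₕ chartAt H q := rfl
  have hxs : x ∈ (chartAt H x).source := mem_chart_source H x
  have hsrc : ∀ y ∈ (chartAt H x).source, y ∈ (hl.localInverseAt q).source ∧
      hl.localInverseAt q y ∈ (chartAt H q).source := by
    intro y hy
    rw [hchart] at hy
    simpa only [mfld_simps] using hy
  have h1 : ContMDiffAt I I n (chartAt H x) x :=
    (contMDiffOn_chart (I := I) (n := n) (x := x)).contMDiffAt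
      ((chartAt H x).open_source.mem_nhds hxs)
  have h2 : ContMDiffAt I I n (chartAt H q).symm (chartAt H x x) := by
    refine (contMDiffOn_chart_symm (I := I) (n := n) (x := q)).contMDiffAt
      ((chartAt H q).open_target.mem_nhds ?_)
    exact (chartAt H q).map_source (hsrc x hxs).2
  have h3 : ContMDiffAt I I n (hl.localInverseAt q) x := by
    refine (ContMDiffAt.comp x h2 h1).congr_of_eventuallyEq ?_
    filter_upwards [(chartAt H x).open_source.mem_nhds hxs] with y hy
    exact ((chartAt H q).left_inv (hsrc y hy).2).symm
  have hpq : quotientProj M G (hl.localInverseAt q x) = x :=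
    hl.apply_localInverseAt_of_mem (hsrc x hxs).1
  obtain ⟨g, hg⟩ := localInverse_comp_proj_eventuallyEq (G := G) p (hl.localInverseAt q x)
    (by rw [hpq]; exact hx)
  refine (ContMDiffAt.comp x ((hG g) _) h3).congr_of_eventuallyEq ?_
  filter_upwards [(chartAt H x).open_source.mem_nhds hxs,
    h3.continuousAt.eventually hg] with y hy hy'
  refine Eq.trans ?_ hy'
  rw [hl.apply_localInverseAt_of_mem (hsrc y hy).1]

theorem isLocalDiffeomorph_quotientProj [IsManifold I n M]
    (hG : ∀ g : G, ContMDiff I I n (fun p : M => g • p)) :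
    IsLocalDiffeomorph I I n (quotientProj M G) := by
  intro p
  set hl := isLocalHomeomorph_quotientProj (M := M) (G := G) with hhl
  refine ⟨⟨(hl.localInverseAt p).symm.toPartialEquiv, (hl.localInverseAt p).symm.open_source,
    (hl.localInverseAt p).symm.open_target, ?_, ?_⟩, ?_, ?_⟩
  · have h := (contMDiff_quotientProj (G := G) I n hG).contMDiffOn
      (s := (hl.localInverseAt p).symm.source)
    refine h.congr fun y _ => ?_
    exact congrFun (hl.localInverseAt_symm p) y
  · exact contMDiffOn_localInverse_quotientProj I n hG p
  · exact hl.self_mem_localInverseAt_target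
  · intro y _
    exact (congrFun (hl.localInverseAt_symm p) y).symm

end QuotientManifold

noncomputable section

/-! ### The quotient manifold -/

/-- The open interval `]-1,1[`. -/
abbrev OpenInterval : TopologicalSpace.Opens ℝ := ⟨Ioo (-1) 1, isOpen_Ioo⟩

/-- The unit sphere of `ℝ³`. -/
abbrev Sphere2 : Type := Metric.sphere (0 : EuclideanSpace ℝ (Fin 3)) 1

/-- The cylinder `]-1,1[ × S²`. -/
abbrev Cylinder : Type := OpenInterval × Sphere2

/-- The model of the manifold structure of the cylinder and of its quotient. -/
abbrev cylModel : ModelWithCorners ℝ (ℝ × EuclideanSpace ℝ (Fin 2))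
    (ModelProd ℝ (EuclideanSpace ℝ (Fin 2))) := 𝓘(ℝ, ℝ).prod (𝓡 2)

instance : Fact (Module.finrank ℝ (EuclideanSpace ℝ (Fin 3)) = 2 + 1) :=
  ⟨finrank_euclideanSpace_fin⟩

/-- The sign `±1` as a real number. -/
def signVal (u : ℤˣ) : ℝ := ((u : ℤ) : ℝ)

theorem signVal_one : signVal 1 = 1 := by simp [signVal]

theorem signVal_neg_one : signVal (-1) = -1 := by simp [signVal]

theorem signVal_mul (u v : ℤˣ) : signVal (u * v) = signVal u * signVal v := by simp [signVal]

theorem signVal_mul_self (u : ℤˣ) : signVal u * signVal u = 1 := by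
  rw [← signVal_mul, Int.units_mul_self, signVal_one]

theorem abs_signVal (u : ℤˣ) : |signVal u| = 1 := by
  rcases Int.units_eq_one_or u with rfl | rfl <;> simp [signVal]

/-- The group `{1, -1}` acts on `]-1,1[` by multiplication. -/
instance : SMul ℤˣ OpenInterval where
  smul u t := ⟨signVal u * t, by
    have h := t.2
    change (t : ℝ) ∈ Ioo (-1 : ℝ) 1 at h
    change signVal u * (t : ℝ) ∈ Ioo (-1 : ℝ) 1
    rw [mem_Ioo, ← abs_lt] at h ⊢
    rwa [abs_mul, abs_signVal, one_mul]⟩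

instance : MulAction ℤˣ OpenInterval where
  one_smul t := Subtype.ext (by
    change signVal 1 * (t : ℝ) = t
    rw [signVal_one, one_mul])
  mul_smul u v t := Subtype.ext (by
    change signVal (u * v) * (t : ℝ) = signVal u * (signVal v * t)
    rw [signVal_mul, mul_assoc])

/-- The group `{1, -1}` acts on `S²` through the antipodal map. -/
instance : SMul ℤˣ Sphere2 where
  smul u w := ⟨signVal u • (w : EuclideanSpace ℝ (Fin 3)), by
    rw [mem_sphere_zero_iff_norm, norm_smul, Real.norm_eq_abs, abs_signVal, one_mul]
    exact mem_sphere_zero_iff_norm.1 w.2⟩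

instance : MulAction ℤˣ Sphere2 where
  one_smul w := Subtype.ext (by
    change signVal 1 • (w : EuclideanSpace ℝ (Fin 3)) = w
    rw [signVal_one, one_smul])
  mul_smul u v w := Subtype.ext (by
    change signVal (u * v) • (w : EuclideanSpace ℝ (Fin 3)) = signVal u • (signVal v • (w : _))
    rw [signVal_mul, mul_smul])

theorem coe_smul_interval (u : ℤˣ) (t : OpenInterval) :
    ((u • t : OpenInterval) : ℝ) = signVal u * t := rfl

theorem coe_smul_sphere (u : ℤˣ) (w : Sphere2) :
    ((u • w : Sphere2) : EuclideanSpace ℝ (Fin 3)) = signVal u • (w : EuclideanSpace ℝ (Fin 3)) :=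
  rfl

instance : SMul ℤˣ Cylinder := Prod.instSMul

instance : MulAction ℤˣ Cylinder := Prod.mulAction

/-- The nontrivial element acts on the cylinder by `(t, ω) ↦ (-t, -ω)`. -/
theorem neg_one_smul_cylinder (p : Cylinder) :
    (((-1 : ℤˣ) • p).1 : ℝ) = -p.1 ∧ ((-1 : ℤˣ) • p).2 = -p.2 := by
  constructor
  · change signVal (-1) * (p.1 : ℝ) = -p.1
    rw [signVal_neg_one]; ring
  · apply Subtype.ext
    change signVal (-1) • (p.2 : EuclideanSpace ℝ (Fin 3)) = -p.2
    rw [signVal_neg_one]; simp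

theorem signVal_injective : Function.Injective signVal := by
  intro u v h
  exact Units.ext (Int.cast_injective (α := ℝ) h)

theorem smul_sphere_cancel (u v : ℤˣ) (w : Sphere2) (h : u • w = v • w) : u = v := by
  have h' := congrArg (Subtype.val) h
  rw [coe_smul_sphere, coe_smul_sphere] at h'
  have hw : (w : EuclideanSpace ℝ (Fin 3)) ≠ 0 := by
    intro h0
    have := mem_sphere_zero_iff_norm.1 w.2
    rw [h0] at this
    simp at this
  exact signVal_injective (smul_left_injective ℝ hw h')

instance : ContinuousConstSMul ℤˣ OpenInterval :=
  ⟨fun u => continuous_induced_rng.2 (by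
    change Continuous fun t : OpenInterval => signVal u * (t : ℝ)
    exact continuous_const.mul continuous_subtype_val)⟩

instance : ContinuousConstSMul ℤˣ Sphere2 :=
  ⟨fun u => continuous_induced_rng.2 (by
    change Continuous fun w : Sphere2 => signVal u • (w : EuclideanSpace ℝ (Fin 3))
    have h : Continuous (fun w : Sphere2 => (w : EuclideanSpace ℝ (Fin 3))) :=
      continuous_subtype_val
    exact h.const_smul (signVal u))⟩

instance : IsCancelSMul ℤˣ Sphere2 where
  left_cancel' u _ _ h := smul_left_cancel u h
  right_cancel' _ _ _ h := smul_sphere_cancel _ _ _ h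

instance : ContinuousConstSMul ℤˣ Cylinder :=
  ⟨fun u => ((continuous_const_smul u).comp continuous_fst).prodMk
    ((continuous_const_smul u).comp continuous_snd)⟩

instance : IsCancelSMul ℤˣ Cylinder where
  left_cancel' u _ _ h := smul_left_cancel u h
  right_cancel' _ _ _ h := smul_sphere_cancel _ _ _ (congrArg Prod.snd h)

instance : LocallyCompactSpace OpenInterval := OpenInterval.isOpen.locallyCompactSpace

theorem contMDiff_smul_interval (u : ℤˣ) :
    ContMDiff 𝓘(ℝ, ℝ) 𝓘(ℝ, ℝ) ∞ (fun t : OpenInterval => u • t) := by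
  refine (ContMDiff.subtypeVal_comp_iff OpenInterval _).1 ?_
  have : ContMDiff 𝓘(ℝ, ℝ) 𝓘(ℝ, ℝ) ∞ (fun t : ℝ => signVal u * t) :=
    (contDiff_const.mul contDiff_id).contMDiff
  exact this.comp contMDiff_subtype_val

theorem contMDiff_smul_sphere (u : ℤˣ) :
    ContMDiff (𝓡 2) (𝓡 2) ∞ (fun w : Sphere2 => u • w) := by
  have h : ContMDiff (𝓡 2) 𝓘(ℝ, EuclideanSpace ℝ (Fin 3)) ∞
      (fun w : Sphere2 => signVal u • (w : EuclideanSpace ℝ (Fin 3))) := by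
    have : ContMDiff 𝓘(ℝ, EuclideanSpace ℝ (Fin 3)) 𝓘(ℝ, EuclideanSpace ℝ (Fin 3)) ∞
        (fun t : EuclideanSpace ℝ (Fin 3) => signVal u • t) := (contDiff_const_smul _).contMDiff
    exact this.comp contMDiff_coe_sphere
  exact ContMDiff.codRestrict_sphere h (fun w => (u • w).2)

theorem contMDiff_smul_cylinder (u : ℤˣ) :
    ContMDiff cylModel cylModel ∞ (fun p : Cylinder => (u • p : Cylinder)) :=
  ((contMDiff_smul_interval u).comp contMDiff_fst).prodMk
    ((contMDiff_smul_sphere u).comp contMDiff_snd)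

/-- The manifold `N`: the quotient of `]-1,1[ × S²` by `(t, ω) ↦ (-t, -ω)`. -/
abbrev QuotCyl : Type := MulAction.orbitRel.Quotient ℤˣ Cylinder

/-- The real projective plane: the quotient of `S²` by the antipodal map. -/
abbrev ProjPlane : Type := MulAction.orbitRel.Quotient ℤˣ Sphere2

instance : IsManifold cylModel ∞ QuotCyl :=
  isManifold_quotient Cylinder ℤˣ cylModel ∞ fun u => contMDiff_smul_cylinder u

instance : IsManifold (𝓡 2) ∞ ProjPlane :=
  isManifold_quotient Sphere2 ℤˣ (𝓡 2) ∞ fun u => contMDiff_smul_sphere u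

/-- The projection `π : ]-1,1[ × S² → N`. -/
def proj : Cylinder → QuotCyl := quotientProj Cylinder ℤˣ

instance : T3Space QuotCyl := by
  have : LocallyCompactSpace (ModelProd ℝ (EuclideanSpace ℝ (Fin 2))) :=
    inferInstanceAs (LocallyCompactSpace (ℝ × EuclideanSpace ℝ (Fin 2)))
  have : LocallyCompactSpace QuotCyl :=
    ChartedSpace.locallyCompactSpace (ModelProd ℝ (EuclideanSpace ℝ (Fin 2))) QuotCyl
  infer_instance

theorem isLocalDiffeomorph_proj : IsLocalDiffeomorph cylModel cylModel ∞ proj :=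
  isLocalDiffeomorph_quotientProj cylModel ∞ fun u => contMDiff_smul_cylinder u

/-! ### The differential of an immersion -/

section Immersion

variable {E : Type*} [NormedAddCommGroup E] [NormedSpace ℝ E] {H : Type*} [TopologicalSpace H]
  {I : ModelWithCorners ℝ E H} [I.Boundaryless] {M : Type*} [TopologicalSpace M] [ChartedSpace H M]
  {E₂ : Type*} [NormedAddCommGroup E₂] [NormedSpace ℝ E₂] {H₂ : Type*} [TopologicalSpace H₂]
  {J : ModelWithCorners ℝ E₂ H₂} {M₂ : Type*} [TopologicalSpace M₂] [ChartedSpace H₂ M₂]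
  {n : ℕ∞ω} {f : M → M₂} {x : M}

theorem injective_mfderiv_of_isImmersionAt [IsManifold I n M] [IsManifold J n M₂] (hn : n ≠ 0)
    (hf : Manifold.IsImmersionAt I J n f x) : Function.Injective (mfderiv I J f x) := by
  let φ := hf.domChart.extend I
  let ψ := hf.codChart.extend J
  let g : M₂ → M := fun y => φ.symm (hf.equiv.symm (ψ y)).1
  have hx : x ∈ hf.domChart.source := hf.mem_domChart_source
  have hsrc : φ.source = hf.domChart.source := hf.domChart.extend_source
  have hval : ∀ y ∈ hf.domChart.source, hf.equiv.symm (ψ (f y)) = (φ y, 0) := by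
    intro y hy
    have h1 := hf.writtenInCharts (φ.map_source (by rw [hsrc]; exact hy))
    simp only [Function.comp] at h1
    rw [φ.left_inv (by rw [hsrc]; exact hy)] at h1
    rw [h1]
    simp
  have hgf : ∀ y ∈ hf.domChart.source, g (f y) = y := by
    intro y hy
    simp only [g, hval y hy]
    exact φ.left_inv (by rw [hsrc]; exact hy)
  have hψ : ContMDiffAt J 𝓘(ℝ, E₂) n ψ (f x) :=
    hf.codChart.contMDiffAt_extend hf.codChart_mem_maximalAtlas hf.mem_codChart_source
  have hφ : ContMDiffAt 𝓘(ℝ, E) I n φ.symm (hf.equiv.symm (ψ (f x))).1 := by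
    rw [hval x hx]
    refine (contMDiffOn_extend_symm hf.domChart_mem_maximalAtlas).contMDiffAt ?_
    refine Filter.mem_of_superset (hf.domChart.isOpen_extend_target.mem_nhds
      (φ.map_source (by rw [hsrc]; exact hx))) ?_
    rw [OpenPartialHomeomorph.extend_target, ← I.image_eq]
  have hlin : ContMDiffAt 𝓘(ℝ, E₂) 𝓘(ℝ, E) n (fun v => (hf.equiv.symm v).1) (ψ (f x)) :=
    (contDiff_fst.comp hf.equiv.symm.contDiff).contMDiff.contMDiffAt
  have hg : ContMDiffAt J I n g (f x) := by
    have h1 : ContMDiffAt J 𝓘(ℝ, E) n ((fun v => (hf.equiv.symm v).1) ∘ ψ) (f x) :=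
      ContMDiffAt.comp (f x) hlin hψ
    exact ContMDiffAt.comp (f x) hφ h1
  have hid : mfderiv I I (g ∘ f) x = ContinuousLinearMap.id ℝ (TangentSpace I x) := by
    have : g ∘ f =ᶠ[𝓝 x] id := by
      filter_upwards [hf.domChart.open_source.mem_nhds hx] with y hy
      exact hgf y hy
    rw [this.mfderiv_eq, mfderiv_id]
  rw [mfderiv_comp x (hg.mdifferentiableAt hn) (hf.contMDiffAt.mdifferentiableAt hn)] at hid
  intro v w hvw
  have h1 := DFunLike.congr_fun hid v
  have h2 := DFunLike.congr_fun hid w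
  simp only [ContinuousLinearMap.comp_apply, hvw] at h1 h2
  exact h1.symm.trans h2

end Immersion

/-! ### The Riemannian metric of the quotient -/

/-- The coordinate `t` on the cylinder. -/
def height (p : Cylinder) : ℝ := p.1

/-- The coordinate `ω`, seen as a vector of `ℝ³`. -/
def direction (p : Cylinder) : EuclideanSpace ℝ (Fin 3) := p.2

theorem contMDiff_height : ContMDiff cylModel 𝓘(ℝ, ℝ) ∞ height :=
  contMDiff_subtype_val.comp contMDiff_fst

theorem contMDiff_direction :
    ContMDiff cylModel 𝓘(ℝ, EuclideanSpace ℝ (Fin 3)) ∞ direction :=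
  contMDiff_coe_sphere.comp contMDiff_snd

/-- The inner product of a Euclidean space as a continuous bilinear form. -/
def euclForm (F : Type*) [NormedAddCommGroup F] [InnerProductSpace ℝ F] : F →L[ℝ] F →L[ℝ] ℝ :=
  innerSL ℝ

theorem euclForm_apply {F : Type*} [NormedAddCommGroup F] [InnerProductSpace ℝ F] (v w : F) :
    euclForm F v w = inner ℝ v w := rfl

/-- The pull back of a bilinear form under a linear map. -/
def pullForm {T F : Type*} [TopologicalSpace T] [AddCommGroup T] [Module ℝ T]
    [IsTopologicalAddGroup T] [ContinuousConstSMul ℝ T]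
    [TopologicalSpace F] [AddCommGroup F] [Module ℝ F]
    [IsTopologicalAddGroup F] [ContinuousConstSMul ℝ F]
    (B : F →L[ℝ] F →L[ℝ] ℝ) (A : T →L[ℝ] F) : T →L[ℝ] T →L[ℝ] ℝ :=
  (ContinuousLinearMap.precomp ℝ A) ∘L B ∘L A

theorem pullForm_apply {T F : Type*} [TopologicalSpace T] [AddCommGroup T] [Module ℝ T]
    [IsTopologicalAddGroup T] [ContinuousConstSMul ℝ T]
    [TopologicalSpace F] [AddCommGroup F] [Module ℝ F]
    [IsTopologicalAddGroup F] [ContinuousConstSMul ℝ F]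
    (B : F →L[ℝ] F →L[ℝ] ℝ) (A : T →L[ℝ] F) (v w : T) : pullForm B A v w = B (A v) (A w) := rfl

section
variable {E : Type*} [NormedAddCommGroup E] [NormedSpace ℝ E] {H : Type*} [TopologicalSpace H]
  {I : ModelWithCorners ℝ E H} {M : Type*} [TopologicalSpace M] [ChartedSpace H M]
  [IsManifold I ∞ M]
  {F : Type*} [NormedAddCommGroup F] [InnerProductSpace ℝ F]

set_option synthInstance.maxHeartbeats 400000 in
set_option maxHeartbeats 1000000 in
theorem contDiff_pullForm :
    ContDiff ℝ ∞ (fun A : E →L[ℝ] F => ((ContinuousLinearMap.compL ℝ E F ℝ).flip A).comp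
        ((euclForm F).comp A)) :=
  ((ContinuousLinearMap.compL ℝ E F ℝ).flip.contDiff).clm_comp
      (contDiff_const.clm_comp contDiff_id)

theorem contMDiffAt_pullback_form (x : M) (h : M → F) (hh : ContMDiffAt I 𝓘(ℝ, F) ∞ h x) :
    ContMDiffAt I (I.prod 𝓘(ℝ, E →L[ℝ] E →L[ℝ] ℝ)) ∞
      (fun y => Bundle.TotalSpace.mk' (E →L[ℝ] E →L[ℝ] ℝ)
        (E := fun y : M => TangentSpace I y →L[ℝ] TangentSpace I y →L[ℝ] ℝ) y
        (pullForm (euclForm F) (mvfderiv I h y))) x := by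
  have h1 := ContMDiffAt.mfderiv_const hh (m := ∞) (by simp)
  rw [Bundle.contMDiffAt_section]
  refine (contDiff_pullForm.contMDiff.contMDiffAt.comp x h1).congr_of_eventuallyEq ?_
  have hx : ∀ᶠ y in 𝓝 x, y ∈ (chartAt H x).source :=
    (chartAt H x).open_source.mem_nhds (mem_chart_source _ x)
  filter_upwards [hx] with y hy
  have hb : y ∈ (trivializationAt E (TangentSpace I : M → Type _) x).baseSet := hy
  ext v w
  simp only [hom_trivializationAt_apply]
  rw [inCoordinates_apply_eq₂ hb hb (Set.mem_univ _)]
  simp [pullForm_apply, inTangentCoordinates, ContinuousLinearMap.inCoordinates]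
  have hA : ∀ v : E, mvfderiv I h y ((trivializationAt E (TangentSpace I : M → Type _) x).symm y v) =
      ((1 : F →L[ℝ] F) ∘L (mfderiv I 𝓘(ℝ, F) h y : E →L[ℝ] F) ∘L
        (Bundle.Trivialization.symmL ℝ
          (trivializationAt E (TangentSpace I : M → Type _) x) y : E →L[ℝ] E)) v := by
    intro v
    rw [← Bundle.Trivialization.symmL_apply (R := ℝ) _ hb]
    rfl
  rw [hA, hA]
  rfl
end

/-- The standard product metric of `]-1,1[ × S²`, that is `dt² + |dω|²`. -/
def cylMetric (p : Cylinder) :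
    TangentSpace cylModel p →L[ℝ] TangentSpace cylModel p →L[ℝ] ℝ :=
  pullForm (euclForm ℝ) (mvfderiv cylModel height p) +
    pullForm (euclForm (EuclideanSpace ℝ (Fin 3))) (mvfderiv cylModel direction p)

/-- A local section of the projection, defined near `x`. -/
def localSection (x : QuotCyl) : OpenPartialHomeomorph QuotCyl Cylinder :=
  (isLocalHomeomorph_quotientProj (M := Cylinder) (G := ℤˣ)).localInverseAt (Quotient.out x)

theorem mem_localSection_source (x : QuotCyl) : x ∈ (localSection x).source := by
  have h : quotientProj Cylinder ℤˣ (Quotient.out x) = x := Quotient.out_eq x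
  have h2 := (isLocalHomeomorph_quotientProj (M := Cylinder) (G := ℤˣ)).apply_self_mem_localInverseAt_source
    (x := Quotient.out x)
  rw [h] at h2
  exact h2

theorem contMDiffOn_localSection (x : QuotCyl) :
    ContMDiffOn cylModel cylModel ∞ (localSection x) (localSection x).source :=
  contMDiffOn_localInverse_quotientProj cylModel ∞ (fun u => contMDiff_smul_cylinder u) _

/-- The Riemannian metric of the quotient, for which the projection is a local isometry: the pull
back of the metric of the cylinder under local sections of the projection. -/
def quotMetric (x : QuotCyl) : TangentSpace cylModel x →L[ℝ] TangentSpace cylModel x →L[ℝ] ℝ :=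
  pullForm (cylMetric (localSection x x)) (mfderiv cylModel cylModel (localSection x) x)

theorem mvfderiv_eq_smul_of_eventuallyEq {F : Type*} [NormedAddCommGroup F] [NormedSpace ℝ F]
    {x : QuotCyl} {f g : QuotCyl → F} (c : ℝ) (hg : MDifferentiableAt cylModel 𝓘(ℝ, F) g x)
    (h : f =ᶠ[𝓝 x] c • g) : mvfderiv cylModel f x = c • mvfderiv cylModel g x := by
  have h1 : HasMFDerivAt cylModel 𝓘(ℝ, F) f x _ :=
    (hg.hasMFDerivAt.const_smul c).congr_of_eventuallyEq h
  have h2 := h1.mfderiv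
  ext v
  exact DFunLike.congr_fun h2 v

theorem mvfderiv_comp_localSection {F : Type*} [NormedAddCommGroup F] [NormedSpace ℝ F]
    (f : Cylinder → F) (hf : ContMDiff cylModel 𝓘(ℝ, F) ∞ f) (u : ℤˣ)
    (hfu : ∀ p : Cylinder, f (u • p : Cylinder) = signVal u • f p)
    (x : QuotCyl) (s : QuotCyl → Cylinder) (hs : ContMDiffAt cylModel cylModel ∞ s x)
    (h1 : ⇑(localSection x) =ᶠ[𝓝 x] fun y => (u • s y : Cylinder)) (v : TangentSpace cylModel x) :
    mvfderiv cylModel f (localSection x x) (mfderiv cylModel cylModel (localSection x) x v) =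
        signVal u • mvfderiv cylModel (f ∘ s) x v := by
  have hsx : MDifferentiableAt cylModel cylModel (localSection x) x :=
    ((contMDiffOn_localSection x).contMDiffAt
      ((localSection x).open_source.mem_nhds (mem_localSection_source x))).mdifferentiableAt
      (by simp)
  have h3 := mfderiv_comp_apply x (g := f) (f := localSection x)
    (I := cylModel) (I' := cylModel) (I'' := 𝓘(ℝ, F))
    (hf.mdifferentiableAt (by simp)) hsx v
  refine h3.symm.trans ?_
  have h2 := mvfderiv_eq_smul_of_eventuallyEq (f := f ∘ localSection x) (signVal u)
      ((hf.contMDiffAt.comp x hs).mdifferentiableAt (by simp)) (by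
        filter_upwards [h1] with y hy
        simp only [Function.comp, hy, hfu]
        rfl)
  exact DFunLike.congr_fun h2 v

theorem exists_localSection_eventuallyEq (x : QuotCyl) (s : QuotCyl → Cylinder)
    (hs : ContinuousAt s x) (hps : ∀ᶠ y in 𝓝 x, proj (s y) = y) :
    ∃ u : ℤˣ, ⇑(localSection x) =ᶠ[𝓝 x] fun y => (u • s y : Cylinder) := by
  have hpx : proj (s x) = x := hps.self_of_nhds
  obtain ⟨u, hu⟩ := localInverse_comp_proj_eventuallyEq (G := ℤˣ) (Quotient.out x) (s x)
    (by
      change proj (s x) ∈ (localSection x).source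
      rw [hpx]; exact mem_localSection_source x)
  refine ⟨u, ?_⟩
  filter_upwards [hps, hs.eventually hu] with y hy hy'
  refine Eq.trans ?_ hy'
  change localSection x y = localSection x (proj (s y))
  rw [hy]

theorem quotMetric_eq_of_section (x : QuotCyl) (s : QuotCyl → Cylinder)
    (hs : ContMDiffAt cylModel cylModel ∞ s x) (hps : ∀ᶠ y in 𝓝 x, proj (s y) = y) :
    quotMetric x =
      pullForm (euclForm ℝ) (mvfderiv cylModel (height ∘ s) x) +
      pullForm (euclForm (EuclideanSpace ℝ (Fin 3))) (mvfderiv cylModel (direction ∘ s) x) := by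
  obtain ⟨u, h1⟩ := exists_localSection_eventuallyEq x s hs.continuousAt hps
  have hh' := mvfderiv_comp_localSection height contMDiff_height u (fun _ => rfl) x s hs h1
  have hd' := mvfderiv_comp_localSection direction contMDiff_direction u (fun _ => rfl) x s hs h1
  ext v w
  have e1 : quotMetric x v w =
      euclForm ℝ (mvfderiv cylModel height (localSection x x)
        (mfderiv cylModel cylModel (localSection x) x v))
        (mvfderiv cylModel height (localSection x x)
        (mfderiv cylModel cylModel (localSection x) x w)) +
      euclForm _ (mvfderiv cylModel direction (localSection x x)
        (mfderiv cylModel cylModel (localSection x) x v))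
        (mvfderiv cylModel direction (localSection x x)
        (mfderiv cylModel cylModel (localSection x) x w)) := rfl
  rw [e1, hh', hh', hd', hd']
  simp only [add_apply, pullForm_apply, euclForm_apply, real_inner_smul_left,
    real_inner_smul_right, ← mul_assoc, signVal_mul_self, one_mul]

theorem proj_localSection (x : QuotCyl) : ∀ᶠ y in 𝓝 x, proj (localSection x y) = y := by
  filter_upwards [(localSection x).open_source.mem_nhds (mem_localSection_source x)] with y hy
  exact (isLocalHomeomorph_quotientProj (M := Cylinder) (G := ℤˣ)).apply_localInverseAt_of_mem hy

theorem contMDiffAt_localSection (x : QuotCyl) :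
    ContMDiffAt cylModel cylModel ∞ (localSection x) x :=
  (contMDiffOn_localSection x).contMDiffAt
      ((localSection x).open_source.mem_nhds (mem_localSection_source x))

theorem contMDiff_quotMetric :
    ContMDiff cylModel (cylModel.prod
      𝓘(ℝ, (ℝ × EuclideanSpace ℝ (Fin 2)) →L[ℝ] (ℝ × EuclideanSpace ℝ (Fin 2)) →L[ℝ] ℝ)) ∞
      (fun y => Bundle.TotalSpace.mk' ((ℝ × EuclideanSpace ℝ (Fin 2)) →L[ℝ]
        (ℝ × EuclideanSpace ℝ (Fin 2)) →L[ℝ] ℝ)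
        (E := fun y : QuotCyl => TangentSpace cylModel y →L[ℝ] TangentSpace cylModel y →L[ℝ] ℝ) y
        (quotMetric y)) := by
  intro x
  have h1 := contMDiffAt_pullback_form x (height ∘ localSection x)
    (contMDiff_height.contMDiffAt.comp x (contMDiffAt_localSection x))
  have h2 := contMDiffAt_pullback_form x (direction ∘ localSection x)
    (contMDiff_direction.contMDiffAt.comp x (contMDiffAt_localSection x))
  refine (h1.add_section h2).congr_of_eventuallyEq ?_
  filter_upwards [(localSection x).open_source.mem_nhds (mem_localSection_source x),
    (proj_localSection x).eventually_nhds] with y hy hy'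
  rw [quotMetric_eq_of_section y (localSection x) ((contMDiffOn_localSection x).contMDiffAt
      ((localSection x).open_source.mem_nhds hy)) hy']
  rfl

theorem injective_mvfderiv_interval (t : OpenInterval) :
    Function.Injective (mvfderiv 𝓘(ℝ, ℝ) (Subtype.val : OpenInterval → ℝ) t) := by
  have h := (Manifold.IsSmoothEmbedding.of_opens (I := 𝓘(ℝ, ℝ)) (n := ∞) OpenInterval)
  exact injective_mfderiv_of_isImmersionAt (by simp) (h.isImmersion.isImmersionAt t)

theorem eq_zero_of_cylMetric_eq_zero (p : Cylinder) (w : TangentSpace cylModel p)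
    (hw : cylMetric p w w = 0) : w = 0 := by
  have e1 : cylMetric p w w = inner ℝ (mvfderiv cylModel height p w) (mvfderiv cylModel height p w) +
      inner ℝ (mvfderiv cylModel direction p w) (mvfderiv cylModel direction p w) := rfl
  rw [e1, real_inner_self_eq_norm_sq, real_inner_self_eq_norm_sq] at hw
  have h1 : mvfderiv cylModel height p w = 0 := by
    rw [← norm_eq_zero]; nlinarith [sq_nonneg ‖mvfderiv cylModel height p w‖,
      sq_nonneg ‖mvfderiv cylModel direction p w‖]
  have h2 : mvfderiv cylModel direction p w = 0 := by
    rw [← norm_eq_zero]; nlinarith [sq_nonneg ‖mvfderiv cylModel height p w‖,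
      sq_nonneg ‖mvfderiv cylModel direction p w‖]
  have c1 : mvfderiv cylModel height p w =
      mvfderiv 𝓘(ℝ, ℝ) (Subtype.val : OpenInterval → ℝ) p.1 w.1 := by
    have h := mfderiv_comp_apply p (g := (Subtype.val : OpenInterval → ℝ)) (f := Prod.fst)
      (I := cylModel) (I' := 𝓘(ℝ, ℝ)) (I'' := 𝓘(ℝ, ℝ))
      (contMDiff_subtype_val.mdifferentiableAt (n := ∞) (by simp)) mdifferentiableAt_fst w
    rw [mfderiv_fst] at h
    exact h
  have c2 : mvfderiv cylModel direction p w =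
      mvfderiv (𝓡 2) (Subtype.val : Sphere2 → EuclideanSpace ℝ (Fin 3)) p.2 w.2 := by
    have h := mfderiv_comp_apply p
      (g := (Subtype.val : Sphere2 → EuclideanSpace ℝ (Fin 3))) (f := Prod.snd)
      (I := cylModel) (I' := 𝓡 2) (I'' := 𝓘(ℝ, EuclideanSpace ℝ (Fin 3)))
      ((contMDiff_coe_sphere (n := 2) (m := ∞)).mdifferentiableAt (by simp))
      mdifferentiableAt_snd w
    rw [mfderiv_snd] at h
    exact h
  rw [c1] at h1
  rw [c2] at h2
  have d1 : w.1 = 0 := injective_mvfderiv_interval p.1 (h1.trans (map_zero _).symm)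
  have d2 : w.2 = 0 := injective_mvfderiv_subtypeVal_sphere p.2 (h2.trans (map_zero _).symm)
  exact Prod.ext d1 d2

theorem cylMetric_symm (p : Cylinder) (v w : TangentSpace cylModel p) :
    cylMetric p v w = cylMetric p w v := by
  have e1 : ∀ v w, cylMetric p v w =
      inner ℝ (mvfderiv cylModel height p v) (mvfderiv cylModel height p w) +
      inner ℝ (mvfderiv cylModel direction p v) (mvfderiv cylModel direction p w) := fun _ _ => rfl
  rw [e1, e1, real_inner_comm, real_inner_comm (mvfderiv cylModel direction p w)]

theorem cylMetric_self_nonneg (p : Cylinder) (v : TangentSpace cylModel p) :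
    0 ≤ cylMetric p v v := by
  have e1 : cylMetric p v v = inner ℝ (mvfderiv cylModel height p v) (mvfderiv cylModel height p v) +
      inner ℝ (mvfderiv cylModel direction p v) (mvfderiv cylModel direction p v) := rfl
  rw [e1]
  exact add_nonneg real_inner_self_nonneg real_inner_self_nonneg

theorem quotMetric_apply (x : QuotCyl) (v w : TangentSpace cylModel x) :
    quotMetric x v w = cylMetric (localSection x x)
      (mfderiv cylModel cylModel (localSection x) x v)
      (mfderiv cylModel cylModel (localSection x) x w) := rfl

theorem quotMetric_symm (x : QuotCyl) (v w : TangentSpace cylModel x) :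
    quotMetric x v w = quotMetric x w v := by
  rw [quotMetric_apply, quotMetric_apply, cylMetric_symm]

theorem quotMetric_pos (x : QuotCyl) (v : TangentSpace cylModel x) (hv : v ≠ 0) :
    0 < quotMetric x v v := by
  rw [quotMetric_apply]
  refine lt_of_le_of_ne (cylMetric_self_nonneg _ _) fun h => hv ?_
  have h1 : mfderiv cylModel cylModel (localSection x) x v = 0 :=
    eq_zero_of_cylMetric_eq_zero _ _ h.symm
  have hid : mfderiv cylModel cylModel (proj ∘ localSection x) x =
      ContinuousLinearMap.id ℝ (TangentSpace cylModel x) := by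
    have : proj ∘ localSection x =ᶠ[𝓝 x] id := proj_localSection x
    rw [this.mfderiv_eq, mfderiv_id]
  rw [mfderiv_comp (I := cylModel) (I' := cylModel) (I'' := cylModel) x
    (isLocalDiffeomorph_proj.contMDiff.mdifferentiableAt (by simp))
    ((contMDiffAt_localSection x).mdifferentiableAt (by simp))] at hid
  have h2 := DFunLike.congr_fun hid v
  simp only [ContinuousLinearMap.comp_apply, h1, map_zero] at h2
  exact h2.symm

theorem isVonNBounded_of_posDef {E : Type*} [NormedAddCommGroup E] [NormedSpace ℝ E]
    [FiniteDimensional ℝ E] (B : E →L[ℝ] E →L[ℝ] ℝ) (hB : ∀ v, v ≠ 0 → 0 < B v v) :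
    Bornology.IsVonNBounded ℝ {v : E | B v v < 1} := by
  rw [NormedSpace.isVonNBounded_iff]
  rcases subsingleton_or_nontrivial E with hE | hE
  · exact (Set.toFinite _).isBounded
  have hcont : Continuous fun v : E => B v v := by fun_prop
  obtain ⟨u, hu, hmin⟩ := (isCompact_sphere (0 : E) 1).exists_isMinOn
    (NormedSpace.sphere_nonempty.2 zero_le_one) hcont.continuousOn
  have hu0 : u ≠ 0 := by
    rintro rfl
    simp at hu
  have hc := hB u hu0
  refine (Metric.isBounded_ball (x := (0 : E)) (r := 1 + 1 / B u u)).subset fun v hv => ?_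
  rw [mem_ball_zero_iff]
  by_cases hv0 : v = 0
  · rw [hv0, norm_zero]; positivity
  have hvn : 0 < ‖v‖ := norm_pos_iff.2 hv0
  have h1 : B u u ≤ B (‖v‖⁻¹ • v) (‖v‖⁻¹ • v) := hmin (by
    rw [mem_sphere_zero_iff_norm, norm_smul, norm_inv, norm_norm, inv_mul_cancel₀ hvn.ne'])
  simp only [map_smul, smul_eq_mul, smul_apply] at h1
  have hv1 : B v v < 1 := hv
  have h2 : B u u * ‖v‖ ^ 2 < 1 := by
    have : ‖v‖ ^ 2 * (‖v‖⁻¹ * (‖v‖⁻¹ * B v v)) = B v v := by field_simp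
    nlinarith [sq_nonneg ‖v‖]
  have h3 : ‖v‖ ^ 2 < 1 / B u u := by
    rw [lt_div_iff₀ hc]; linarith
  nlinarith [sq_nonneg (‖v‖ - 1), one_div_pos.2 hc]

/-- The Riemannian metric of `N`. -/
def quotRiemannianMetric : Bundle.ContMDiffRiemannianMetric cylModel ∞ (ℝ × EuclideanSpace ℝ (Fin 2))
    (fun x : QuotCyl => TangentSpace cylModel x) where
  inner := quotMetric
  symm := quotMetric_symm
  pos := quotMetric_pos
  isVonNBounded x := isVonNBounded_of_posDef
    (E := ℝ × EuclideanSpace ℝ (Fin 2)) (quotMetric x) (quotMetric_pos x)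
  contMDiff := contMDiff_quotMetric

instance : Bundle.RiemannianBundle (fun x : QuotCyl => TangentSpace cylModel x) :=
  ⟨quotRiemannianMetric.toRiemannianMetric⟩

theorem inner_tangentSpace_quotCyl (x : QuotCyl) (v w : TangentSpace cylModel x) :
    inner ℝ v w = quotMetric x v w := rfl

instance : IsContMDiffRiemannianBundle cylModel ∞ (ℝ × EuclideanSpace ℝ (Fin 2))
    (fun x : QuotCyl => TangentSpace cylModel x) :=
  ⟨quotMetric, contMDiff_quotMetric, fun _ _ _ => rfl⟩

instance : IsContinuousRiemannianBundle (ℝ × EuclideanSpace ℝ (Fin 2))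
    (fun x : QuotCyl => TangentSpace cylModel x) :=
  ⟨quotMetric, contMDiff_quotMetric.continuous, fun _ _ _ => rfl⟩

/-- The Riemannian distance of `N`. -/
instance : EMetricSpace QuotCyl := EMetricSpace.ofRiemannianMetric cylModel QuotCyl

instance : MeasurableSpace QuotCyl := borel QuotCyl

instance : BorelSpace QuotCyl := ⟨rfl⟩

theorem mdifferentiable_proj : MDifferentiable cylModel cylModel proj :=
  isLocalDiffeomorph_proj.contMDiff.mdifferentiable (by simp)

/-- The projection is a local isometry. -/
theorem inner_mfderiv_proj (p : Cylinder) (v w : TangentSpace cylModel p) :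
    quotMetric (proj p) (mfderiv cylModel cylModel proj p v) (mfderiv cylModel cylModel proj p w) =
      cylMetric p v w := by
  obtain ⟨u, hu⟩ := localInverse_comp_proj_eventuallyEq (G := ℤˣ) (Quotient.out (proj p)) p
    (mem_localSection_source (proj p))
  have key : ∀ {F : Type} [NormedAddCommGroup F] [NormedSpace ℝ F] (f : Cylinder → F)
      (_ : ContMDiff cylModel 𝓘(ℝ, F) ∞ f)
      (_ : ∀ q : Cylinder, f (u • q : Cylinder) = signVal u • f q) (v : TangentSpace cylModel p),
      mvfderiv cylModel f (localSection (proj p) (proj p))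
        (mfderiv cylModel cylModel (localSection (proj p)) (proj p)
          (mfderiv cylModel cylModel proj p v)) = signVal u • mvfderiv cylModel f p v := by
    intro F _ _ f hf hfu v
    have hs : MDifferentiableAt cylModel cylModel (localSection (proj p)) (proj p) :=
      (contMDiffAt_localSection (proj p)).mdifferentiableAt (by simp)
    have h1 := mfderiv_comp_apply (proj p) (g := f) (f := localSection (proj p))
      (I := cylModel) (I' := cylModel) (I'' := 𝓘(ℝ, F))
      (hf.mdifferentiableAt (by simp)) hs (mfderiv cylModel cylModel proj p v)
    have h2 := mfderiv_comp_apply p (g := f ∘ localSection (proj p)) (f := proj)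
      (I := cylModel) (I' := cylModel) (I'' := 𝓘(ℝ, F))
      (MDifferentiableAt.comp (proj p) (hf.mdifferentiableAt (by simp)) hs)
      (mdifferentiable_proj p) v
    have h3 : ((f ∘ localSection (proj p)) ∘ proj) =ᶠ[𝓝 p] signVal u • f := by
      filter_upwards [hu] with q hq
      exact (congrArg f hq).trans (hfu q)
    have h4 : HasMFDerivAt cylModel 𝓘(ℝ, F) ((f ∘ localSection (proj p)) ∘ proj) p _ :=
      ((hf.mdifferentiableAt (by simp) (x := p)).hasMFDerivAt.const_smul
        (signVal u)).congr_of_eventuallyEq h3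
    have h5 := DFunLike.congr_fun h4.mfderiv v
    exact (h1.symm.trans h2.symm).trans h5
  have kh := key height contMDiff_height (fun _ => rfl)
  have kd := key direction contMDiff_direction (fun _ => rfl)
  have e1 : ∀ v w, quotMetric (proj p) (mfderiv cylModel cylModel proj p v)
      (mfderiv cylModel cylModel proj p w) =
      euclForm ℝ (mvfderiv cylModel height (localSection (proj p) (proj p))
        (mfderiv cylModel cylModel (localSection (proj p)) (proj p)
          (mfderiv cylModel cylModel proj p v)))
        (mvfderiv cylModel height (localSection (proj p) (proj p))
        (mfderiv cylModel cylModel (localSection (proj p)) (proj p)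
          (mfderiv cylModel cylModel proj p w))) +
      euclForm _ (mvfderiv cylModel direction (localSection (proj p) (proj p))
        (mfderiv cylModel cylModel (localSection (proj p)) (proj p)
          (mfderiv cylModel cylModel proj p v)))
        (mvfderiv cylModel direction (localSection (proj p) (proj p))
        (mfderiv cylModel cylModel (localSection (proj p)) (proj p)
          (mfderiv cylModel cylModel proj p w))) := fun _ _ => rfl
  rw [e1, kh, kh, kd, kd]
  simp only [euclForm_apply, real_inner_smul_left, real_inner_smul_right, ← mul_assoc,
    signVal_mul_self, one_mul]
  rfl

/-! ### Isotopies, almost minimizing surfaces, varifolds -/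

section General

open Manifold Filter Bundle

variable {E : Type} [NormedAddCommGroup E] [NormedSpace ℝ E]
  {H : Type} [TopologicalSpace H] (I : ModelWithCorners ℝ E H)
  {N : Type} [EMetricSpace N] [ChartedSpace H N]

/-- The two-dimensional Hausdorff measure, normalised such that it agrees with Lebesgue measure on
Euclidean planes. -/
def area [MeasurableSpace N] [BorelSpace N] : MeasureTheory.Measure N :=
  ENNReal.ofReal (Real.pi / 4) • MeasureTheory.Measure.hausdorffMeasure 2

/-- The open annulus `B_σ(x) ∖ closed B_τ(x)`. -/
def annulus (x : N) (τ σ : ℝ) : Set N :=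
  Metric.eball x (ENNReal.ofReal σ) \ Metric.closedEBall x (ENNReal.ofReal τ)

/-- Smooth isotopies `ψ : [0,1] × N → N` which leave `N ∖ U` fixed. -/
structure IsIsotopyIn (U : Set N) (ψ : Icc (0 : ℝ) 1 × N → N) : Prop where
  contMDiff : ContMDiff ((𝓡∂ 1).prod I) I ∞ ψ
  map_zero : ∀ x, ψ (0, x) = x
  diffeo : ∀ t, ∃ Φ : N ≃ₘ^∞⟮I, I⟯ N, ∀ x, ψ (t, x) = Φ x
  fixed : ∀ t, ∀ x, x ∉ U → ψ (t, x) = x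

/-- The surface `S` is `ε`-almost minimizing in `U`: no isotopy in `U` decreases the area of `S` by
at least `ε` while keeping it at most `ε / 8` above the initial one. -/
def IsAlmostMinimizing [MeasurableSpace N] [BorelSpace N] (ε : ℝ) (U S : Set N) : Prop :=
  ¬ ∃ ψ : Icc (0 : ℝ) 1 × N → N, IsIsotopyIn I U ψ ∧
    (∀ t, area ((fun x => ψ (t, x)) '' S) ≤ area S + ENNReal.ofReal (ε / 8)) ∧
    area ((fun x => ψ (1, x)) '' S) + ENNReal.ofReal ε ≤ area S

variable (N) in
/-- A compact smooth surface without boundary, smoothly embedded in `N`. -/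
structure EmbeddedSurface where
  /-- The underlying abstract surface. -/
  carrier : Type
  [topologicalSpace : TopologicalSpace carrier]
  [chartedSpace : ChartedSpace (EuclideanSpace ℝ (Fin 2)) carrier]
  [isManifold : IsManifold (𝓡 2) ∞ carrier]
  [compactSpace : CompactSpace carrier]
  /-- The embedding. -/
  toFun : carrier → N
  isSmoothEmbedding : IsSmoothEmbedding (𝓡 2) I ∞ toFun

attribute [instance] EmbeddedSurface.topologicalSpace EmbeddedSurface.chartedSpace
  EmbeddedSurface.isManifold EmbeddedSurface.compactSpace

variable [IsManifold I ∞ N] [RiemannianBundle (fun x : N => TangentSpace I x)]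

variable (N) in
/-- The Grassmannian bundle of unoriented two-dimensional tangent planes of `N`. -/
@[ext]
structure GrassmannBundle where
  /-- The base point. -/
  base : N
  /-- The plane. -/
  plane : Submodule ℝ (TangentSpace I base)
  finrank_plane : Module.finrank ℝ plane = 2

variable [FiniteDimensional ℝ E]

/-- A plane, seen as the orthogonal projection onto it. -/
def GrassmannBundle.toEndomorphism (p : GrassmannBundle I N) :
    Bundle.TotalSpace (E →L[ℝ] E)
      (fun x : N => TangentSpace I x →L[ℝ] TangentSpace I x) :=
  haveI : FiniteDimensional ℝ (TangentSpace I p.base) := inferInstanceAs (FiniteDimensional ℝ E)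
  ⟨p.base, p.plane.starProjection⟩

instance : TopologicalSpace (GrassmannBundle I N) :=
  TopologicalSpace.induced (GrassmannBundle.toEndomorphism I) inferInstance

instance : MeasurableSpace (GrassmannBundle I N) := borel _

instance : BorelSpace (GrassmannBundle I N) := ⟨rfl⟩

variable {I}

/-- The surface as a subset of `N`. -/
def EmbeddedSurface.toSet (S : EmbeddedSurface I N) : Set N := range S.toFun

/-- The tangent plane of a surface. -/
def EmbeddedSurface.tangentPlane (S : EmbeddedSurface I N) (s : S.carrier) :
    GrassmannBundle I N where
  base := S.toFun s
  plane := (mfderiv (𝓡 2) I S.toFun s).range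
  finrank_plane := by
    have h := LinearMap.finrank_range_of_inj (f := (mfderiv (𝓡 2) I S.toFun s).toLinearMap)
      (injective_mfderiv_of_isImmersionAt (by simp)
        (S.isSmoothEmbedding.isImmersion.isImmersionAt s))
    refine h.trans ?_
    exact finrank_euclideanSpace_fin

/-- The varifold induced by a surface `S`, that is the measure
`A ↦ H²({x ∈ S : (x, T_x S) ∈ A})` on the Grassmannian bundle. -/
def EmbeddedSurface.varifold [MeasurableSpace N] [BorelSpace N] (S : EmbeddedSurface I N) :
    MeasureTheory.Measure (GrassmannBundle I N) :=
  letI : MeasurableSpace S.carrier := borel S.carrier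
  ((area (N := N)).comap S.toFun).map S.tangentPlane

variable (I) in
/-- Convergence of varifolds: weak convergence of measures, tested on continuous functions with
compact support. -/
def VarifoldTendsto (V : ℕ → MeasureTheory.Measure (GrassmannBundle I N))
    (W : MeasureTheory.Measure (GrassmannBundle I N)) : Prop :=
  ∀ φ : GrassmannBundle I N → ℝ, Continuous φ → HasCompactSupport φ →
    Tendsto (fun j => ∫ p, φ p ∂(V j)) atTop (𝓝 (∫ p, φ p ∂W))

/-- The factor by which a linear map changes areas in the plane `P`: the square root of the Gram
determinant of the image of an orthonormal basis of `P`. -/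
def areaFactor {T T' : Type*} [NormedAddCommGroup T] [InnerProductSpace ℝ T]
    [NormedAddCommGroup T'] [InnerProductSpace ℝ T'] (P : Submodule ℝ T) [FiniteDimensional ℝ P]
    (L : T → T') : ℝ :=
  Real.sqrt (Matrix.det (Matrix.of fun i j =>
    inner ℝ (L (stdOrthonormalBasis ℝ P i)) (L (stdOrthonormalBasis ℝ P j))))

/-- The Jacobian `Jψ(x, π)` of a map `ψ` of `N` along the plane `π ⊆ T_x N`. -/
def planeJacobian (ψ : N → N) (p : GrassmannBundle I N) : ℝ :=
  haveI : FiniteDimensional ℝ (TangentSpace I p.base) := inferInstanceAs (FiniteDimensional ℝ E)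
  areaFactor p.plane (mfderiv I I ψ p.base)

/-- The map `ψ` is the flow of the vector field `χ`. -/
structure IsFlowOf (χ : (x : N) → TangentSpace I x) (ψ : ℝ → N → N) : Prop where
  contMDiff : ContMDiff (𝓘(ℝ, ℝ).prod I) I ∞ fun q : ℝ × N => ψ q.1 q.2
  map_zero : ∀ x, ψ 0 x = x
  integralCurve : ∀ x, IsMIntegralCurve (fun t => ψ t x) χ

/-- A varifold is stationary if its first variation vanishes: along the flow of every smooth
vector field with compact support, its mass has derivative zero. -/
def IsStationary (V : MeasureTheory.Measure (GrassmannBundle I N)) : Prop :=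
  ∀ χ : (x : N) → TangentSpace I x,
    ContMDiff I I.tangent ∞ (fun x => (⟨x, χ x⟩ : TangentBundle I N)) →
    IsCompact (closure {x | χ x ≠ 0}) →
    ∀ ψ : ℝ → N → N, IsFlowOf χ ψ →
      HasDerivAt (fun t => ∫ p, planeJacobian (ψ t) p ∂V) 0 0

/-- A sequence of surfaces is almost minimizing in sufficiently small annuli: for some positive
function `r`, in each annulus with centre `x` and outer radius at most `r x`, the `j`-th surface is
`1/j`-almost minimizing if `j` is large, and the surfaces converge to a stationary varifold. (The
surfaces are smooth everywhere.) -/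
def IsAlmostMinimizingInSmallAnnuli [MeasurableSpace N] [BorelSpace N]
    (S : ℕ → EmbeddedSurface I N) : Prop :=
  (∃ r : N → ℝ, (∀ x, 0 < r x) ∧ ∀ x : N, ∀ τ σ : ℝ, 0 < τ → τ < σ → σ ≤ r x →
    ∀ᶠ j : ℕ in atTop, IsAlmostMinimizing I (1 / (j : ℝ)) (annulus x τ σ) (S j).toSet) ∧
  ∃ V : MeasureTheory.Measure (GrassmannBundle I N), MeasureTheory.IsFiniteMeasure V ∧
    IsStationary V ∧ VarifoldTendsto I (fun j => (S j).varifold) V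

/-! ### Totally geodesic surfaces -/

/-- A geodesic of a length space, parametrised proportionally to arc length on the interval `J`:
locally, the distance is proportional to the difference of the parameters. -/
def IsGeodesicOn {X : Type*} (d : X → X → ℝ≥0∞) (γ : ℝ → X) (J : Set ℝ) : Prop :=
  ∃ c : ℝ, 0 ≤ c ∧ ∀ s₀ ∈ J, ∃ δ > 0, ∀ s ∈ J, ∀ s' ∈ J, |s - s₀| < δ → |s' - s₀| < δ →
    d (γ s) (γ s') = ENNReal.ofReal (c * |s - s'|)

/-- The distance on a surface which is induced by its embedding: the infimum of the lengths in `N`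
of paths in the surface. -/
def EmbeddedSurface.inducedEDist (S : EmbeddedSurface I N) (a b : S.carrier) : ℝ≥0∞ :=
  ⨅ (σ : ℝ → S.carrier) (_ : ContMDiffOn 𝓘(ℝ, ℝ) (𝓡 2) 1 σ (Icc 0 1)) (_ : σ 0 = a)
    (_ : σ 1 = b), pathELength I (S.toFun ∘ σ) 0 1

/-- A surface is totally geodesic if its geodesics, for the induced metric, are geodesics of `N`. -/
def EmbeddedSurface.IsTotallyGeodesic (S : EmbeddedSurface I N) : Prop :=
  ∀ (J : Set ℝ) (γ : ℝ → S.carrier), J.OrdConnected → IsGeodesicOn S.inducedEDist γ J →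
    IsGeodesicOn edist (S.toFun ∘ γ) J

end General

/-! ### Orientability and genus -/

section Genus

variable {E : Type*} [NormedAddCommGroup E] [NormedSpace ℝ E]
  {H : Type*} [TopologicalSpace H] (I : ModelWithCorners ℝ E H)
  {M : Type*} [TopologicalSpace M] [ChartedSpace H M]

/-- The open set `U` is orientable: it is covered by smooth charts whose transition maps have
positive Jacobian determinants. -/
def IsOrientableOn (U : Set M) : Prop :=
  ∃ A ⊆ IsManifold.maximalAtlas I ∞ M,
    (∀ e ∈ A, e.source ⊆ U) ∧ (∀ x ∈ U, ∃ e ∈ A, x ∈ e.source) ∧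
    ∀ e ∈ A, ∀ e' ∈ A, ∀ y ∈ (e.symm ≫ₕ e').source,
      0 < (fderivWithin ℝ (I ∘ (e.symm ≫ₕ e') ∘ I.symm) (range I) (I y)).det

/-- The space `Y` arises from `X` by attaching a handle: two disjoint closed discs of `X`, which
correspond to the unit discs around `2` and `-2` in an open set identified with `ℂ`, are replaced
by a tube joining their boundaries, that is, their interiors are removed and their boundaries are
glued along a reflection of `ℂ`. -/
def IsHandleAttachment (X Y : Type) [TopologicalSpace X] [TopologicalSpace Y] : Prop :=
  ∃ d : ℂ → X, Topology.IsOpenEmbedding d ∧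
    Nonempty (Y ≃ₜ Quot fun a b : {x : X // x ∉ d '' (Metric.ball 2 1 ∪ Metric.ball (-2) 1)} =>
      ∃ z : ℂ, ‖z - 2‖ = 1 ∧ (a : X) = d z ∧ (b : X) = d (-(starRingEnd ℂ) z))

/-- The space `Y` arises from `X` by attaching a cross cap: the interior of a disc of `X` is
removed, and opposite points of the boundary circle are identified. -/
def IsCrosscapAttachment (X Y : Type) [TopologicalSpace X] [TopologicalSpace Y] : Prop :=
  ∃ d : ℂ → X, Topology.IsOpenEmbedding d ∧
    Nonempty (Y ≃ₜ Quot fun a b : {x : X // x ∉ d '' Metric.ball 0 1} =>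
      ∃ z : ℂ, ‖z‖ = 1 ∧ (a : X) = d z ∧ (b : X) = d (-z))

/-- The space is homeomorphic to a sphere with `g` handles attached. -/
inductive IsSphereWithHandles : ℕ → (X : Type) → [TopologicalSpace X] → Prop
  | sphere (X : Type) [TopologicalSpace X] :
      Nonempty (X ≃ₜ Metric.sphere (0 : EuclideanSpace ℝ (Fin 3)) 1) → IsSphereWithHandles 0 X
  | attach (g : ℕ) (X Y : Type) [TopologicalSpace X] [TopologicalSpace Y] :
      IsSphereWithHandles g X → IsHandleAttachment X Y → IsSphereWithHandles (g + 1) Y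

/-- The space is homeomorphic to a sphere with `k` cross caps attached. -/
inductive IsSphereWithCrosscaps : ℕ → (X : Type) → [TopologicalSpace X] → Prop
  | sphere (X : Type) [TopologicalSpace X] :
      Nonempty (X ≃ₜ Metric.sphere (0 : EuclideanSpace ℝ (Fin 3)) 1) → IsSphereWithCrosscaps 0 X
  | attach (k : ℕ) (X Y : Type) [TopologicalSpace X] [TopologicalSpace Y] :
      IsSphereWithCrosscaps k X → IsCrosscapAttachment X Y → IsSphereWithCrosscaps (k + 1) Y

variable {S : Type} [TopologicalSpace S] [ChartedSpace (EuclideanSpace ℝ (Fin 2)) S]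

open Classical in
/-- The genus of a connected component of a compact surface: the number of handles, if it is
orientable, and the number of cross caps, if it is not, which one has to attach to a sphere in
order to get a surface homeomorphic to it. -/
def componentGenus (C : Set S) : ℕ :=
  if IsOrientableOn (𝓡 2) C then sInf {g | IsSphereWithHandles g C}
  else sInf {k | 1 ≤ k ∧ IsSphereWithCrosscaps k C}

variable (S) in
/-- The genus of a compact surface: the sum of the genera of its connected components. -/
def genus : ℕ :=
  ∑ᶠ c : ConnectedComponents S, componentGenus ((↑) ⁻¹' {c} : Set S)

end Genus

section Estimate

open Manifold Filter

variable {E : Type} [NormedAddCommGroup E] [NormedSpace ℝ E]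
  {H : Type} [TopologicalSpace H] {I : ModelWithCorners ℝ E H}
  {N : Type} [EMetricSpace N] [ChartedSpace H N]

/-- The surface is orientable. -/
def EmbeddedSurface.IsOrientable (S : EmbeddedSurface I N) : Prop :=
  IsOrientableOn (𝓡 2) (univ : Set S.carrier)

/-- The genus of an embedded surface. -/
def EmbeddedSurface.gen (S : EmbeddedSurface I N) : ℕ := genus S.carrier

open Classical in
/-- The estimate
`∑_{Γ i orientable} n i * gen (Γ i) + (1/2) * ∑_{Γ i non-orientable} n i * gen (Γ i) ≤
  liminf_j gen (S j)`
for connected surfaces `Γ i` with multiplicities `n i` and a sequence of surfaces `S j`. -/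
def StrongerEstimate {ι : Type} [Fintype ι] (n : ι → ℕ) (Γ : ι → EmbeddedSurface I N)
    (S : ℕ → EmbeddedSurface I N) : Prop :=
  ∑ i with (Γ i).IsOrientable, (n i : ℝ≥0∞) * ((Γ i).gen : ℝ≥0∞) +
      1 / 2 * ∑ i with ¬ (Γ i).IsOrientable, (n i : ℝ≥0∞) * ((Γ i).gen : ℝ≥0∞) ≤
    liminf (fun j => ((S j).gen : ℝ≥0∞)) atTop

end Estimate

/-! ### The surfaces of the example -/

/-- The map `ω ↦ π(t, ω)`, whose image is `π({t} × S²)`. -/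
def sliceMap (t : OpenInterval) (w : Sphere2) : QuotCyl := proj (t, w)

/-- The origin of `]-1,1[`. -/
def originInterval : OpenInterval := ⟨0, by norm_num⟩

/-- The map `±ω ↦ π(0, ω)` on the projective plane, whose image is `π({0} × S²)`. -/
def planeMap : ProjPlane → QuotCyl :=
  Quotient.lift (sliceMap originInterval) (by
    intro w w' h
    obtain ⟨u, rfl⟩ := h
    refine quotientProj_eq_iff.2 ⟨u, ?_⟩
    refine Prod.ext (Subtype.ext ?_) rfl
    change signVal u * (0 : ℝ) = 0
    exact mul_zero _)

/-- The surface `π({t} × S²)` as an embedded sphere, if the map `ω ↦ π(t, ω)` is an embedding. -/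
def sphereSurface (t : OpenInterval)
    (h : Manifold.IsSmoothEmbedding (𝓡 2) cylModel ∞ (sliceMap t)) :
    EmbeddedSurface cylModel QuotCyl where
  carrier := Sphere2
  toFun := sliceMap t
  isSmoothEmbedding := h

/-- The surface `π({0} × S²)` as an embedded projective plane, if the map `±ω ↦ π(0, ω)` is an
embedding. -/
def planeSurface (h : Manifold.IsSmoothEmbedding (𝓡 2) cylModel ∞ planeMap) :
    EmbeddedSurface cylModel QuotCyl where
  carrier := ProjPlane
  toFun := planeMap
  isSmoothEmbedding := h

end

end GenusBound

namespace GenusBound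

noncomputable section

open Manifold MeasureTheory Filter

/-! ### Paths in the quotient and in the cylinder -/

/-! For `t > 0` the slice at height `t` is an embedded copy of `S²`, and it is also the slice at
height `-t`. As `t → 0` its two sheets close up onto the projective plane at height `0`, which is
therefore doubly covered. Local geometry does not change with `t`, but the topology of the limit
does.

Metric facts come from path lifting. A path in `N` lifts to the cylinder, and its length bounds both
the length of its sphere component and its change of height (`exists_path_of_edist_lt`). Hence
slices are locally isometric to the sphere (`edist_sliceMap_eq`), which makes them totally geodesic,
and retracting onto the central slice does not increase distances (`edist_sliceMap_origin_le`). All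
slices with `t > 0` pull the area back to one rotation invariant measure `sphArea`, whose push
forward to the projective plane is twice the area there (`map_sphArea_eq_two_smul`).

The varifold of a slice is the push forward of `sphArea` under `slicePlane t`. Continuity of the
tangent planes in `t` gives convergence to twice the plane (`continuous_slicePlane`,
`varifoldTendsto_slicePlane`). Stationarity (`isStationary_slicePlane`) holds because the first
variation is the integral over the sphere of the divergence of a tangential field, which vanishes by
rotation invariance (`integral_divergence_eq_zero`).

For almost minimality, slices with large index avoid small annuli centred off the limit plane. Near
a centre on the plane, no homeomorphism supported in the annulus can decrease the area at all. Each
vertical segment over a small patch must cross the image of each sheet by the intermediate value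
theorem, and projecting that image to the central slice does not increase its area
(`area_range_sliceMap_le`).

Orientability is read off the sign of a determinant formed by a normal vector and a local immersion
into a Euclidean space of one dimension more. Local lifts are unique up to `±1`, and this sign
enters with the power given by the ambient dimension. It disappears in `ℝ × ℝ³`, so `N` is
orientable. It survives in `ℝ³`, where it would split the connected sphere into two open sets
exchanged by the antipodal map (`not_isOrientableOn_projPlane`). The projective plane is a
hemisphere with antipodal points of its boundary identified, that is, a sphere with one cross cap
(`isCrosscapAttachment_projPlane`). The two estimates thus become `1 ≤ 0` and `(1/2) * 2 * 1 ≤ 0`.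
-/

/-- Euclidean three-space. -/
abbrev E3 : Type := EuclideanSpace ℝ (Fin 3)

/-- The length of a path in the unit sphere. -/
def sphLength (σ : ℝ → Sphere2) : ℝ≥0∞ :=
  ∫⁻ s in Ioo (0 : ℝ) 1, ‖deriv (fun s => (σ s : E3)) s‖ₑ

theorem isCoveringMap_proj : IsCoveringMap proj :=
  isQuotientCoveringMap_quotientMk_of_properlyDiscontinuousSMul.isCoveringMap

theorem proj_eq_iff {p q : Cylinder} :
    proj p = proj q ↔ q = p ∨ (q.1 : ℝ) = -p.1 ∧ q.2 = -p.2 := by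
  rw [eq_comm]
  refine (quotientProj_eq_iff (M := Cylinder) (G := ℤˣ)).trans ⟨?_, ?_⟩
  · rintro ⟨u, rfl⟩
    rcases Int.units_eq_one_or u with rfl | rfl
    · exact Or.inl (one_smul _ _)
    · exact Or.inr (neg_one_smul_cylinder p)
  · rintro (rfl | ⟨h1, h2⟩)
    · exact ⟨1, one_smul _ _⟩
    · refine ⟨-1, Prod.ext (Subtype.ext ?_) ?_⟩
      · rw [h1]; exact (neg_one_smul_cylinder p).1
      · rw [h2]; exact (neg_one_smul_cylinder p).2

theorem contMDiff_proj : ContMDiff cylModel cylModel ∞ proj := isLocalDiffeomorph_proj.contMDiff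

/-- The covering map provides a continuous lift. It is smooth because near each parameter it agrees
with `γ` followed by a smooth local inverse of the projection. The lift is extended by constants
beyond the endpoints, so regularity is claimed only within `[0,1]`. -/
theorem exists_contMDiffOn_lift {γ : ℝ → QuotCyl}
    (hγ : ContMDiffOn 𝓘(ℝ, ℝ) cylModel 1 γ (Icc 0 1)) (p : Cylinder) (hp : proj p = γ 0) :
    ∃ η : ℝ → Cylinder, ContMDiffOn 𝓘(ℝ, ℝ) cylModel 1 η (Icc 0 1) ∧ η 0 = p ∧
      ∀ s ∈ Icc (0 : ℝ) 1, proj (η s) = γ s := by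
  let γ' : C(unitInterval, QuotCyl) := ⟨fun s => γ s, hγ.continuousOn.domRestrict⟩
  have h0 : γ' 0 = proj p := hp.symm
  let Γ := isCoveringMap_proj.liftPath γ' p h0
  have hΓ : ∀ s, proj (Γ s) = γ' s := congrFun (isCoveringMap_proj.liftPath_lifts γ' p h0)
  have hΓ0 : Γ 0 = p := isCoveringMap_proj.liftPath_zero γ' p h0
  have hproj : ∀ s : Icc (0 : ℝ) 1, proj (Γ s) = γ s := fun s => hΓ s
  have hext : ∀ s (hs : s ∈ Icc (0 : ℝ) 1), IccExtend zero_le_one Γ s = Γ ⟨s, hs⟩ :=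
    fun s hs => IccExtend_of_mem _ _ hs
  have hc : Continuous (IccExtend zero_le_one Γ) := Γ.continuous.Icc_extend'
  refine ⟨IccExtend zero_le_one Γ, ?_, ?_, ?_⟩
  · intro s hs
    set hl := isLocalHomeomorph_quotientProj (M := Cylinder) (G := ℤˣ)
    set q := IccExtend zero_le_one Γ s
    have hsm := contMDiffOn_localInverse_quotientProj (G := ℤˣ) cylModel ∞
      (fun u => contMDiff_smul_cylinder u) q
    have hq : γ s ∈ (hl.localInverseAt q).source := by
      rw [← hproj ⟨s, hs⟩, ← hext s hs]
      exact hl.apply_self_mem_localInverseAt_source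
    have hsm1 : ContMDiffAt cylModel cylModel 1 (hl.localInverseAt q) (γ s) :=
      (hsm.contMDiffAt ((hl.localInverseAt q).open_source.mem_nhds hq)).of_le (by simp)
    refine (hsm1.comp_contMDiffWithinAt s (hγ s hs)).congr_of_eventuallyEq ?_ ?_
    · have h1 : ∀ᶠ y in 𝓝[Icc 0 1] s, IccExtend zero_le_one Γ y ∈ (hl.localInverseAt q).target :=
        (hc.continuousAt.eventually ((hl.localInverseAt q).open_target.mem_nhds
          hl.self_mem_localInverseAt_target)).filter_mono nhdsWithin_le_nhds
      have h2 : ∀ᶠ y in 𝓝[Icc 0 1] s, γ y ∈ (hl.localInverseAt q).source :=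
        (hγ s hs).continuousWithinAt ((hl.localInverseAt q).open_source.mem_nhds hq)
      filter_upwards [h1, h2, self_mem_nhdsWithin] with y hy1 hy2 hy3
      refine hl.injOn_localInverseAt_target (x := q) hy1 ((hl.localInverseAt q).map_source hy2) ?_
      refine Eq.trans ?_ (hl.apply_localInverseAt_of_mem hy2).symm
      rw [hext y hy3]
      exact hproj ⟨y, hy3⟩
    · refine hl.injOn_localInverseAt_target (x := q) hl.self_mem_localInverseAt_target
        ((hl.localInverseAt q).map_source hq) ?_
      refine Eq.trans ?_ (hl.apply_localInverseAt_of_mem hq).symm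
      change proj q = _
      rw [← hproj ⟨s, hs⟩, ← hext s hs]
  · rw [hext 0 (by simp)]; exact hΓ0
  · intro s hs
    rw [hext s hs]; exact hproj ⟨s, hs⟩

theorem norm_tangent_quotCyl (x : QuotCyl) (v : TangentSpace cylModel x) :
    ‖v‖ = √(quotMetric x v v) := rfl

/-- As the projection is a local isometry, speeds may be computed in the cylinder, where the metric
is the sum of the squares of the differentials of `height` and `direction`. -/
theorem enorm_mfderiv_proj_comp {η : ℝ → Cylinder} {s : ℝ}
    (hη : MDifferentiableAt 𝓘(ℝ, ℝ) cylModel η s) :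
    ‖mfderiv 𝓘(ℝ, ℝ) cylModel (proj ∘ η) s 1‖ₑ = ENNReal.ofReal
      √((deriv (fun s => ((η s).1 : ℝ)) s) ^ 2 + ‖deriv (fun s => ((η s).2 : E3)) s‖ ^ 2) := by
  rw [← ofReal_norm, norm_tangent_quotCyl]
  have h1 := mfderiv_comp_apply s (g := proj) (f := η) (I := 𝓘(ℝ, ℝ)) (I' := cylModel)
    (I'' := cylModel) (mdifferentiable_proj (η s)) hη 1
  rw [h1]
  have h2 := inner_mfderiv_proj (η s) (mfderiv 𝓘(ℝ, ℝ) cylModel η s 1)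
    (mfderiv 𝓘(ℝ, ℝ) cylModel η s 1)
  have key : ∀ {F : Type} [NormedAddCommGroup F] [NormedSpace ℝ F] (f : Cylinder → F)
      (_ : ContMDiff cylModel 𝓘(ℝ, F) ∞ f),
      mvfderiv cylModel f (η s) (mfderiv 𝓘(ℝ, ℝ) cylModel η s 1) = deriv (fun s => f (η s)) s := by
    intro F _ _ f hf
    have h3 := mfderiv_comp_apply s (g := f) (f := η) (I := 𝓘(ℝ, ℝ)) (I' := cylModel)
      (I'' := 𝓘(ℝ, F)) (hf.mdifferentiableAt (by simp)) hη 1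
    rw [mfderiv_eq_fderiv] at h3
    exact h3.symm
  have h4 : cylMetric (η s) (mfderiv 𝓘(ℝ, ℝ) cylModel η s 1) (mfderiv 𝓘(ℝ, ℝ) cylModel η s 1) =
      inner ℝ (mvfderiv cylModel height (η s) (mfderiv 𝓘(ℝ, ℝ) cylModel η s 1))
        (mvfderiv cylModel height (η s) (mfderiv 𝓘(ℝ, ℝ) cylModel η s 1)) +
      inner ℝ (mvfderiv cylModel direction (η s) (mfderiv 𝓘(ℝ, ℝ) cylModel η s 1))
        (mvfderiv cylModel direction (η s) (mfderiv 𝓘(ℝ, ℝ) cylModel η s 1)) := rfl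
  rw [key height contMDiff_height, key direction contMDiff_direction,
    real_inner_self_eq_norm_sq, real_inner_self_eq_norm_sq, Real.norm_eq_abs, sq_abs] at h4
  congr 2
  exact h2.trans h4

theorem pathELength_proj_comp {γ : ℝ → QuotCyl} {η : ℝ → Cylinder}
    (hη : ContMDiffOn 𝓘(ℝ, ℝ) cylModel 1 η (Icc 0 1))
    (h : ∀ s ∈ Icc (0 : ℝ) 1, proj (η s) = γ s) :
    pathELength cylModel γ 0 1 = ∫⁻ s in Ioo (0 : ℝ) 1, ENNReal.ofReal
      √((deriv (fun s => ((η s).1 : ℝ)) s) ^ 2 + ‖deriv (fun s => ((η s).2 : E3)) s‖ ^ 2) := by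
  rw [← pathELength_congr (I := cylModel) (γ := proj ∘ η) h, pathELength_eq_lintegral_mfderiv_Ioo]
  refine setLIntegral_congr_fun measurableSet_Ioo fun s hs => ?_
  exact enorm_mfderiv_proj_comp
    ((hη.contMDiffAt (Icc_mem_nhds hs.1 hs.2)).mdifferentiableAt (by simp))

theorem pathELength_sliceMap_comp (t : OpenInterval) {σ : ℝ → Sphere2}
    (hσ : ContMDiffOn 𝓘(ℝ, ℝ) (𝓡 2) 1 σ (Icc 0 1)) :
    pathELength cylModel (sliceMap t ∘ σ) 0 1 = sphLength σ := by
  refine (pathELength_proj_comp (η := fun s => (t, σ s)) (contMDiffOn_const.prodMk hσ)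
    (fun _ _ => rfl)).trans ?_
  refine setLIntegral_congr_fun measurableSet_Ioo fun s _ => ?_
  simp only [deriv_const', ne_eq, OfNat.ofNat_ne_zero, not_false_eq_true, zero_pow, zero_add,
    Real.sqrt_sq (norm_nonneg _), ofReal_norm]

theorem edist_eq_riemannianEDist (x y : QuotCyl) : edist x y = riemannianEDist cylModel x y := rfl

/-- The length distance of the unit sphere. -/
def sphEDist (a b : Sphere2) : ℝ≥0∞ :=
  ⨅ (σ : ℝ → Sphere2) (_ : ContMDiffOn 𝓘(ℝ, ℝ) (𝓡 2) 1 σ (Icc 0 1)) (_ : σ 0 = a)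
    (_ : σ 1 = b), sphLength σ

theorem sphEDist_le {σ : ℝ → Sphere2} (hσ : ContMDiffOn 𝓘(ℝ, ℝ) (𝓡 2) 1 σ (Icc 0 1)) :
    sphEDist (σ 0) (σ 1) ≤ sphLength σ :=
  iInf₂_le_of_le σ hσ (iInf₂_le_of_le rfl rfl le_rfl)

theorem exists_path_of_sphEDist_lt {a b : Sphere2} {r : ℝ≥0∞} (h : sphEDist a b < r) :
    ∃ σ : ℝ → Sphere2, ContMDiffOn 𝓘(ℝ, ℝ) (𝓡 2) 1 σ (Icc 0 1) ∧ σ 0 = a ∧ σ 1 = b ∧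
      sphLength σ < r := by
  simpa only [sphEDist, iInf_lt_iff, exists_prop] using h

/-- A path in the sphere, placed at height `t`, has the same length in `N`. -/
theorem edist_sliceMap_le (t : OpenInterval) (a b : Sphere2) :
    edist (sliceMap t a) (sliceMap t b) ≤ sphEDist a b := by
  refine le_of_forall_gt fun r hr => ?_
  obtain ⟨σ, hσ, rfl, rfl, hl⟩ := exists_path_of_sphEDist_lt hr
  refine lt_of_le_of_lt ?_ hl
  rw [← pathELength_sliceMap_comp t hσ, edist_eq_riemannianEDist]
  refine riemannianEDist_le_pathELength ?_ rfl rfl zero_le_one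
  have h1 : ContMDiff cylModel cylModel 1 proj := contMDiff_proj.of_le (by simp)
  exact h1.comp_contMDiffOn (contMDiffOn_const.prodMk hσ)

theorem contDiffOn_coe_of_contMDiffOn {σ : ℝ → Sphere2} {S : Set ℝ}
    (hσ : ContMDiffOn 𝓘(ℝ, ℝ) (𝓡 2) 1 σ S) : ContDiffOn ℝ 1 (fun s => (σ s : E3)) S :=
  ((contMDiff_coe_sphere (m := 1)).comp_contMDiffOn hσ).contDiffOn

theorem ofReal_norm_sub_le_sphLength {σ : ℝ → Sphere2}
    (hσ : ContMDiffOn 𝓘(ℝ, ℝ) (𝓡 2) 1 σ (Icc 0 1)) :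
    ENNReal.ofReal ‖(σ 1 : E3) - σ 0‖ ≤ sphLength σ := by
  have h := enorm_sub_le_lintegral_deriv_of_contDiffOn_Icc (contDiffOn_coe_of_contMDiffOn hσ)
    zero_le_one
  rw [← restrict_Ioo_eq_restrict_Icc] at h
  rwa [ofReal_norm]

/-- A short path in the quotient yields a short path in the sphere. -/
theorem exists_path_of_edist_lt {p q : Cylinder} {r : ℝ≥0∞} (h : edist (proj p) (proj q) < r) :
    ∃ σ : ℝ → Sphere2, ContMDiffOn 𝓘(ℝ, ℝ) (𝓡 2) 1 σ (Icc 0 1) ∧ σ 0 = p.2 ∧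
      sphLength σ < r ∧ ((σ 1 = q.2 ∧ ENNReal.ofReal |(q.1 : ℝ) - p.1| < r) ∨
        (σ 1 = -q.2 ∧ ENNReal.ofReal |-(q.1 : ℝ) - p.1| < r)) := by
  obtain ⟨γ, hγ0, hγ1, hγ, hl⟩ := exists_lt_of_riemannianEDist_lt
    (by rwa [edist_eq_riemannianEDist] at h)
  obtain ⟨η, hη, hη0, hηγ⟩ := exists_contMDiffOn_lift hγ p hγ0.symm
  rw [pathELength_proj_comp hη hηγ] at hl
  have hσ : ContMDiffOn 𝓘(ℝ, ℝ) (𝓡 2) 1 (fun s => (η s).2) (Icc 0 1) :=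
    contMDiff_snd.comp_contMDiffOn hη
  have hh : ContDiffOn ℝ 1 (fun s => ((η s).1 : ℝ)) (Icc 0 1) :=
    ((contMDiff_height.of_le (by simp)).comp_contMDiffOn hη).contDiffOn
  -- The speed of each component of the lift is at most the full speed.
  have l1 : sphLength (fun s => (η s).2) < r := by
    refine lt_of_le_of_lt (lintegral_mono fun s => ?_) hl
    rw [← ofReal_norm]
    exact ENNReal.ofReal_le_ofReal (Real.le_sqrt_of_sq_le (by
      nlinarith [sq_nonneg (deriv (fun s => ((η s).1 : ℝ)) s)]))
  have l2 : ENNReal.ofReal |((η 1).1 : ℝ) - (η 0).1| < r := by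
    have h1 := enorm_sub_le_lintegral_deriv_of_contDiffOn_Icc hh zero_le_one
    rw [← restrict_Ioo_eq_restrict_Icc, ← ofReal_norm, Real.norm_eq_abs] at h1
    refine lt_of_le_of_lt (h1.trans (lintegral_mono fun s => ?_)) hl
    rw [← ofReal_norm]
    exact ENNReal.ofReal_le_ofReal (Real.le_sqrt_of_sq_le (by
      rw [Real.norm_eq_abs, sq_abs]
      nlinarith [sq_nonneg ‖deriv (fun s => ((η s).2 : E3)) s‖]))
  refine ⟨fun s => (η s).2, hσ, congrArg Prod.snd hη0, l1, ?_⟩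
  rw [hη0] at l2
  -- The lift ends somewhere over `proj q`, hence at `q` or at the other point of its orbit.
  have h1 : proj (η 1) = proj q := (hηγ 1 (by simp)).trans hγ1
  rcases proj_eq_iff.1 h1.symm with h2 | ⟨h2, h3⟩
  · rw [h2] at l2; exact Or.inl ⟨congrArg Prod.snd h2, l2⟩
  · rw [h2] at l2; exact Or.inr ⟨h3, l2⟩

/-- A lift of a path of length less than `1` cannot end over `-q.2`: the chord from `p.2` to `-q.2`
is at least `2 - ‖p.2 - q.2‖ ≥ 1`. So it ends over `q.2`, and its sphere component competes in the
infimum. -/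
theorem sphEDist_le_edist {p q : Cylinder} (hpq : ‖(p.2 : E3) - q.2‖ ≤ 1)
    (h : edist (proj p) (proj q) < 1) : sphEDist p.2 q.2 ≤ edist (proj p) (proj q) := by
  refine le_of_forall_gt fun r hr => ?_
  obtain ⟨σ, hσ, h0, hl, h1⟩ := exists_path_of_edist_lt (lt_min hr h)
  rcases h1 with ⟨h1, -⟩ | ⟨h1, -⟩
  · rw [← h0, ← h1]
    exact (sphEDist_le hσ).trans_lt (hl.trans_le (min_le_left _ _))
  · exfalso
    have h2 := (ofReal_norm_sub_le_sphLength hσ).trans_lt (hl.trans_le (min_le_right _ _))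
    rw [h1, h0, ENNReal.ofReal_lt_one] at h2
    have h3 : ‖(2 : ℝ) • (p.2 : E3)‖ ≤ ‖((-q.2 : Sphere2) : E3) - p.2‖ + ‖(p.2 : E3) - q.2‖ := by
      rw [← norm_neg (((-q.2 : Sphere2) : E3) - p.2)]
      refine le_trans (le_of_eq ?_) (norm_add_le _ _)
      congr 1
      rw [coe_neg_sphere, two_smul]; abel
    rw [norm_smul, mem_sphere_zero_iff_norm.1 p.2.2] at h3
    rw [Real.norm_eq_abs, abs_two, mul_one] at h3
    linarith

theorem norm_sub_le_one_of_sphEDist_lt {a b : Sphere2} {r : ℝ}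
    (h : sphEDist a b < ENNReal.ofReal r) : ‖(a : E3) - b‖ < r := by
  obtain ⟨σ, hσ, rfl, rfl, hl⟩ := exists_path_of_sphEDist_lt h
  rw [norm_sub_rev]
  exact (ENNReal.ofReal_lt_ofReal_iff_of_nonneg (norm_nonneg _)).1
    ((ofReal_norm_sub_le_sphLength hσ).trans_lt hl)

/-- The slices are local isometries from the intrinsic sphere. A chord is no longer than a path
joining its ends, so the bound `1` on `sphEDist` supplies both hypotheses of `sphEDist_le_edist`.
Height `0` is included. -/
theorem edist_sliceMap_eq (t : OpenInterval) {a b : Sphere2} (h : sphEDist a b < 1) :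
    edist (sliceMap t a) (sliceMap t b) = sphEDist a b := by
  refine le_antisymm (edist_sliceMap_le t a b) ?_
  refine sphEDist_le_edist (p := (t, a)) (q := (t, b)) ?_ ((edist_sliceMap_le t a b).trans_lt h)
  exact (norm_sub_le_one_of_sphEDist_lt (by rwa [ENNReal.ofReal_one])).le

/-- The projection onto the central slice does not increase distances. -/
theorem edist_sliceMap_origin_le (p q : Cylinder) :
    edist (sliceMap originInterval p.2) (sliceMap originInterval q.2) ≤
      edist (proj p) (proj q) := by
  refine le_of_forall_gt fun r hr => ?_
  obtain ⟨σ, hσ, h0, hl, h1⟩ := exists_path_of_edist_lt hr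
  -- In the central slice antipodal points coincide, so both possible ends of the lifted path are
  -- acceptable.
  have h2 : sliceMap originInterval (σ 1) = sliceMap originInterval q.2 := by
    rcases h1 with ⟨h1, -⟩ | ⟨h1, -⟩
    · rw [h1]
    · rw [h1]
      exact proj_eq_iff.2 (Or.inr ⟨by simp [originInterval], by simp⟩)
  rw [← h2, ← h0]
  exact (edist_sliceMap_le _ _ _).trans_lt ((sphEDist_le hσ).trans_lt hl)

theorem continuous_sliceMap (t : OpenInterval) : Continuous (sliceMap t) :=
  contMDiff_proj.continuous.comp (by fun_prop)

/-- The neighbourhood is cut out by a chordal ball and by a ball for the distance of `N`, both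
visibly open. The triangle inequality then brings any two of its points within reach of
`sphEDist_le_edist`. -/
theorem exists_isOpen_sphEDist_lt_one (a : Sphere2) :
    ∃ W : Set Sphere2, IsOpen W ∧ a ∈ W ∧ ∀ b ∈ W, ∀ c ∈ W, sphEDist b c < 1 := by
  refine ⟨{b | ‖(b : E3) - a‖ < 1 / 2 ∧
    edist (sliceMap originInterval b) (sliceMap originInterval a) < 1 / 2}, ?_, by simp, ?_⟩
  · refine (isOpen_lt (continuous_subtype_val.sub continuous_const).norm continuous_const).inter
      (isOpen_lt ((continuous_sliceMap _).edist continuous_const) continuous_const)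
  · intro b hb c hc
    have h1 : edist (sliceMap originInterval b) (sliceMap originInterval c) < 1 := by
      refine (edist_triangle_right _ _ (sliceMap originInterval a)).trans_lt ?_
      refine (ENNReal.add_lt_add hb.2 hc.2).trans_eq ?_
      simp [ENNReal.inv_two_add_inv_two]
    refine (sphEDist_le_edist (p := (originInterval, b)) (q := (originInterval, c)) ?_ h1).trans_lt h1
    calc ‖(b : E3) - c‖ = ‖((b : E3) - a) - (c - a)‖ := by congr 1; abel
      _ ≤ ‖(b : E3) - a‖ + ‖(c : E3) - a‖ := norm_sub_le _ _
      _ ≤ 1 := by linarith [hb.1, hc.1]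

/-! ### The slices are totally geodesic. -/

theorem inducedEDist_sphereSurface (t : OpenInterval)
    (h : IsSmoothEmbedding (𝓡 2) cylModel ∞ (sliceMap t)) (a b : Sphere2) :
    (sphereSurface t h).inducedEDist a b = sphEDist a b := by
  refine iInf_congr fun σ => iInf_congr fun hσ => ?_
  have : pathELength cylModel ((sphereSurface t h).toFun ∘ σ) 0 1 = sphLength σ :=
    pathELength_sliceMap_comp t hσ
  rw [this]
  rfl

theorem isTotallyGeodesic_sphereSurface (t : OpenInterval)
    (h : IsSmoothEmbedding (𝓡 2) cylModel ∞ (sliceMap t)) :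
    (sphereSurface t h).IsTotallyGeodesic := by
  rintro J γ - ⟨c, hc, hγ⟩
  refine ⟨c, hc, fun s₀ hs₀ => ?_⟩
  obtain ⟨δ, hδ, H⟩ := hγ s₀ hs₀
  -- Two parameters this close to `s₀` differ by at most `1 / (2 * (c + 1))`, so the points are less
  -- than `1` apart and `edist_sliceMap_eq` applies. Using `c + 1` covers constant geodesics, where
  -- `c = 0`.
  refine ⟨min δ (1 / (4 * (c + 1))), lt_min hδ (by positivity), fun s hs s' hs' h1 h2 => ?_⟩
  have h3 := H s hs s' hs' (h1.trans_le (min_le_left _ _)) (h2.trans_le (min_le_left _ _))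
  replace h3 := (inducedEDist_sphereSurface t h (γ s) (γ s')).symm.trans h3
  refine (edist_sliceMap_eq t ?_).trans h3
  rw [h3, ENNReal.ofReal_lt_one]
  have h4 : |s - s'| ≤ 1 / (2 * (c + 1)) := by
    have e : s - s' = (s - s₀) - (s' - s₀) := by ring
    rw [e]
    refine (abs_sub _ _).trans ?_
    have := h1.le.trans (min_le_right _ _)
    have := h2.le.trans (min_le_right _ _)
    have e2 : 1 / (2 * (c + 1)) = 1 / (4 * (c + 1)) + 1 / (4 * (c + 1)) := by field_simp; norm_num
    rw [e2]; linarith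
  calc c * |s - s'| ≤ c * (1 / (2 * (c + 1))) := by gcongr
    _ < 1 := by
      rw [mul_one_div, div_lt_one (by positivity)]; linarith

/-! ### Charts and immersions -/

section Charts

variable {E : Type*} [NormedAddCommGroup E] [NormedSpace ℝ E] {H : Type*} [TopologicalSpace H]
  {I : ModelWithCorners ℝ E H} {M : Type*} [TopologicalSpace M] [ChartedSpace H M] {n : ℕ∞ω}

/-- A diffeomorphism onto an open subset of the model space is a chart. -/
theorem mem_maximalAtlas_of_contMDiffOn [IsManifold I n M] {e : OpenPartialHomeomorph M H}
    (h1 : ContMDiffOn I I n e e.source) (h2 : ContMDiffOn I I n e.symm e.target) :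
    e ∈ IsManifold.maximalAtlas I n M := by
  have key : ∀ f : OpenPartialHomeomorph H H, ContMDiffOn I I n f f.source →
      ContMDiffOn I I n f.symm f.target → f ∈ contDiffGroupoid n I := by
    intro f hf hf'
    refine mem_groupoid_of_pregroupoid.2 ⟨?_, ?_⟩
    · refine contMDiffOn_iff_contDiffOn.1 (I.contMDiff.comp_contMDiffOn (hf.comp
        (I.contMDiffOn_symm.mono inter_subset_right) fun y hy => hy.1))
    · refine contMDiffOn_iff_contDiffOn.1 (I.contMDiff.comp_contMDiffOn (hf'.comp
        (I.contMDiffOn_symm.mono inter_subset_right) fun y hy => hy.1))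
  have hm : ∀ e' ∈ atlas H M, e' ∈ IsManifold.maximalAtlas I n M := fun e' he' =>
    IsManifold.subset_maximalAtlas he'
  refine mem_maximalAtlas_iff.2 fun e' he' => ⟨key _ ?_ ?_, key _ ?_ ?_⟩
  · refine (contMDiffOn_of_mem_maximalAtlas (hm e' he')).comp (h2.mono ?_) ?_
    · intro y hy; exact hy.1
    · intro y hy; exact hy.2
  · refine h1.comp ((contMDiffOn_symm_of_mem_maximalAtlas (hm e' he')).mono ?_) ?_
    · intro y hy; exact hy.1
    · intro y hy; exact hy.2
  · refine h1.comp ((contMDiffOn_symm_of_mem_maximalAtlas (hm e' he')).mono ?_) ?_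
    · intro y hy; exact hy.1
    · intro y hy; exact hy.2
  · refine (contMDiffOn_of_mem_maximalAtlas (hm e' he')).comp (h2.mono ?_) ?_
    · intro y hy; exact hy.1
    · intro y hy; exact hy.2

theorem trans_mem_maximalAtlas {M' : Type*} [TopologicalSpace M'] [ChartedSpace H M']
    [IsManifold I n M] [IsManifold I n M'] {e : OpenPartialHomeomorph M M'}
    {φ : OpenPartialHomeomorph M' H}
    (h1 : ContMDiffOn I I n e e.source) (h2 : ContMDiffOn I I n e.symm e.target)
    (hφ : φ ∈ IsManifold.maximalAtlas I n M') : e ≫ₕ φ ∈ IsManifold.maximalAtlas I n M := by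
  refine mem_maximalAtlas_of_contMDiffOn ?_ ?_
  · refine (contMDiffOn_of_mem_maximalAtlas hφ).comp (h1.mono ?_) ?_
    · intro y hy; exact hy.1
    · intro y hy; exact hy.2
  · refine h2.comp ((contMDiffOn_symm_of_mem_maximalAtlas hφ).mono ?_) ?_
    · intro y hy; exact hy.1
    · intro y hy; exact hy.2

end Charts

/-! ### Slices are smoothly embedded. -/

/-- The local inverse of the projection from the cylinder. -/
def cylInverse (p : Cylinder) : OpenPartialHomeomorph QuotCyl Cylinder :=
  (isLocalHomeomorph_quotientProj (M := Cylinder) (G := ℤˣ)).localInverseAt p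

theorem mem_cylInverse_target (p : Cylinder) : p ∈ (cylInverse p).target :=
  (isLocalHomeomorph_quotientProj (M := Cylinder) (G := ℤˣ)).self_mem_localInverseAt_target

theorem cylInverse_symm (p : Cylinder) : ⇑(cylInverse p).symm = proj :=
  (isLocalHomeomorph_quotientProj (M := Cylinder) (G := ℤˣ)).localInverseAt_symm p

theorem proj_mem_cylInverse_source {p q : Cylinder} (h : q ∈ (cylInverse p).target) :
    proj q ∈ (cylInverse p).source := by
  have := (cylInverse p).map_target h
  rwa [cylInverse_symm] at this

theorem cylInverse_proj {p q : Cylinder} (h : q ∈ (cylInverse p).target) :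
    cylInverse p (proj q) = q := by
  have := (cylInverse p).right_inv h
  rwa [cylInverse_symm] at this

theorem contMDiffOn_cylInverse (p : Cylinder) :
    ContMDiffOn cylModel cylModel ∞ (cylInverse p) (cylInverse p).source :=
  contMDiffOn_localInverse_quotientProj cylModel ∞ (fun u => contMDiff_smul_cylinder u) p

/-- The chart of the interval which maps `t` to the origin. -/
def intervalChart (t : OpenInterval) : OpenPartialHomeomorph OpenInterval ℝ :=
  chartAt ℝ t ≫ₕ (Homeomorph.addRight (-(t : ℝ))).toOpenPartialHomeomorph

theorem intervalChart_self (t : OpenInterval) : intervalChart t t = 0 := by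
  change (t : ℝ) + -(t : ℝ) = 0
  ring

theorem mem_intervalChart_source (t : OpenInterval) : t ∈ (intervalChart t).source := by
  simp [intervalChart]

theorem contMDiffOn_intervalChart (t : OpenInterval) :
    ContMDiffOn 𝓘(ℝ, ℝ) 𝓘(ℝ, ℝ) ∞ (intervalChart t) (intervalChart t).source := by
  have h : ContMDiff 𝓘(ℝ, ℝ) 𝓘(ℝ, ℝ) ∞ (fun s : ℝ => s + -(t : ℝ)) :=
    (contDiff_id.add contDiff_const).contMDiff
  refine h.comp_contMDiffOn ((contMDiffOn_chart (I := 𝓘(ℝ, ℝ)) (x := t)).mono ?_)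
  intro y hy; exact hy.1

theorem contMDiffOn_intervalChart_symm (t : OpenInterval) :
    ContMDiffOn 𝓘(ℝ, ℝ) 𝓘(ℝ, ℝ) ∞ (intervalChart t).symm (intervalChart t).target := by
  have h : ContMDiff 𝓘(ℝ, ℝ) 𝓘(ℝ, ℝ) ∞ (fun s : ℝ => s + - -(t : ℝ)) :=
    (contDiff_id.add contDiff_const).contMDiff
  refine (contMDiffOn_chart_symm (I := 𝓘(ℝ, ℝ)) (x := t)).comp h.contMDiffOn ?_
  intro y hy; exact hy.2

/-- A map which is, up to a local diffeomorphism, the inclusion of a slice is an immersion. -/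
theorem isImmersionAtOfComplement_of_eq_sliceMap {M : Type} [TopologicalSpace M]
    [ChartedSpace (EuclideanSpace ℝ (Fin 2)) M] [IsManifold (𝓡 2) ∞ M] (t : OpenInterval)
    (g : OpenPartialHomeomorph M Sphere2) (hg : ContMDiffOn (𝓡 2) (𝓡 2) ∞ g g.source)
    (hg' : ContMDiffOn (𝓡 2) (𝓡 2) ∞ g.symm g.target) {f : M → QuotCyl}
    (hf : ∀ y ∈ g.source, f y = sliceMap t (g y)) {x : M} (hx : x ∈ g.source) :
    IsImmersionAtOfComplement ℝ (𝓡 2) cylModel ∞ f x := by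
  set φ := chartAt (EuclideanSpace ℝ (Fin 2)) (g x) with hφ
  set s := cylInverse (t, g x) with hs
  -- The chart of the source is restricted to `W` so that the slice stays on the branch inverted by
  -- `s`.
  let W : Set Sphere2 := {w | (t, w) ∈ s.target}
  have hW : IsOpen W := s.open_target.preimage (by fun_prop : Continuous fun w : Sphere2 => (t, w))
  have hxW : g x ∈ W := mem_cylInverse_target _
  have hfc : ContinuousAt f x := by
    have : ContinuousAt (fun y => sliceMap t (g y)) x :=
      (continuous_sliceMap t).continuousAt.comp (g.continuousAt hx)
    refine this.congr ?_
    filter_upwards [g.open_source.mem_nhds hx] with y hy using (hf y hy).symm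
  -- In these charts the map is `y ↦ (0, y)`, because `intervalChart t` moves `t` to `0`. This is
  -- the normal form of an immersion up to exchanging the two factors.
  refine IsImmersionAtOfComplement.mk_of_continuousAt hfc
    (ContinuousLinearEquiv.prodComm ℝ (EuclideanSpace ℝ (Fin 2)) ℝ)
    (g ≫ₕ φ.restr W) (s ≫ₕ (intervalChart t).prod φ) ?_ ?_ ?_ ?_ ?_
  · simp [hx, hφ, hxW, hW.interior_eq]
  · rw [hf x hx]
    have h1 : sliceMap t (g x) ∈ s.source := proj_mem_cylInverse_source (mem_cylInverse_target _)
    have h2 : s (sliceMap t (g x)) = (t, g x) := cylInverse_proj (mem_cylInverse_target _)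
    simp [h1, h2, hφ, mem_intervalChart_source]
  · exact trans_mem_maximalAtlas hg hg' (restr_mem_maximalAtlas _
      (IsManifold.chart_mem_maximalAtlas (g x)) hW)
  · refine trans_mem_maximalAtlas (contMDiffOn_cylInverse _) ?_
      (IsManifold.mem_maximalAtlas_prod (mem_maximalAtlas_of_contMDiffOn
        (contMDiffOn_intervalChart t) (contMDiffOn_intervalChart_symm t))
      (IsManifold.chart_mem_maximalAtlas (g x)))
    rw [cylInverse_symm]; exact contMDiff_proj.contMDiffOn
  · intro y hy
    simp only [mfld_simps, hW.interior_eq] at hy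
    obtain ⟨⟨h1, h2⟩, h3⟩ := hy
    have h4 : f (g.symm (φ.symm y)) = proj (t, φ.symm y) := by
      rw [hf _ (g.map_target h3), g.right_inv h3]; rfl
    simp only [mfld_simps, Function.comp]
    have h5 : s (proj (t, φ.symm y)) = (t, φ.symm y) := cylInverse_proj h2
    erw [h4, h5]
    refine Prod.ext (intervalChart_self t) (φ.right_inv h1)

theorem sliceMap_injective {t : OpenInterval} (ht : 0 < (t : ℝ)) :
    Function.Injective (sliceMap t) := by
  intro a b h
  rcases proj_eq_iff.1 h with h | ⟨h, -⟩
  · exact (congrArg Prod.snd h).symm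
  · exfalso
    change (t : ℝ) = -(t : ℝ) at h
    linarith

theorem isSmoothEmbedding_sliceMap {t : OpenInterval} (ht : 0 < (t : ℝ)) :
    IsSmoothEmbedding (𝓡 2) cylModel ∞ (sliceMap t) where
  isImmersion := IsImmersionOfComplement.isImmersion (F := ℝ) fun x => isImmersionAtOfComplement_of_eq_sliceMap t (.refl _)
    contMDiffOn_id contMDiffOn_id (fun _ _ => rfl) (mem_univ x)
  isEmbedding := ((continuous_sliceMap t).isClosedEmbedding (sliceMap_injective ht)).isEmbedding

theorem planeMap_quotientProj (w : Sphere2) :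
    planeMap (quotientProj Sphere2 ℤˣ w) = sliceMap originInterval w := rfl

theorem quotientProj_sphere_eq_iff {a b : Sphere2} :
    quotientProj Sphere2 ℤˣ a = quotientProj Sphere2 ℤˣ b ↔ b = a ∨ b = -a := by
  rw [eq_comm]
  refine quotientProj_eq_iff.trans ⟨?_, ?_⟩
  · rintro ⟨u, rfl⟩
    rcases Int.units_eq_one_or u with rfl | rfl
    · exact Or.inl (one_smul _ _)
    · exact Or.inr (neg_one_smul_cylinder (originInterval, a)).2
  · rintro (rfl | rfl)
    · exact ⟨1, one_smul _ _⟩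
    · exact ⟨-1, (neg_one_smul_cylinder (originInterval, a)).2⟩

theorem planeMap_injective : Function.Injective planeMap := by
  intro a b h
  obtain ⟨a, rfl⟩ := quotientProj_surjective a
  obtain ⟨b, rfl⟩ := quotientProj_surjective b
  rw [planeMap_quotientProj, planeMap_quotientProj] at h
  refine quotientProj_sphere_eq_iff.2 ?_
  rcases proj_eq_iff.1 h with h | ⟨-, h⟩
  · exact Or.inl (congrArg Prod.snd h)
  · exact Or.inr h

theorem continuous_quotientProj_sphere : Continuous (quotientProj Sphere2 ℤˣ) :=
  continuous_quotient_mk'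

instance : CompactSpace ProjPlane := Quotient.compactSpace

theorem continuous_planeMap : Continuous planeMap :=
  (continuous_sliceMap originInterval).quotient_lift _

/-- Locally the map is the central slice composed with a smooth inverse branch of the covering by
the sphere. It is injective because the two points over a given one at height `0` are antipodal, and
compactness makes it an embedding. -/
theorem isSmoothEmbedding_planeMap : IsSmoothEmbedding (𝓡 2) cylModel ∞ planeMap where
  isImmersion := IsImmersionOfComplement.isImmersion (F := ℝ) fun x => by
    set hl := isLocalHomeomorph_quotientProj (M := Sphere2) (G := ℤˣ)
    obtain ⟨w, rfl⟩ := quotientProj_surjective x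
    refine isImmersionAtOfComplement_of_eq_sliceMap originInterval (hl.localInverseAt w)
      (contMDiffOn_localInverse_quotientProj (𝓡 2) ∞ (fun u => contMDiff_smul_sphere u) w) ?_ ?_
      hl.apply_self_mem_localInverseAt_source
    · rw [hl.localInverseAt_symm]
      exact (contMDiff_quotientProj (𝓡 2) ∞ fun u => contMDiff_smul_sphere u).contMDiffOn
    · intro y hy
      rw [← planeMap_quotientProj, hl.apply_localInverseAt_of_mem hy]
  isEmbedding := (continuous_planeMap.isClosedEmbedding planeMap_injective).isEmbedding

/-! ### The area of the slices -/

/-- The inequality forces `G` to be constant on the fibres of `F` in `A`, so `G` factors through a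
Lipschitz map defined on `F '' A`. No metric on `X` is involved, which allows two images of the same
patch to be compared directly. -/
theorem hausdorffMeasure_image_le_of_edist_le {X Y Z : Type*} [EMetricSpace Y] [MeasurableSpace Y]
    [BorelSpace Y] [EMetricSpace Z] [MeasurableSpace Z] [BorelSpace Z] {A : Set X} {F : X → Y}
    {G : X → Z} {C : ℝ≥0} {d : ℝ} (hd : 0 ≤ d)
    (h : ∀ a ∈ A, ∀ b ∈ A, edist (G a) (G b) ≤ C * edist (F a) (F b)) :
    μH[d] (G '' A) ≤ (C : ℝ≥0∞) ^ d * μH[d] (F '' A) := by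
  rcases isEmpty_or_nonempty X with hX | hX
  · simp [Set.eq_empty_of_isEmpty A]
  have hinv : ∀ a ∈ A, G (Function.invFunOn F A (F a)) = G a := by
    intro a ha
    have h1 : F a ∈ F '' A := mem_image_of_mem F ha
    have h2 := h _ (Function.invFunOn_mem h1) a ha
    rw [Function.invFunOn_eq h1, edist_self, mul_zero, nonpos_iff_eq_zero, edist_eq_zero] at h2
    exact h2
  have hL : LipschitzOnWith C (G ∘ Function.invFunOn F A) (F '' A) := by
    rintro _ ⟨a, ha, rfl⟩ _ ⟨b, hb, rfl⟩
    simp only [Function.comp, hinv a ha, hinv b hb]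
    exact h a ha b hb
  have hI : (G ∘ Function.invFunOn F A) '' (F '' A) = G '' A := by
    rw [image_image]
    exact image_congr hinv
  rw [← hI]
  exact hL.hausdorffMeasure_image_le hd

theorem area_image_le_of_edist_le {X : Type*} {A : Set X} {F G : X → QuotCyl}
    (h : ∀ a ∈ A, ∀ b ∈ A, edist (G a) (G b) ≤ edist (F a) (F b)) :
    area (G '' A) ≤ area (F '' A) := by
  have h1 := hausdorffMeasure_image_le_of_edist_le (C := 1) (d := 2) zero_le_two
    (A := A) (F := F) (G := G) (by simpa using h)
  simp only [area, Measure.smul_apply, smul_eq_mul]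
  exact mul_le_mul' le_rfl (by simpa using h1)

theorem area_image_eq_of_edist_eq {X : Type*} {A : Set X} {F G : X → QuotCyl}
    (h : ∀ a ∈ A, ∀ b ∈ A, edist (G a) (G b) = edist (F a) (F b)) :
    area (G '' A) = area (F '' A) :=
  (area_image_le_of_edist_le fun a ha b hb => (h a ha b hb).le).antisymm
    (area_image_le_of_edist_le fun a ha b hb => (h a ha b hb).ge)

/-- A countable subfamily of the neighbourhoods already covers the space. This passes from small
patches, where the isometries are available, to the whole surface. -/
theorem measure_ext_of_nhds {X : Type*} [TopologicalSpace X] [SecondCountableTopology X]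
    [MeasurableSpace X] [BorelSpace X] {μ ν : Measure X}
    (h : ∀ x, ∃ W, IsOpen W ∧ x ∈ W ∧ ∀ B ⊆ W, MeasurableSet B → μ B = ν B) : μ = ν := by
  choose W hW hx hB using h
  obtain ⟨s, hs, hsu⟩ := TopologicalSpace.countable_cover_nhds fun x => (hW x).mem_nhds (hx x)
  have := hs.to_subtype
  refine (Measure.ext_iff_of_iUnion_eq_univ (s := fun i : s => W i)
    (by rw [← hsu, biUnion_eq_iUnion])).2 fun i => Measure.ext fun B hBm => ?_
  rw [Measure.restrict_apply hBm, Measure.restrict_apply hBm]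
  exact hB i _ inter_subset_right (hBm.inter (hW i).measurableSet)

theorem measurableEmbedding_sliceMap {t : OpenInterval} (ht : 0 < (t : ℝ)) :
    MeasurableEmbedding (sliceMap t) :=
  ((continuous_sliceMap t).isClosedEmbedding (sliceMap_injective ht)).measurableEmbedding

/-! ### The area measure of the sphere, its rotation invariance and its push forward to the
projective plane. -/

/-- A set is small if its points have distances less than one in the sphere. -/
def IsSmallPatch (A : Set Sphere2) : Prop := ∀ a ∈ A, ∀ b ∈ A, sphEDist a b < 1

theorem IsSmallPatch.mono {A B : Set Sphere2} (hB : IsSmallPatch B) (h : A ⊆ B) :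
    IsSmallPatch A := fun a ha b hb => hB a (h ha) b (h hb)

/-- This handles at once a change of height, with `f = id`, and a rotation, with `t' = t`. -/
theorem area_sliceMap_image_eq (t t' : OpenInterval) {A : Set Sphere2} (hA : IsSmallPatch A)
    {f : Sphere2 → Sphere2} (hf : ∀ a b, sphEDist (f a) (f b) = sphEDist a b) :
    area (sliceMap t' '' (f '' A)) = area (sliceMap t '' A) := by
  rw [image_image]
  refine area_image_eq_of_edist_eq fun a ha b hb => ?_
  have h := hA a ha b hb
  rw [edist_sliceMap_eq t h, edist_sliceMap_eq t' (by rwa [hf]), hf]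

/-- The area measure of the unit sphere. -/
def sphArea : Measure Sphere2 :=
  area.comap (sliceMap ⟨1 / 2, by norm_num⟩)

theorem sphArea_apply (A : Set Sphere2) :
    sphArea A = area (sliceMap ⟨1 / 2, by norm_num⟩ '' A) :=
  (measurableEmbedding_sliceMap (by norm_num)).comap_apply _ _

/-- For small patches even the central slice may be used, although it is not injective on the
sphere. Here the areas of the spheres and of the projective plane are compared. -/
theorem sphArea_apply_of_isSmallPatch (t : OpenInterval) {A : Set Sphere2} (hA : IsSmallPatch A) :
    sphArea A = area (sliceMap t '' A) := by
  have := area_sliceMap_image_eq t ⟨1 / 2, by norm_num⟩ hA (f := id) fun _ _ => rfl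
  rwa [image_id, ← sphArea_apply] at this

/-- In particular the height `1 / 2` in `sphArea` is arbitrary. Positivity of `t` makes the slice
injective, as `comap` requires. -/
theorem comap_sliceMap_area {t : OpenInterval} (ht : 0 < (t : ℝ)) :
    area.comap (sliceMap t) = sphArea := by
  refine measure_ext_of_nhds fun x => ?_
  obtain ⟨W, hW, hx, hs⟩ := exists_isOpen_sphEDist_lt_one x
  refine ⟨W, hW, hx, fun B hB _ => ?_⟩
  rw [(measurableEmbedding_sliceMap ht).comap_apply,
    sphArea_apply_of_isSmallPatch t (IsSmallPatch.mono hs hB)]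

/-- The action of a linear isometry on the sphere. -/
def rot (g : E3 ≃ₗᵢ[ℝ] E3) (w : Sphere2) : Sphere2 :=
  ⟨g w, by rw [mem_sphere_zero_iff_norm, g.norm_map]; exact mem_sphere_zero_iff_norm.1 w.2⟩

theorem rot_symm_rot (g : E3 ≃ₗᵢ[ℝ] E3) (w : Sphere2) : rot g.symm (rot g w) = w :=
  Subtype.ext (g.symm_apply_apply _)

theorem rot_rot_symm (g : E3 ≃ₗᵢ[ℝ] E3) (w : Sphere2) : rot g (rot g.symm w) = w :=
  Subtype.ext (g.apply_symm_apply _)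

theorem contMDiff_rot (g : E3 ≃ₗᵢ[ℝ] E3) : ContMDiff (𝓡 2) (𝓡 2) ∞ (rot g) := by
  have h : ContMDiff (𝓡 2) 𝓘(ℝ, E3) ∞ (fun w : Sphere2 => g (w : E3)) :=
    (g.toContinuousLinearEquiv.contDiff.contMDiff).comp contMDiff_coe_sphere
  exact ContMDiff.codRestrict_sphere h fun w => (rot g w).2

theorem sphLength_rot (g : E3 ≃ₗᵢ[ℝ] E3) (σ : ℝ → Sphere2) :
    sphLength (fun s => rot g (σ s)) = sphLength σ := by
  refine lintegral_congr fun s => ?_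
  have h : deriv (fun s => g (σ s : E3)) s = g (deriv (fun s => (σ s : E3)) s) := by
    rw [← fderiv_apply_one_eq_deriv, ← fderiv_apply_one_eq_deriv]
    exact DFunLike.congr_fun
      (g.toContinuousLinearEquiv.comp_fderiv (f := fun s => (σ s : E3)) (x := s)) 1
  change ‖deriv (fun s => g (σ s : E3)) s‖ₑ = _
  rw [h, ← ofReal_norm, g.norm_map, ofReal_norm]

theorem sphEDist_rot_le (g : E3 ≃ₗᵢ[ℝ] E3) (a b : Sphere2) :
    sphEDist (rot g a) (rot g b) ≤ sphEDist a b := by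
  refine le_of_forall_gt fun r hr => ?_
  obtain ⟨σ, hσ, rfl, rfl, hl⟩ := exists_path_of_sphEDist_lt hr
  rw [← sphLength_rot g] at hl
  exact (sphEDist_le (((contMDiff_rot g).of_le (by simp)).comp_contMDiffOn hσ)).trans_lt hl

theorem sphEDist_rot (g : E3 ≃ₗᵢ[ℝ] E3) (a b : Sphere2) :
    sphEDist (rot g a) (rot g b) = sphEDist a b := by
  refine (sphEDist_rot_le g a b).antisymm ?_
  have := sphEDist_rot_le g.symm (rot g a) (rot g b)
  rwa [rot_symm_rot, rot_symm_rot] at this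

theorem sphArea_image_rot (g : E3 ≃ₗᵢ[ℝ] E3) {A : Set Sphere2} (hA : IsSmallPatch A) :
    sphArea (rot g '' A) = sphArea A := by
  rw [sphArea_apply, sphArea_apply]
  exact area_sliceMap_image_eq _ _ hA (sphEDist_rot g)

/-- Linear isometries preserve lengths of paths in the sphere, hence the areas of small patches.
This invariance is what the divergence theorem below rests on. -/
theorem map_rot_sphArea (g : E3 ≃ₗᵢ[ℝ] E3) : sphArea.map (rot g) = sphArea := by
  refine measure_ext_of_nhds fun x => ?_
  obtain ⟨W, hW, hx, hs⟩ := exists_isOpen_sphEDist_lt_one x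
  refine ⟨W, hW, hx, fun B hB hBm => ?_⟩
  rw [Measure.map_apply (contMDiff_rot g).continuous.measurable hBm,
    ← sphArea_image_rot g.symm (IsSmallPatch.mono hs hB)]
  congr 1
  ext w
  constructor
  · intro h
    exact ⟨rot g w, h, rot_symm_rot g w⟩
  · rintro ⟨v, hv, rfl⟩
    rwa [mem_preimage, rot_rot_symm]

theorem neg_eq_rot (w : Sphere2) : -w = rot (LinearIsometryEquiv.neg ℝ) w := rfl

instance : MeasurableSpace ProjPlane := borel ProjPlane

instance : BorelSpace ProjPlane := ⟨rfl⟩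

instance : SecondCountableTopology ProjPlane :=
  (isLocalHomeomorph_quotientProj (M := Sphere2) (G := ℤˣ)).isOpenMap.isQuotientMap
    continuous_quotientProj_sphere quotientProj_surjective |>.secondCountableTopology
    (isLocalHomeomorph_quotientProj (M := Sphere2) (G := ℤˣ)).isOpenMap

theorem measurableEmbedding_planeMap : MeasurableEmbedding planeMap :=
  (continuous_planeMap.isClosedEmbedding planeMap_injective).measurableEmbedding

/-- The source of the multiplicity two. Over the image of a small patch, the preimage of `B`
consists of a set `A` in the patch and of `-A`. These are disjoint and have equal area, while the
central slice maps `A` onto `planeMap '' B`. -/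
theorem map_sphArea_eq_two_smul :
    sphArea.map (quotientProj Sphere2 ℤˣ) = 2 • area.comap planeMap := by
  refine measure_ext_of_nhds fun x => ?_
  obtain ⟨x, rfl⟩ := quotientProj_surjective x
  obtain ⟨W, hW, hx, hs⟩ := exists_isOpen_sphEDist_lt_one x
  have hq := isLocalHomeomorph_quotientProj (M := Sphere2) (G := ℤˣ)
  refine ⟨quotientProj Sphere2 ℤˣ '' W, hq.isOpenMap _ hW, mem_image_of_mem _ hx,
    fun B hB hBm => ?_⟩
  set A := quotientProj Sphere2 ℤˣ ⁻¹' B ∩ W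
  have hAm : MeasurableSet A :=
    (continuous_quotientProj_sphere.measurable hBm).inter hW.measurableSet
  have hA : IsSmallPatch A := IsSmallPatch.mono hs inter_subset_right
  have h1 : quotientProj Sphere2 ℤˣ ⁻¹' B = A ∪ rot (LinearIsometryEquiv.neg ℝ) '' A := by
    ext w
    constructor
    · intro hw
      obtain ⟨v, hv, hvw⟩ := hB hw
      rcases quotientProj_sphere_eq_iff.1 hvw with rfl | rfl
      · exact Or.inl ⟨hw, hv⟩
      · exact Or.inr ⟨v, ⟨by rw [mem_preimage, hvw]; exact hw, hv⟩, rfl⟩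
    · rintro (hw | ⟨v, hv, rfl⟩)
      · exact hw.1
      · rw [← neg_eq_rot, mem_preimage, ← quotientProj_sphere_eq_iff.2 (Or.inr rfl)]
        exact hv.1
  -- Antipodal points have chordal distance `2`, while points of a small patch are closer than `1`.
  have h2 : Disjoint A (rot (LinearIsometryEquiv.neg ℝ) '' A) := by
    rw [disjoint_left]
    rintro _ h ⟨v, hv, rfl⟩
    have h4 := norm_sub_le_one_of_sphEDist_lt (r := 1)
      (by rw [ENNReal.ofReal_one]; exact hA v hv _ h)
    rw [← neg_eq_rot, coe_neg_sphere, sub_neg_eq_add, ← two_smul ℝ, norm_smul,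
      mem_sphere_zero_iff_norm.1 v.2] at h4
    norm_num at h4
  have h3 : planeMap '' B = sliceMap originInterval '' A := by
    ext y
    constructor
    · rintro ⟨b, hb, rfl⟩
      obtain ⟨v, hv, rfl⟩ := hB hb
      exact ⟨v, ⟨hb, hv⟩, rfl⟩
    · rintro ⟨v, hv, rfl⟩
      exact ⟨_, hv.1, rfl⟩
  rw [Measure.map_apply continuous_quotientProj_sphere.measurable hBm, h1,
    measure_union' h2 hAm, sphArea_image_rot _ hA, Measure.smul_apply,
    measurableEmbedding_planeMap.comap_apply, h3, ← sphArea_apply_of_isSmallPatch _ hA, two_smul]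

/-! ### Finiteness of the area -/

/-- An inverse chart is Lipschitz on a small ball of the plane, so the area of the image is at most
a constant times the two-dimensional Hausdorff measure of the ball. -/
theorem exists_isOpen_sphArea_lt_top (x : Sphere2) :
    ∃ W, IsOpen W ∧ x ∈ W ∧ sphArea W < ⊤ := by
  set φ := chartAt (EuclideanSpace ℝ (Fin 2)) x
  -- Coordinates with the maximum norm are used because there `hausdorffMeasure_pi_real` identifies
  -- the Hausdorff measure with Lebesgue measure.
  let L : (Fin 2 → ℝ) ≃L[ℝ] EuclideanSpace ℝ (Fin 2) := (EuclideanSpace.equiv (Fin 2) ℝ).symm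
  let G : (Fin 2 → ℝ) → E3 := fun u => (φ.symm (L u) : E3)
  let u₀ := L.symm (φ x)
  have hO : IsOpen (L ⁻¹' φ.target) := φ.open_target.preimage L.continuous
  have hu₀ : u₀ ∈ L ⁻¹' φ.target := by
    simp only [u₀, mem_preimage, L.apply_symm_apply]
    exact mem_chart_target _ _
  have hGm : ContMDiffOn 𝓘(ℝ, Fin 2 → ℝ) (𝓡 2) ∞ (fun u => φ.symm (L u)) (L ⁻¹' φ.target) :=
    (contMDiffOn_chart_symm (I := 𝓡 2) (x := x)).comp L.contDiff.contMDiff.contMDiffOn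
      fun _ h => h
  have hG : ContDiffOn ℝ 1 G (L ⁻¹' φ.target) :=
    ((contMDiff_coe_sphere (m := 1)).comp_contMDiffOn (hGm.of_le (by simp))).contDiffOn
  have hG' : ContinuousAt (fderiv ℝ G) u₀ :=
    (hG.contDiffAt (hO.mem_nhds hu₀)).continuousAt_fderiv (by simp)
  obtain ⟨C, hC⟩ : ∃ C : ℝ≥0, ‖fderiv ℝ G u₀‖ < C := ⟨⟨‖fderiv ℝ G u₀‖ + 1, by positivity⟩,
    by change _ < ‖fderiv ℝ G u₀‖ + 1; linarith⟩
  obtain ⟨ε, hε, hb⟩ := Metric.eventually_nhds_iff_ball.1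
    ((hO.eventually_mem hu₀).and (hG'.norm.eventually_lt continuousAt_const hC))
  refine ⟨φ.symm '' (L '' Metric.ball u₀ ε), ?_, ?_, ?_⟩
  · refine φ.symm.isOpen_image_of_subset_source (L.toHomeomorph.isOpenMap _ Metric.isOpen_ball) ?_
    rintro _ ⟨u, hu, rfl⟩
    exact (hb u hu).1
  · refine ⟨φ x, ⟨u₀, Metric.mem_ball_self hε, L.apply_symm_apply _⟩, ?_⟩
    exact φ.left_inv (mem_chart_source _ _)
  have hd : ∀ u ∈ Metric.ball u₀ ε, ∀ v ∈ Metric.ball u₀ ε,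
      sphEDist (φ.symm (L u)) (φ.symm (L v)) ≤ C * edist u v := by
    intro u hu v hv
    -- The segment from `u` to `v` stays in the ball, where the derivative of `G` is bounded by `C`,
    -- so its image has length at most `C * edist u v`.
    let σ : ℝ → Sphere2 := fun s => φ.symm (L (AffineMap.lineMap u v s))
    have hmem : ∀ s ∈ Icc (0 : ℝ) 1, AffineMap.lineMap u v s ∈ Metric.ball u₀ ε := fun s hs =>
      (convex_ball u₀ ε).lineMap_mem hu hv hs
    have hlin : ContDiff ℝ ∞ (fun s : ℝ => (AffineMap.lineMap u v s : Fin 2 → ℝ)) := by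
      simp only [AffineMap.lineMap_apply_module']
      fun_prop
    have hσ : ContMDiffOn 𝓘(ℝ, ℝ) (𝓡 2) 1 σ (Icc 0 1) :=
      (hGm.comp hlin.contMDiff.contMDiffOn fun s hs => (hb _ (hmem s hs)).1).of_le (by simp)
    have e0 : σ 0 = φ.symm (L u) := by simp [σ]
    have e1 : σ 1 = φ.symm (L v) := by simp [σ]
    rw [← e0, ← e1]
    refine (sphEDist_le hσ).trans ?_
    have hbd : ∀ s ∈ Ioo (0 : ℝ) 1, ‖deriv (fun s => (σ s : E3)) s‖ₑ ≤ C * edist u v := by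
      intro s hs
      have hs' := hmem s ⟨hs.1.le, hs.2.le⟩
      have h1 : HasDerivAt (fun s : ℝ => (AffineMap.lineMap u v s : Fin 2 → ℝ)) (v - u) s :=
        AffineMap.hasDerivAt_lineMap
      have h2 : HasFDerivAt G (fderiv ℝ G (AffineMap.lineMap u v s)) (AffineMap.lineMap u v s) :=
        ((hG.contDiffAt (hO.mem_nhds (hb _ hs').1)).differentiableAt (by simp)).hasFDerivAt
      have h3 : deriv (fun s => (σ s : E3)) s = fderiv ℝ G (AffineMap.lineMap u v s) (v - u) :=
        (h2.comp_hasDerivAt s h1).deriv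
      rw [h3, edist_comm, edist_eq_enorm_sub]
      refine (ContinuousLinearMap.le_opENorm _ _).trans ?_
      gcongr
      rw [← ofReal_norm, ← ENNReal.ofReal_coe_nnreal]
      exact ENNReal.ofReal_le_ofReal (hb _ hs').2.le
    calc sphLength σ ≤ ∫⁻ s in Ioo (0 : ℝ) 1, C * edist u v :=
          setLIntegral_mono measurable_const hbd
      _ = C * edist u v := by simp
  rw [image_image, sphArea_apply, image_image, area, Measure.smul_apply, smul_eq_mul]
  refine ENNReal.mul_lt_top ENNReal.ofReal_lt_top ?_
  refine (hausdorffMeasure_image_le_of_edist_le (F := id) (C := C) zero_le_two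
    fun u hu v hv => (edist_sliceMap_le _ _ _).trans (hd u hu v hv)).trans_lt ?_
  refine ENNReal.mul_lt_top (by simp) ?_
  have h2 := hausdorffMeasure_pi_real (ι := Fin 2)
  simp only [Fintype.card_fin, Nat.cast_ofNat] at h2
  rw [h2, image_id]
  exact measure_ball_lt_top

instance : IsFiniteMeasure sphArea := by
  choose W hW hx hf using exists_isOpen_sphArea_lt_top
  obtain ⟨s, hs⟩ := isCompact_univ.elim_finite_subcover W hW fun x _ => mem_iUnion.2 ⟨x, hx x⟩
  refine ⟨(measure_mono hs).trans_lt ((measure_biUnion_finset_le s W).trans_lt ?_)⟩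
  exact ENNReal.sum_lt_top.2 fun i _ => hf i

/-! ### Almost minimizing surfaces -/

/-- An even function on the cylinder as a function on the quotient. -/
def descend {X : Type*} (f : Cylinder → X) (hf : ∀ p q : Cylinder, (q.1 : ℝ) = -p.1 →
    q.2 = -p.2 → f p = f q) : QuotCyl → X :=
  Quotient.lift f fun p q h => by
    rcases proj_eq_iff.1 (Quotient.sound h : proj p = proj q) with rfl | ⟨h1, h2⟩
    · rfl
    · exact hf p q h1 h2

theorem continuous_descend {X : Type*} [TopologicalSpace X] {f : Cylinder → X} (hf)
    (hc : Continuous f) : Continuous (descend f hf) := hc.quotient_lift _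

theorem proj_surjective : Function.Surjective proj := quotientProj_surjective

/-- The absolute value of the height is well defined on `N` and does not vary faster than the
distance. -/
theorem abs_abs_height_sub_lt {p q : Cylinder} {r : ℝ}
    (h : edist (proj p) (proj q) < ENNReal.ofReal r) : |(|(q.1 : ℝ)| - |(p.1 : ℝ)|)| < r := by
  obtain ⟨σ, -, -, -, h1⟩ := exists_path_of_edist_lt h
  rcases h1 with ⟨-, h1⟩ | ⟨-, h1⟩
  · exact (abs_abs_sub_abs_le_abs_sub _ _).trans_lt
      ((ENNReal.ofReal_lt_ofReal_iff_of_nonneg (abs_nonneg _)).1 h1)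
  · rw [← abs_neg (q.1 : ℝ)]
    exact (abs_abs_sub_abs_le_abs_sub _ _).trans_lt
      ((ENNReal.ofReal_lt_ofReal_iff_of_nonneg (abs_nonneg _)).1 h1)

theorem norm_direction_sub_lt {p q : Cylinder} {r : ℝ}
    (h : edist (proj p) (proj q) < ENNReal.ofReal r) :
    ‖(q.2 : E3) - p.2‖ < r ∨ ‖((-q.2 : Sphere2) : E3) - p.2‖ < r := by
  obtain ⟨σ, hσ, h0, hl, h1⟩ := exists_path_of_edist_lt h
  have h2 := (ENNReal.ofReal_lt_ofReal_iff_of_nonneg (norm_nonneg _)).1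
    ((ofReal_norm_sub_le_sphLength hσ).trans_lt hl)
  rw [h0] at h2
  rcases h1 with ⟨h1, -⟩ | ⟨h1, -⟩
  · exact Or.inl (by rwa [h1] at h2)
  · exact Or.inr (by rwa [h1] at h2)

/-- Only the final map of the isotopy matters for this criterion: it is a homeomorphism fixing the
complement of `U`. Finite area and `ε > 0` exclude a loss of `ε`. -/
theorem isAlmostMinimizing_of_forall_homeomorph {ε : ℝ} (hε : 0 < ε) {U S : Set QuotCyl}
    (hS : area S ≠ ⊤)
    (h : ∀ Φ : QuotCyl ≃ₜ QuotCyl, (∀ x, x ∉ U → Φ x = x) → area S ≤ area (Φ '' S)) :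
    IsAlmostMinimizing cylModel ε U S := by
  rintro ⟨ψ, hψ, -, h1⟩
  obtain ⟨Φ, hΦ⟩ := hψ.diffeo 1
  have h2 : (fun x => ψ (1, x)) = Φ.toHomeomorph := funext hΦ
  have h3 := h Φ.toHomeomorph fun x hx => by rw [← h2]; exact hψ.fixed 1 x hx
  rw [h2] at h1
  have h4 : area S < area S + ENNReal.ofReal ε :=
    ENNReal.lt_add_right hS (by simpa using hε)
  exact h4.not_ge ((add_le_add h3 le_rfl).trans h1)

theorem area_range_sliceMap {t : OpenInterval} (ht : 0 < (t : ℝ)) :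
    area (range (sliceMap t)) = sphArea univ := by
  rw [← image_univ, ← (measurableEmbedding_sliceMap ht).comap_apply, comap_sliceMap_area ht]

/-- The reflection of the interval. -/
def negInterval (t : OpenInterval) : OpenInterval := ⟨-t, by
  have h : -1 < (t : ℝ) ∧ (t : ℝ) < 1 := t.2
  change -(t : ℝ) ∈ Ioo (-1 : ℝ) 1
  constructor <;> linarith [h.1, h.2]⟩

theorem sliceMap_neg (t : OpenInterval) (w : Sphere2) :
    sliceMap t (-w) = sliceMap (negInterval t) w :=
  proj_eq_iff.2 (Or.inr ⟨rfl, (neg_neg w).symm⟩)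

theorem inner_pos_of_norm_sub_lt {a b : Sphere2} (h : ‖(a : E3) - b‖ < 1) :
    0 < inner ℝ (a : E3) (b : E3) := by
  have h1 := norm_sub_sq_real (a : E3) b
  rw [mem_sphere_zero_iff_norm.1 a.2, mem_sphere_zero_iff_norm.1 b.2] at h1
  nlinarith [norm_nonneg ((a : E3) - b)]

/-- A homeomorphism which moves only points over a small part of the sphere does not decrease the
area of the slices. -/
theorem area_range_sliceMap_le {t : OpenInterval} (ht : 0 < (t : ℝ)) {W : Set Sphere2}
    (hWo : IsOpen W) (hW : IsSmallPatch W) {w₀ : Sphere2} (hw₀ : w₀ ∈ W) {U : Set QuotCyl}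
    (hU : ∀ y ∈ U, ∃ p : Cylinder, proj p = y ∧ |(p.1 : ℝ)| < 1 / 2 ∧ p.2 ∈ W)
    (Φ : QuotCyl ≃ₜ QuotCyl) (hΦ : ∀ x, x ∉ U → Φ x = x) :
    area (range (sliceMap t)) ≤ area (Φ '' range (sliceMap t)) := by
  have hpos : ∀ w ∈ W, 0 < inner ℝ (w : E3) (w₀ : E3) := fun w hw =>
    inner_pos_of_norm_sub_lt (norm_sub_le_one_of_sphEDist_lt (r := 1)
      (by rw [ENNReal.ofReal_one]; exact hW w hw w₀ hw₀))
  have hinner : ∀ w : Sphere2, inner ℝ ((-w : Sphere2) : E3) (w₀ : E3) =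
      -inner ℝ (w : E3) (w₀ : E3) := fun w => by rw [coe_neg_sphere, inner_neg_left]
  have hneg : ∀ w ∈ W, -w ∉ W := fun w hw hw' => by
    have h1 := hpos w hw
    have h2 := hpos _ hw'
    rw [hinner] at h2
    linarith
  -- As `W` contains no two antipodal points, each point of `D` has a unique lift over `W`, so `D`
  -- is a copy of `]-1,1[ × W`. It contains `U`, hence `Φ` maps `D` onto itself.
  set D : Set QuotCyl := proj '' {p | p.2 ∈ W}
  have hDo : IsOpen D := isCoveringMap_proj.isLocalHomeomorph.isOpenMap _
    (hWo.preimage continuous_snd)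
  have hUD : U ⊆ D := fun y hy => by
    obtain ⟨p, rfl, -, hp⟩ := hU y hy
    exact ⟨p, hp, rfl⟩
  have hinj : ∀ p q : Cylinder, p.2 ∈ W → q.2 ∈ W → proj p = proj q → p = q := by
    intro p q hp hq h
    rcases proj_eq_iff.1 h with h | ⟨-, h⟩
    · exact h.symm
    · rw [h] at hq
      exact absurd hq (hneg _ hp)
  have hΦD : ∀ y, Φ y ∈ D ↔ y ∈ D := by
    intro y
    by_cases hy : y ∈ U
    · refine iff_of_true ?_ (hUD hy)
      by_contra h
      have h1 := hΦ (Φ y) fun h' => h (hUD h')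
      exact h (by rw [Φ.injective h1]; exact hUD hy)
    · rw [hΦ y hy]
  -- the height, with the sign for which it is the height of the points over `W`
  let g : QuotCyl → ℝ := descend (fun p => (p.1 : ℝ) * inner ℝ (p.2 : E3) (w₀ : E3))
    fun p q h1 h2 => by rw [h1, h2, hinner]; ring
  let b : QuotCyl → ℝ := descend (fun p => |inner ℝ (p.2 : E3) (w₀ : E3)|)
    fun p q h1 h2 => by rw [h2, hinner, abs_neg]
  have hcd : Continuous fun p : Cylinder => inner ℝ (p.2 : E3) (w₀ : E3) :=
    (continuous_subtype_val.comp continuous_snd).inner continuous_const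
  have hg : Continuous g := continuous_descend _
    ((continuous_subtype_val.comp continuous_fst).mul hcd)
  have hb : Continuous b := continuous_descend _ hcd.abs
  -- The height itself is odd and does not descend to `N`, but its product with the odd function
  -- `⟨·, w₀⟩` does. On `D` the quotient by `b` recovers the height of the lift over `W`.
  have hgb : ∀ p : Cylinder, p.2 ∈ W → g (proj p) / b (proj p) = p.1 := by
    intro p hp
    change (p.1 : ℝ) * inner ℝ (p.2 : E3) (w₀ : E3) / |inner ℝ (p.2 : E3) (w₀ : E3)| = p.1
    rw [abs_of_pos (hpos _ hp), mul_div_assoc, div_self (hpos _ hp).ne', mul_one]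
  have hbD : ∀ y ∈ D, b y ≠ 0 := by
    rintro _ ⟨p, hp, rfl⟩
    exact (abs_pos.2 (hpos _ hp).ne').ne'
  -- The vertical segment over `w` meets the image under `Φ` of the sheet at height `c`. Along the
  -- segment, the height of the preimage under `Φ` is continuous and equals `s` once `|s| ≥ 1/2`,
  -- since `Φ` is the identity there, so it takes the value `c`.
  have hcross : ∀ c : OpenInterval, ∀ w ∈ W, ∃ s : OpenInterval, ∃ w' ∈ W,
      proj (s, w) = Φ (sliceMap c w') := by
    intro c w hw
    have hmem : ∀ s : OpenInterval, Φ.symm (proj (s, w)) ∈ D := fun s => by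
      rw [← hΦD, Φ.apply_symm_apply]
      exact ⟨_, hw, rfl⟩
    have hf : Continuous fun s : OpenInterval =>
        g (Φ.symm (proj (s, w))) / b (Φ.symm (proj (s, w))) := by
      have h1 : Continuous fun s : OpenInterval => Φ.symm (proj (s, w)) :=
        Φ.symm.continuous.comp (contMDiff_proj.continuous.comp (by fun_prop))
      exact (hg.comp h1).div (hb.comp h1) fun s => hbD _ (hmem s)
    have hfix : ∀ s : OpenInterval, 1 / 2 ≤ |(s : ℝ)| →
        g (Φ.symm (proj (s, w))) / b (Φ.symm (proj (s, w))) = s := by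
      intro s hs
      have h1 : proj (s, w) ∉ U := fun h => by
        obtain ⟨p, hp, hp1, hp2⟩ := hU _ h
        rw [hinj p (s, w) hp2 hw hp] at hp1
        exact absurd hs (not_le.2 hp1)
      have h2 : Φ.symm (proj (s, w)) = proj (s, w) := by
        rw [Φ.symm_apply_eq]
        exact (hΦ _ h1).symm
      rw [h2]
      exact hgb (s, w) hw
    have hc1 : |(c : ℝ)| < 1 := abs_lt.2 c.2
    -- At heights `±m` the point is fixed by `Φ`, and the interval `[-m, m]` contains `c`.
    set m : ℝ := max (1 / 2) |(c : ℝ)|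
    have hm1 : m < 1 := max_lt (by norm_num) hc1
    have hm2 : 1 / 2 ≤ m := le_max_left _ _
    have hm3 : |(c : ℝ)| ≤ m := le_max_right _ _
    let m₁ : OpenInterval := ⟨-m, by constructor <;> linarith⟩
    let m₂ : OpenInterval := ⟨m, by constructor <;> linarith⟩
    have e1 := hfix m₁ (by change 1 / 2 ≤ |-m|; rw [abs_neg, abs_of_pos] <;> linarith)
    have e2 := hfix m₂ (by change 1 / 2 ≤ |m|; rw [abs_of_pos] <;> linarith)
    have : PreconnectedSpace OpenInterval :=
      Subtype.preconnectedSpace isPreconnected_Ioo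
    obtain ⟨s, hs⟩ := mem_range_of_exists_le_of_exists_ge (c := (c : ℝ)) hf
      ⟨m₁, by rw [e1]; exact neg_le_of_abs_le hm3⟩ ⟨m₂, by rw [e2]; exact le_of_abs_le hm3⟩
    obtain ⟨p, hp, hps⟩ := hmem s
    refine ⟨s, p.2, hp, ?_⟩
    rw [← Φ.symm_apply_eq, ← hps]
    dsimp only at hs
    rw [← hps, hgb p hp] at hs
    rw [sliceMap, ← Subtype.ext hs]
  -- By `hcross` the projection of the deformed sheet to the central slice still covers the patch,
  -- and this projection does not increase area.
  have hkey : ∀ c : OpenInterval, area (sliceMap c '' W) ≤ area (Φ '' (sliceMap c '' W)) := by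
    intro c
    rw [← sphArea_apply_of_isSmallPatch c hW, sphArea_apply_of_isSmallPatch originInterval hW]
    calc area (sliceMap originInterval '' W)
        ≤ area ((fun p : Cylinder => sliceMap originInterval p.2) ''
            (proj ⁻¹' (Φ '' (sliceMap c '' W)))) := by
          refine measure_mono ?_
          rintro _ ⟨w, hw, rfl⟩
          obtain ⟨s, w', hw', h⟩ := hcross c w hw
          exact ⟨(s, w), ⟨_, mem_image_of_mem _ hw', h.symm⟩, rfl⟩
      _ ≤ area (proj '' (proj ⁻¹' (Φ '' (sliceMap c '' W)))) :=
          area_image_le_of_edist_le fun p _ q _ => edist_sliceMap_origin_le p q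
      _ = _ := by rw [image_preimage_eq _ proj_surjective]
  -- Seen from `W`, the part of the slice in `D` consists of two disjoint sheets, at heights `t` and
  -- `-t`. The rest `R` is fixed by `Φ`, and the images of the three pieces remain disjoint, so the
  -- areas add up.
  set A₁ := sliceMap t '' W
  set A₂ := sliceMap (negInterval t) '' W
  set R := range (sliceMap t) \ D
  have hA₁D : A₁ ⊆ D := by
    rintro _ ⟨w, hw, rfl⟩
    exact ⟨_, hw, rfl⟩
  have hA₂D : A₂ ⊆ D := by
    rintro _ ⟨w, hw, rfl⟩
    exact ⟨_, hw, rfl⟩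
  have hunion : range (sliceMap t) = A₁ ∪ A₂ ∪ R := by
    refine Subset.antisymm ?_ ?_
    · rintro _ ⟨w, rfl⟩
      by_cases hD : sliceMap t w ∈ D
      · left
        obtain ⟨p, hp, h⟩ := hD
        rcases proj_eq_iff.1 h.symm with rfl | ⟨h1, h2⟩
        · exact Or.inl ⟨w, hp, rfl⟩
        · refine Or.inr ⟨p.2, hp, ?_⟩
          rw [← sliceMap_neg]
          congr 1
          rw [h2]; exact neg_neg _
      · exact Or.inr ⟨⟨w, rfl⟩, hD⟩
    · refine union_subset (union_subset (image_subset_range _ _) ?_) sdiff_subset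
      rintro _ ⟨w, -, rfl⟩
      exact ⟨-w, sliceMap_neg t w⟩
  have hdisj : Disjoint A₁ A₂ := by
    rw [disjoint_left]
    rintro _ ⟨w, hw, rfl⟩ ⟨w', hw', h⟩
    have h1 := congrArg (fun p : Cylinder => (p.1 : ℝ)) (hinj _ _ hw' hw h)
    change -(t : ℝ) = t at h1
    linarith
  have hA₂m : MeasurableSet A₂ := by
    have : A₂ = sliceMap t '' ((fun w => -w) ⁻¹' W) := by
      ext y
      constructor
      · rintro ⟨w, hw, rfl⟩
        exact ⟨-w, by simpa using hw, sliceMap_neg t w⟩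
      · rintro ⟨w, hw, rfl⟩
        exact ⟨-w, hw, by rw [← sliceMap_neg, neg_neg]⟩
    rw [this]
    exact (measurableEmbedding_sliceMap ht).measurableSet_image.2
      (hWo.preimage continuous_neg).measurableSet
  have hΦm : MeasurableEmbedding Φ := Φ.measurableEmbedding
  have hΦR : Φ '' R = R := by
    have : ∀ y ∈ R, Φ y = y := fun y hy => hΦ y fun h => hy.2 (hUD h)
    rw [image_congr this, image_id']
  have hΦsub : ∀ {A : Set QuotCyl}, A ⊆ D → Φ '' A ⊆ D := by
    rintro A hA _ ⟨y, hy, rfl⟩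
    exact (hΦD y).2 (hA hy)
  have hRm : MeasurableSet R := by
    refine MeasurableSet.diff ?_ hDo.measurableSet
    exact (measurableEmbedding_sliceMap ht).measurableSet_range
  calc area (range (sliceMap t)) ≤ area A₁ + area A₂ + area R := by
        rw [hunion]
        exact (measure_union_le _ _).trans (add_le_add_left (measure_union_le _ _) _)
    _ ≤ area (Φ '' A₁) + area (Φ '' A₂) + area R := by
        exact add_le_add (add_le_add (hkey t) (hkey (negInterval t))) le_rfl
    _ = area (Φ '' range (sliceMap t)) := by
        rw [hunion, image_union, image_union, hΦR, measure_union _ hRm,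
          measure_union ((disjoint_image_iff hΦm.injective).2 hdisj) (hΦm.measurableSet_image.2 hA₂m)]
        rw [disjoint_left]
        intro y hy hyR
        exact hyR.2 (union_subset (hΦsub hA₁D) (hΦsub hA₂D) hy)

/-- Balls centred on the limit plane are treated by `area_range_sliceMap_le`. Around any other
centre, the slices eventually leave a small ball. -/
theorem exists_radius_isAlmostMinimizing {t : ℕ → OpenInterval} (ht_pos : ∀ j, 0 < (t j : ℝ))
    (ht_lim : Tendsto (fun j => (t j : ℝ)) atTop (𝓝 0)) (x : QuotCyl) :
    ∃ r : ℝ, 0 < r ∧ ∀ τ σ : ℝ, 0 < τ → τ < σ → σ ≤ r → ∀ᶠ j : ℕ in atTop,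
      IsAlmostMinimizing cylModel (1 / (j : ℝ)) (annulus x τ σ) (range (sliceMap (t j))) := by
  have hfin : ∀ j, area (range (sliceMap (t j))) ≠ ⊤ := fun j => by
    rw [area_range_sliceMap (ht_pos j)]
    exact measure_ne_top _ _
  obtain ⟨p, rfl⟩ := proj_surjective x
  have hsub : ∀ {τ σ r : ℝ}, σ ≤ r → ∀ y ∈ annulus (proj p) τ σ,
      edist (proj p) y < ENNReal.ofReal r := by
    intro τ σ r h y hy
    have h1 : edist y (proj p) < ENNReal.ofReal σ := hy.1
    rw [edist_comm]
    exact h1.trans_le (ENNReal.ofReal_le_ofReal h)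
  by_cases hp : (p.1 : ℝ) = 0
  · obtain ⟨W, hWo, hpW, hW⟩ := exists_isOpen_sphEDist_lt_one p.2
    obtain ⟨ρ, hρ, hball⟩ := Metric.isOpen_iff.1 hWo p.2 hpW
    -- The bound `ρ` keeps the ball over the patch `W`, and `1 / 2` bounds the heights as required
    -- by `area_range_sliceMap_le`.
    refine ⟨min ρ (1 / 2), lt_min hρ (by norm_num), fun τ σ _ _ hσ => ?_⟩
    -- The index `0` is left out because `1 / 0 = 0` is not a positive tolerance.
    filter_upwards [eventually_ge_atTop 1] with j hj
    have hj' : (0 : ℝ) < 1 / (j : ℝ) := by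
      have : (1 : ℝ) ≤ j := by exact_mod_cast hj
      positivity
    refine isAlmostMinimizing_of_forall_homeomorph hj' (hfin j) fun Φ hΦ =>
      area_range_sliceMap_le (ht_pos j) hWo hW hpW ?_ Φ hΦ
    intro y hy
    obtain ⟨q, rfl⟩ := proj_surjective y
    have h1 := hsub hσ _ hy
    have h2 := abs_abs_height_sub_lt h1
    rw [hp, abs_zero, sub_zero, abs_abs] at h2
    have h2' := h2.trans_le (min_le_right _ _)
    have hmem : ∀ v : Sphere2, ‖(v : E3) - p.2‖ < min ρ (1 / 2) → v ∈ W := fun v hv => by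
      refine hball ?_
      rw [Metric.mem_ball, Subtype.dist_eq, dist_eq_norm]
      exact hv.trans_le (min_le_left _ _)
    rcases norm_direction_sub_lt h1 with h3 | h3
    · exact ⟨q, rfl, h2', hmem _ h3⟩
    · refine ⟨(negInterval q.1, -q.2), proj_eq_iff.2 (Or.inr ⟨?_, ?_⟩), ?_, hmem _ h3⟩
      · exact (neg_neg _).symm
      · exact (neg_neg _).symm
      · change |-(q.1 : ℝ)| < 1 / 2
        rwa [abs_neg]
  · have hp' : 0 < |(p.1 : ℝ)| := abs_pos.2 hp
    -- In this ball the absolute heights exceed half of that of the centre, so slices with smaller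
    -- `t j` miss the annulus and are fixed pointwise.
    refine ⟨|(p.1 : ℝ)| / 2, half_pos hp', fun τ σ _ _ hσ => ?_⟩
    filter_upwards [eventually_ge_atTop 1,
      ht_lim.eventually_lt_const (half_pos hp')] with j hj htj
    have hj' : (0 : ℝ) < 1 / (j : ℝ) := by
      have : (1 : ℝ) ≤ j := by exact_mod_cast hj
      positivity
    refine isAlmostMinimizing_of_forall_homeomorph hj' (hfin j) fun Φ hΦ => ?_
    have : ∀ y ∈ range (sliceMap (t j)), Φ y = y := by
      rintro _ ⟨w, rfl⟩
      refine hΦ _ fun h => ?_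
      have h1 := abs_abs_height_sub_lt (q := (t j, w)) (hsub hσ _ h)
      dsimp only at h1
      rw [abs_of_pos (ht_pos j), abs_lt] at h1
      linarith [h1.1]
    rw [image_congr this, image_id']

/-! ### The tangent planes of the slices -/

theorem contMDiff_sliceMap (t : OpenInterval) : ContMDiff (𝓡 2) cylModel ∞ (sliceMap t) :=
  contMDiff_proj.comp (contMDiff_const.prodMk contMDiff_id)

theorem injective_mfderiv_sliceMap (t : OpenInterval) (w : Sphere2) :
    Function.Injective (mfderiv (𝓡 2) cylModel (sliceMap t) w) :=
  injective_mfderiv_of_isImmersionAt (n := ∞) (by simp)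
    (isImmersionAtOfComplement_of_eq_sliceMap t (.refl _) contMDiffOn_id contMDiffOn_id
      (fun _ _ => rfl) (mem_univ w)).isImmersionAt

/-- The tangent plane of the slice at height `t`. -/
def slicePlane (t : OpenInterval) (w : Sphere2) : GrassmannBundle cylModel QuotCyl where
  base := sliceMap t w
  plane := (mfderiv (𝓡 2) cylModel (sliceMap t) w).range
  finrank_plane := by
    have h := LinearMap.finrank_range_of_inj
      (f := (mfderiv (𝓡 2) cylModel (sliceMap t) w).toLinearMap) (injective_mfderiv_sliceMap t w)
    exact h.trans finrank_euclideanSpace_fin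

theorem cylInverse_eventually_section {p₀ : Cylinder} {y : QuotCyl}
    (hy : y ∈ (cylInverse p₀).source) : ∀ᶠ z in 𝓝 y, proj (cylInverse p₀ z) = z := by
  filter_upwards [(cylInverse p₀).open_source.mem_nhds hy] with z hz
  exact (isLocalHomeomorph_quotientProj (M := Cylinder) (G := ℤˣ)).apply_localInverseAt_of_mem hz

theorem contMDiffAt_cylInverse {p₀ : Cylinder} {y : QuotCyl}
    (hy : y ∈ (cylInverse p₀).source) : ContMDiffAt cylModel cylModel ∞ (cylInverse p₀) y :=
  (contMDiffOn_cylInverse p₀).contMDiffAt ((cylInverse p₀).open_source.mem_nhds hy)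

theorem toEndomorphism_apply_eq {E : Type} [NormedAddCommGroup E] [NormedSpace ℝ E]
    [FiniteDimensional ℝ E] {H : Type} [TopologicalSpace H] {I : ModelWithCorners ℝ E H}
    {N : Type} [EMetricSpace N] [ChartedSpace H N] [IsManifold I ∞ N]
    [Bundle.RiemannianBundle (fun x : N => TangentSpace I x)] (p : GrassmannBundle I N)
    {v u : TangentSpace I p.base} (hu : u ∈ p.plane)
    (ho : ∀ w ∈ p.plane, inner ℝ (v - u) w = 0) : (p.toEndomorphism I).2 v = u := by
  have : FiniteDimensional ℝ (TangentSpace I p.base) := inferInstanceAs (FiniteDimensional ℝ E)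
  have : p.plane.HasOrthogonalProjection := inferInstance
  change p.plane.starProjection v = u
  exact Submodule.eq_starProjection_of_mem_of_inner_eq_zero hu ho

/-- The projection onto the tangent plane of a slice is the differential of a retraction. -/
theorem toEndomorphism_slicePlane (p₀ p : Cylinder) (hp : p ∈ (cylInverse p₀).target) :
    (GrassmannBundle.toEndomorphism cylModel (slicePlane p.1 p.2)).2 =
      mfderiv cylModel cylModel (fun y => proj (p.1, (cylInverse p₀ y).2)) (proj p) := by
  set s := cylInverse p₀ with hs_def
  have hy : proj p ∈ s.source := proj_mem_cylInverse_source hp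
  have hsp : s (proj p) = p := cylInverse_proj hp
  have hs : ContMDiffAt cylModel cylModel ∞ s (proj p) := contMDiffAt_cylInverse hy
  have hs2 : ContMDiffAt cylModel (𝓡 2) ∞ (fun y => (s y).2) (proj p) :=
    contMDiffAt_snd.comp _ hs
  set ρ : QuotCyl → QuotCyl := fun y => proj (p.1, (s y).2) with hρ_def
  have hρ : ContMDiffAt cylModel cylModel ∞ ρ (proj p) :=
    (contMDiff_sliceMap p.1).contMDiffAt.comp _ hs2
  have hρp : ρ (proj p) = proj p := by rw [hρ_def]; dsimp only; rw [hsp]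
  have hslice : MDifferentiable (𝓡 2) cylModel (sliceMap p.1) :=
    (contMDiff_sliceMap p.1).mdifferentiable (by simp)
  refine ContinuousLinearMap.ext fun (v : TangentSpace cylModel (proj p)) => toEndomorphism_apply_eq _ ?_ ?_
  · have h1 : HasMFDerivAt (𝓡 2) cylModel (sliceMap p.1) (s (proj p)).2
        (mfderiv (𝓡 2) cylModel (sliceMap p.1) p.2) := by
      rw [hsp]; exact (hslice p.2).hasMFDerivAt
    have h2 := (h1.comp (proj p) (hs2.mdifferentiableAt (by simp)).hasMFDerivAt).mfderiv
    exact ⟨_, (DFunLike.congr_fun h2 v).symm⟩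
  · rintro _ ⟨u, rfl⟩
    -- Orthogonality is checked in the lift: tangent vectors of the slice have no height component
    -- (`e1`), while a vector and its image under the retraction have the same direction component
    -- (`e2`).
    have hin : ∀ a b : TangentSpace cylModel (proj p), inner ℝ a b =
        inner ℝ (mvfderiv cylModel (height ∘ s) (proj p) a)
          (mvfderiv cylModel (height ∘ s) (proj p) b) +
        inner ℝ (mvfderiv cylModel (direction ∘ s) (proj p) a)
          (mvfderiv cylModel (direction ∘ s) (proj p) b) := by
      intro a b
      rw [inner_tangentSpace_quotCyl, quotMetric_eq_of_section (proj p) s hs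
        (cylInverse_eventually_section hy)]
      rfl
    have hh : MDifferentiableAt cylModel 𝓘(ℝ, ℝ) (height ∘ s) (proj p) :=
      (contMDiff_height.contMDiffAt.comp _ hs).mdifferentiableAt (by simp)
    have hd : MDifferentiableAt cylModel 𝓘(ℝ, E3) (direction ∘ s) (proj p) :=
      (contMDiff_direction.contMDiffAt.comp _ hs).mdifferentiableAt (by simp)
    have e1 : mvfderiv cylModel (height ∘ s) (proj p)
        (mfderiv (𝓡 2) cylModel (sliceMap p.1) p.2 u) = 0 := by
      have h1 := mfderiv_comp_apply p.2 (g := height ∘ s) (f := sliceMap p.1)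
        (I := 𝓡 2) (I' := cylModel) (I'' := 𝓘(ℝ, ℝ)) hh (hslice p.2) u
      have h2 : (height ∘ s) ∘ sliceMap p.1 =ᶠ[𝓝 p.2] fun _ => (p.1 : ℝ) := by
        have hc : ContinuousAt (fun w : Sphere2 => (p.1, w)) p.2 := by fun_prop
        filter_upwards [hc (s.open_target.mem_nhds hp)] with w hw
        have : s (sliceMap p.1 w) = (p.1, w) := cylInverse_proj hw
        simp only [Function.comp, this]
        rfl
      rw [h2.mfderiv_eq, mfderiv_const] at h1
      exact h1.symm
    have e2 : mvfderiv cylModel (direction ∘ s) (proj p) (mfderiv cylModel cylModel ρ (proj p) v) =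
        mvfderiv cylModel (direction ∘ s) (proj p) v := by
      have h0 : HasMFDerivAt cylModel 𝓘(ℝ, E3) (direction ∘ s) (ρ (proj p))
          (mvfderiv cylModel (direction ∘ s) (proj p)) := by
        rw [hρp]; exact hd.hasMFDerivAt
      have h1 := (h0.comp (proj p) (hρ.mdifferentiableAt (by simp)).hasMFDerivAt).mfderiv
      have h2 : (direction ∘ s) ∘ ρ =ᶠ[𝓝 (proj p)] direction ∘ s := by
        have hc : ContinuousAt (fun y => (p.1, (s y).2)) (proj p) :=
          continuousAt_const.prodMk hs2.continuousAt
        have : (p.1, (s (proj p)).2) ∈ s.target := by rw [hsp]; exact hp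
        filter_upwards [hc (s.open_target.mem_nhds this)] with w hw
        have : s (ρ w) = (p.1, (s w).2) := cylInverse_proj hw
        simp only [Function.comp, this]
        rfl
      rw [h2.mfderiv_eq] at h1
      exact (DFunLike.congr_fun h1 v).symm
    refine (hin _ _).trans ?_
    let z : TangentSpace cylModel (proj p) := mfderiv cylModel cylModel ρ (proj p) v
    have e3 : mvfderiv cylModel (direction ∘ s) (proj p)
        (v - z) = 0 := by
      rw [map_sub, sub_eq_zero]
      exact e2.symm
    erw [e1, e3]
    rw [inner_zero_right, inner_zero_left, add_zero]

/-- The topology of the Grassmann bundle is induced by orthogonal projections. By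
`toEndomorphism_slicePlane` these are differentials, in `y`, of a map smooth jointly in `p` and `y`,
so they depend continuously on `p`. -/
theorem continuous_slicePlane :
    Continuous fun p : Cylinder => slicePlane p.1 p.2 := by
  refine continuous_induced_rng.2 (continuous_iff_continuousAt.2 fun p₀ => ?_)
  set s := cylInverse p₀
  have hy : proj p₀ ∈ s.source := proj_mem_cylInverse_source (mem_cylInverse_target p₀)
  have hf : ContMDiffAt (cylModel.prod cylModel) cylModel ∞
      (Function.uncurry fun (p : Cylinder) (y : QuotCyl) => proj (p.1, (s y).2)) (p₀, proj p₀) := by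
    refine contMDiff_proj.contMDiffAt.comp _ ?_
    have h1 : ContMDiffAt (cylModel.prod cylModel) 𝓘(ℝ, ℝ) ∞
        (fun q : Cylinder × QuotCyl => q.1.1) (p₀, proj p₀) :=
      (contMDiff_fst.comp contMDiff_fst).contMDiffAt
    have h2 : ContMDiffAt (cylModel.prod cylModel) cylModel ∞
        (fun q : Cylinder × QuotCyl => s q.2) (p₀, proj p₀) :=
      (contMDiffAt_cylInverse hy).comp (p₀, proj p₀) contMDiffAt_snd
    exact h1.prodMk (contMDiffAt_snd.comp _ h2)
  have h1 := hf.mfderiv (fun (p : Cylinder) (y : QuotCyl) => proj (p.1, (s y).2)) proj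
    (contMDiff_proj.contMDiffAt (x := p₀)) (m := ∞) (by simp)
  have hev : ∀ᶠ p in 𝓝 p₀, p ∈ s.target := s.open_target.mem_nhds (mem_cylInverse_target p₀)
  refine (continuousAt_hom_bundle _ _).2 ⟨contMDiff_proj.continuous.continuousAt, ?_⟩
  refine h1.continuousAt.congr ?_
  filter_upwards [hev] with p hp
  have e1 : ∀ q ∈ s.target, proj (q.1, (s (proj q)).2) = proj q := fun q hq => by
    have : s (proj q) = q := cylInverse_proj hq
    rw [this]
  have e2 : (GrassmannBundle.toEndomorphism cylModel (slicePlane p.1 p.2)).2 =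
      mfderiv cylModel cylModel (fun y => proj (p.1, (s y).2)) (proj p) :=
    toEndomorphism_slicePlane p₀ p hp
  simp only [inTangentCoordinates]
  rw [e1 p hp, e1 p₀ (mem_cylInverse_target p₀)]
  simp only [Function.comp]
  erw [e2]
  rfl

/-! ### The varifolds of the slices -/

/-- Points over different base points are separated in the base, points of one fibre in a
trivialization. It yields that the Grassmann bundle is Hausdorff, so that compact families of planes
are closed. -/
theorem t2Space_totalSpace {B F : Type*} {E : B → Type*} [TopologicalSpace B] [T2Space B]
    [TopologicalSpace F] [T2Space F] [TopologicalSpace (Bundle.TotalSpace F E)]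
    [∀ b, TopologicalSpace (E b)] [FiberBundle F E] : T2Space (Bundle.TotalSpace F E) := by
  refine ⟨fun p q hpq => ?_⟩
  by_cases hb : p.proj = q.proj
  · set e := trivializationAt F E p.proj
    have hp : p ∈ e.source := FiberBundle.mem_trivializationAt_proj_source
    have hq : q ∈ e.source := by
      rw [e.mem_source, ← hb]
      exact mem_baseSet_trivializationAt F E p.proj
    have hne : e p ≠ e q := fun h => hpq (e.injOn hp hq h)
    obtain ⟨U, V, hU, hV, hpU, hqV, hUV⟩ := t2_separation hne
    refine ⟨e.source ∩ e ⁻¹' U, e.source ∩ e ⁻¹' V,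
      e.continuousOn.isOpen_inter_preimage e.open_source hU,
      e.continuousOn.isOpen_inter_preimage e.open_source hV, ⟨hp, hpU⟩, ⟨hq, hqV⟩, ?_⟩
    exact (hUV.preimage e).mono inter_subset_right inter_subset_right
  · exact separated_by_continuous (FiberBundle.continuous_proj F E) hb

section Grassmann

variable {E : Type} [NormedAddCommGroup E] [NormedSpace ℝ E]
  [FiniteDimensional ℝ E] {H : Type} [TopologicalSpace H] {I : ModelWithCorners ℝ E H}
  {N : Type} [EMetricSpace N] [ChartedSpace H N] [IsManifold I ∞ N]
  [Bundle.RiemannianBundle (fun x : N => TangentSpace I x)]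

theorem plane_eq_range_toEndomorphism (p : GrassmannBundle I N) :
    p.plane = (p.toEndomorphism I).2.range := by
  have : FiniteDimensional ℝ (TangentSpace I p.base) := inferInstanceAs (FiniteDimensional ℝ E)
  have : p.plane.HasOrthogonalProjection := inferInstance
  change p.plane = p.plane.starProjection.range
  exact (Submodule.range_starProjection p.plane).symm

theorem toEndomorphism_injective :
    Function.Injective (GrassmannBundle.toEndomorphism I (N := N)) := by
  intro p q h
  have hp := plane_eq_range_toEndomorphism p
  have hq := plane_eq_range_toEndomorphism q
  have hb : p.base = q.base := congrArg Bundle.TotalSpace.proj h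
  obtain ⟨b, P, h1⟩ := p
  obtain ⟨b', Q, h2⟩ := q
  obtain rfl : b = b' := hb
  dsimp only at hp hq
  have h3 := eq_of_heq (Bundle.TotalSpace.mk.inj h).2
  have : P = Q := by
    rw [hp, hq]
    exact congrArg (fun A : TangentSpace I b →L[ℝ] TangentSpace I b => A.range) h3
  subst this
  rfl

instance [IsContMDiffRiemannianBundle I ∞ E (fun x : N => TangentSpace I x)] :
    T2Space (GrassmannBundle I N) := by
  have := t2Space_totalSpace (B := N) (F := E →L[ℝ] E)
    (E := fun x : N => TangentSpace I x →L[ℝ] TangentSpace I x)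
  exact .of_injective_continuous toEndomorphism_injective continuous_induced_dom

end Grassmann

/-- The definition installs the Borel σ-algebra on the carrier by hand. This form accepts any
instance which is Borel, in particular those already present on the sphere and on the projective
plane. -/
theorem varifold_eq {E : Type} [NormedAddCommGroup E] [NormedSpace ℝ E]
    [FiniteDimensional ℝ E] {H : Type} [TopologicalSpace H] {I : ModelWithCorners ℝ E H}
    {N : Type} [EMetricSpace N] [ChartedSpace H N] [IsManifold I ∞ N]
    [Bundle.RiemannianBundle (fun x : N => TangentSpace I x)] [MeasurableSpace N] [BorelSpace N]
    (S : EmbeddedSurface I N) [m : MeasurableSpace S.carrier] [BorelSpace S.carrier] :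
    S.varifold = ((area (N := N)).comap S.toFun).map S.tangentPlane := by
  obtain rfl : m = borel S.carrier := BorelSpace.measurable_eq
  rfl

theorem varifold_sphereSurface {t : OpenInterval} (ht : 0 < (t : ℝ))
    (h : IsSmoothEmbedding (𝓡 2) cylModel ∞ (sliceMap t)) :
    (sphereSurface t h).varifold = sphArea.map (slicePlane t) := by
  let : MeasurableSpace (sphereSurface t h).carrier := inferInstanceAs (MeasurableSpace Sphere2)
  have : BorelSpace (sphereSurface t h).carrier := inferInstanceAs (BorelSpace Sphere2)
  rw [varifold_eq, ← comap_sliceMap_area ht]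
  rfl

/-- The central slice is `planeMap` after a local diffeomorphism, whose differential is onto, so the
two differentials have the same range. -/
theorem tangentPlane_planeSurface (h : IsSmoothEmbedding (𝓡 2) cylModel ∞ planeMap)
    (w : Sphere2) : (planeSurface h).tangentPlane (quotientProj Sphere2 ℤˣ w) =
      slicePlane originInterval w := by
  refine GrassmannBundle.ext rfl ?_
  have hq : IsLocalDiffeomorph (𝓡 2) (𝓡 2) ∞ (quotientProj Sphere2 ℤˣ) :=
    isLocalDiffeomorph_quotientProj (𝓡 2) ∞ fun u => contMDiff_smul_sphere u
  have h1 : mfderiv (𝓡 2) cylModel (sliceMap originInterval) w =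
      (mfderiv (𝓡 2) cylModel planeMap (quotientProj Sphere2 ℤˣ w)).comp
        (mfderiv (𝓡 2) (𝓡 2) (quotientProj Sphere2 ℤˣ) w) :=
    mfderiv_comp w (g := planeMap) (h.contMDiff.mdifferentiableAt (by simp))
      (hq.contMDiff.mdifferentiableAt (by simp))
  change (mfderiv (𝓡 2) cylModel planeMap (quotientProj Sphere2 ℤˣ w)).range =
    (mfderiv (𝓡 2) cylModel (sliceMap originInterval) w).range
  rw [h1]
  refine le_antisymm ?_ ?_
  · rintro _ ⟨v, rfl⟩
    obtain ⟨u, hu⟩ := (hq.mfderivToContinuousLinearEquiv (by simp) w).surjective v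
    exact ⟨u, congrArg (mfderiv (𝓡 2) cylModel planeMap (quotientProj Sphere2 ℤˣ w)) hu⟩
  · rintro _ ⟨v, rfl⟩
    exact ⟨_, rfl⟩

theorem two_smul_varifold_planeSurface (h : IsSmoothEmbedding (𝓡 2) cylModel ∞ planeMap) :
    2 • (planeSurface h).varifold = sphArea.map (slicePlane originInterval) := by
  let : MeasurableSpace (planeSurface h).carrier := inferInstanceAs (MeasurableSpace ProjPlane)
  have : BorelSpace (planeSurface h).carrier := inferInstanceAs (BorelSpace ProjPlane)
  obtain ⟨T, hT⟩ : ∃ T : ProjPlane → GrassmannBundle cylModel QuotCyl,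
    T = (planeSurface h).tangentPlane := ⟨_, rfl⟩
  have hcomp : T ∘ quotientProj Sphere2 ℤˣ = slicePlane originInterval := by
    rw [hT]; exact funext (tangentPlane_planeSurface h)
  have hq : Topology.IsQuotientMap (quotientProj Sphere2 ℤˣ) := isQuotientMap_quotient_mk'
  have hc : Continuous T := by
    refine hq.continuous_iff.2 ?_
    rw [hcomp]
    exact continuous_slicePlane.comp (Continuous.prodMk_right originInterval)
  have hv : (planeSurface h).varifold = ((area (N := QuotCyl)).comap planeMap).map T := by
    rw [varifold_eq, hT]
    rfl
  rw [hv, two_smul, ← Measure.map_add _ _ hc.measurable, ← two_smul ℕ,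
    ← map_sphArea_eq_two_smul, Measure.map_map hc.measurable hq.continuous.measurable, hcomp]

/-- Continuity of `f` is assumed only along the slice, which suits Jacobians of flows. The planes of
the slice form a compact, hence closed, set carrying the whole measure, and `f` is continuous on it
because `slicePlane t` is a closed map. -/
theorem integral_map_slicePlane (t : OpenInterval) {f : GrassmannBundle cylModel QuotCyl → ℝ}
    (hf : Continuous fun w => f (slicePlane t w)) :
    ∫ p, f p ∂(sphArea.map (slicePlane t)) = ∫ w, f (slicePlane t w) ∂sphArea := by
  have hc : Continuous (slicePlane t) := continuous_slicePlane.comp (Continuous.prodMk_right t)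
  refine integral_map hc.measurable.aemeasurable ?_
  have hK : IsCompact (range (slicePlane t)) := isCompact_range hc
  have hfK : ContinuousOn f (range (slicePlane t)) := by
    refine continuousOn_iff_isClosed.2 fun Z hZ => ⟨slicePlane t '' ((fun w => f (slicePlane t w)) ⁻¹' Z),
      ((hZ.preimage hf).isCompact.image hc).isClosed, ?_⟩
    ext p
    constructor
    · rintro ⟨hp, w, rfl⟩
      exact ⟨⟨w, hp, rfl⟩, w, rfl⟩
    · rintro ⟨⟨w, hw, rfl⟩, hp⟩
      exact ⟨hw, hp⟩
  have h1 := hfK.aestronglyMeasurable_of_isCompact hK hK.isClosed.measurableSet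
    (μ := sphArea.map (slicePlane t))
  rwa [Measure.restrict_eq_self_of_ae_mem] at h1
  exact (ae_map_iff hc.measurable.aemeasurable (p := fun x => x ∈ range (slicePlane t))
    hK.isClosed.measurableSet).2 (Eventually.of_forall fun w => ⟨w, rfl⟩)

/-- All the measures are images of the same finite measure, so pointwise convergence of the planes
and boundedness of `φ` suffice. -/
theorem varifoldTendsto_slicePlane {t : ℕ → OpenInterval}
    (ht_lim : Tendsto (fun j => (t j : ℝ)) atTop (𝓝 0)) :
    VarifoldTendsto cylModel (fun j => sphArea.map (slicePlane (t j)))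
      (sphArea.map (slicePlane originInterval)) := by
  intro φ hφ hφc
  have hcs : ∀ s, Continuous fun w => φ (slicePlane s w) := fun s =>
    hφ.comp (continuous_slicePlane.comp (Continuous.prodMk_right s))
  simp only [integral_map_slicePlane _ (hcs _)]
  obtain ⟨C, hC⟩ := hφ.bounded_above_of_compact_support hφc
  refine tendsto_integral_of_dominated_convergence (fun _ => C)
    (fun j => (hcs _).aestronglyMeasurable) (integrable_const C)
    (fun j => Eventually.of_forall fun w => hC _) (Eventually.of_forall fun w => ?_)
  have hlim : Tendsto t atTop (𝓝 originInterval) := tendsto_subtype_rng.2 ht_lim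
  have h1 : Continuous fun s : OpenInterval => φ (slicePlane s w) :=
    hφ.comp (continuous_slicePlane.comp (Continuous.prodMk_left w))
  exact (h1.tendsto originInterval).comp hlim

instance (t : OpenInterval) : IsFiniteMeasure (sphArea.map (slicePlane t)) :=
  Measure.isFiniteMeasure_map _ _

/-! ### The divergence theorem on the sphere -/

/-- Differentiability of finite order is an open condition, and compactness of the sphere makes the
range of times uniform. -/
theorem eventually_forall_contDiffAt_sphere {n : ℕ} {F : Type*} [NormedAddCommGroup F]
    [NormedSpace ℝ F] {f : ℝ × E3 → F} (hf : ∀ w : Sphere2, ContDiffAt ℝ n f (0, (w : E3))) :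
    ∀ᶠ s in 𝓝 (0 : ℝ), ∀ w : Sphere2, ContDiffAt ℝ n f (s, (w : E3)) := by
  have h := (isCompact_univ (X := Sphere2)).eventually_forall_of_forall_eventually (x₀ := (0 : ℝ))
    (P := fun s w => ContDiffAt ℝ n f (s, (w : E3))) fun w _ => by
      have hc : Continuous fun z : ℝ × Sphere2 => (z.1, (z.2 : E3)) := by fun_prop
      exact (hc.tendsto (0, w)).eventually ((hf w).eventually (by simp))
  exact h.mono fun s hs w => hs w (mem_univ w)

theorem hasDerivAt_integral_sphere {F : ℝ × E3 → ℝ}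
    (hF : ∀ w : Sphere2, ContDiffAt ℝ 1 F (0, (w : E3))) :
    HasDerivAt (fun s => ∫ w : Sphere2, F (s, w) ∂sphArea)
      (∫ w : Sphere2, fderiv ℝ F (0, (w : E3)) (1, 0) ∂sphArea) 0 := by
  have h1 := eventually_forall_contDiffAt_sphere (n := 1) (f := F) (by simpa using hF)
  obtain ⟨ε, hε, hball⟩ := Metric.eventually_nhds_iff_ball.1 h1
  have hc : Continuous fun z : ℝ × Sphere2 => (z.1, (z.2 : E3)) := by fun_prop
  have hG : ContinuousOn (fun z : ℝ × Sphere2 => fderiv ℝ F (z.1, (z.2 : E3)) (1, 0))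
      (Metric.closedBall 0 (ε / 2) ×ˢ univ) := by
    rintro ⟨s, w⟩ ⟨hs, -⟩
    have h2 : ContDiffAt ℝ 1 F (s, (w : E3)) :=
      hball s (Metric.closedBall_subset_ball (half_lt_self hε) hs) w
    have h3 : ContinuousAt (fderiv ℝ F) (s, (w : E3)) :=
      (h2.fderiv_right (m := 0) (by simp)).continuousAt
    exact ((h3.comp (f := fun z : ℝ × Sphere2 => (z.1, (z.2 : E3))) (x := (s, w))
      hc.continuousAt).clm_apply continuousAt_const).continuousWithinAt
  obtain ⟨C, hC⟩ := ((isCompact_closedBall (0 : ℝ) (ε / 2)).prod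
    (isCompact_univ (X := Sphere2))).exists_bound_of_continuousOn hG
  have hcont : ∀ s ∈ Metric.ball (0 : ℝ) ε, Continuous fun w : Sphere2 => F (s, (w : E3)) := by
    intro s hs
    refine continuous_iff_continuousAt.2 fun w => ?_
    exact (hball s hs w).continuousAt.comp (f := fun w : Sphere2 => (s, (w : E3)))
      (by fun_prop : Continuous fun w : Sphere2 => (s, (w : E3))).continuousAt
  refine (hasDerivAt_integral_of_dominated_loc_of_deriv_le (bound := fun _ => C)
    (F := fun s (w : Sphere2) => F (s, (w : E3)))
    (F' := fun s (w : Sphere2) => fderiv ℝ F (s, (w : E3)) (1, 0))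
    (Metric.closedBall_mem_nhds 0 (half_pos hε)) ?_ ?_ ?_ ?_ (integrable_const C) ?_).2
  · filter_upwards [Metric.ball_mem_nhds 0 hε] with s hs
    exact (hcont s hs).aestronglyMeasurable
  · exact (hcont 0 (Metric.mem_ball_self hε)).integrable_of_hasCompactSupport
      (HasCompactSupport.of_compactSpace _)
  · refine Continuous.aestronglyMeasurable ?_
    have h2 : ContinuousOn (fun w : Sphere2 => fderiv ℝ F ((0 : ℝ), (w : E3)) (1, 0)) univ :=
      hG.comp (f := fun w : Sphere2 => ((0 : ℝ), w)) (by fun_prop)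
        fun w _ => ⟨Metric.mem_closedBall_self (half_pos hε).le, mem_univ _⟩
    exact continuousOn_univ.1 h2
  · exact Eventually.of_forall fun w s hs => hC (s, w) ⟨hs, mem_univ _⟩
  · refine Eventually.of_forall fun w s hs => ?_
    have h2 := ((hball s (Metric.closedBall_subset_ball (half_lt_self hε) hs) w).differentiableAt
      (by simp)).hasFDerivAt
    have h3 : HasDerivAt (fun s : ℝ => (s, (w : E3))) (1, 0) s :=
      (hasDerivAt_id s).prodMk (hasDerivAt_const s _)
    exact h2.comp_hasDerivAt s h3

/-- The vectors of the standard basis of `ℝ³`. -/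
abbrev stdVec (i : Fin 3) : E3 := EuclideanSpace.single i (1 : ℝ)

/-- The rotation by the angle `θ` in a coordinate plane. -/
def planeRotation {i j : Fin 3} (hij : i ≠ j) (θ : ℝ) : E3 ≃ₗᵢ[ℝ] E3 :=
  LinearIsometry.toLinearIsometryEquiv
    { toFun := fun x => x + ((Real.cos θ - 1) * x i - Real.sin θ * x j) • stdVec i +
        ((Real.cos θ - 1) * x j + Real.sin θ * x i) • stdVec j
      map_add' := fun x y => by
        simp only [PiLp.add_apply]
        module
      map_smul' := fun c x => by
        simp only [PiLp.smul_apply, smul_eq_mul, RingHom.id_apply]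
        module
      norm_map' := fun x => by
        rw [← sq_eq_sq₀ (norm_nonneg _) (norm_nonneg _)]
        change ‖x + ((Real.cos θ - 1) * x i - Real.sin θ * x j) • stdVec i +
          ((Real.cos θ - 1) * x j + Real.sin θ * x i) • stdVec j‖ ^ 2 = _
        have h := Real.sin_sq_add_cos_sq θ
        have e1 : inner ℝ (stdVec i) (stdVec j) = 0 := by
          simp [EuclideanSpace.inner_single_left, hij]
        have e2 : ∀ k, inner ℝ x (stdVec k) = x k := fun k => by
          simp [EuclideanSpace.inner_single_right]
        have e3 : ∀ k, ‖stdVec k‖ = 1 := fun k => by simp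
        rw [norm_add_sq_real, norm_add_sq_real, inner_add_left, real_inner_smul_left,
          real_inner_smul_right, real_inner_smul_right, real_inner_smul_right, e1, e2, e2,
          norm_smul, norm_smul, e3, e3, Real.norm_eq_abs, Real.norm_eq_abs, mul_one, mul_one,
          sq_abs, sq_abs]
        linear_combination (x i ^ 2 + x j ^ 2) * h } rfl

theorem integral_rot (g : E3 ≃ₗᵢ[ℝ] E3) (f : E3 → ℝ) :
    ∫ w : Sphere2, f (g w) ∂sphArea = ∫ w : Sphere2, f w ∂sphArea := by
  let e : Sphere2 ≃ₜ Sphere2 :=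
    { toFun := rot g
      invFun := rot g.symm
      left_inv := rot_symm_rot g
      right_inv := rot_rot_symm g
      continuous_toFun := (contMDiff_rot g).continuous
      continuous_invFun := (contMDiff_rot g.symm).continuous }
  have h : MeasurePreserving e sphArea sphArea :=
    ⟨e.continuous.measurable, map_rot_sphArea g⟩
  exact h.integral_comp e.measurableEmbedding fun w : Sphere2 => f w

/-- The integral of `f` composed with the rotation by the angle `s` does not depend on `s`. The
integrand is its derivative at `s = 0`, namely `f` differentiated along the rotation field of the
plane of `i` and `j`. -/
theorem integral_fderiv_rotation {f : E3 → ℝ} (hf : ∀ w : Sphere2, ContDiffAt ℝ 1 f w)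
    (i j : Fin 3) :
    ∫ w : Sphere2, fderiv ℝ f w ((w : E3) i • stdVec j - (w : E3) j • stdVec i) ∂sphArea = 0 := by
  rcases eq_or_ne i j with rfl | hij
  · simp
  let g : ℝ × E3 → E3 := fun z => z.2 +
    ((Real.cos z.1 - 1) * z.2 i - Real.sin z.1 * z.2 j) • stdVec i +
        ((Real.cos z.1 - 1) * z.2 j + Real.sin z.1 * z.2 i) • stdVec j
  have hg : ContDiff ℝ 1 g := by
    have : ∀ k : Fin 3, ContDiff ℝ 1 fun z : ℝ × E3 => z.2 k := fun k =>
      (EuclideanSpace.proj (𝕜 := ℝ) k).contDiff.comp contDiff_snd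
    have hcos : ContDiff ℝ 1 fun z : ℝ × E3 => Real.cos z.1 := Real.contDiff_cos.comp contDiff_fst
    have hsin : ContDiff ℝ 1 fun z : ℝ × E3 => Real.sin z.1 := Real.contDiff_sin.comp contDiff_fst
    exact (contDiff_snd.add ((((hcos.sub contDiff_const).mul (this i)).sub
      (hsin.mul (this j))).smul contDiff_const)).add ((((hcos.sub contDiff_const).mul (this j)).add
      (hsin.mul (this i))).smul contDiff_const)
  have hg0 : ∀ x, g (0, x) = x := fun x => by simp [g]
  have hF : ∀ w : Sphere2, ContDiffAt ℝ 1 (f ∘ g) (0, (w : E3)) := fun w =>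
    ContDiffAt.comp _ (by rw [hg0]; exact hf w) hg.contDiffAt
  have h1 := hasDerivAt_integral_sphere hF
  have h2 : (fun s => ∫ w : Sphere2, (f ∘ g) (s, (w : E3)) ∂sphArea) =
      fun _ => ∫ w : Sphere2, f w ∂sphArea := by
    funext s
    exact integral_rot (planeRotation hij s) f
  rw [h2] at h1
  rw [← h1.unique (hasDerivAt_const 0 _)]
  refine integral_congr_ae (Eventually.of_forall fun w => ?_)
  have h3 : HasFDerivAt f (fderiv ℝ f w) (g (0, (w : E3))) := by
    rw [hg0]; exact ((hf w).differentiableAt (by simp)).hasFDerivAt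
  have h4 : HasFDerivAt g (fderiv ℝ g (0, (w : E3))) (0, (w : E3)) :=
    (hg.differentiable (by simp) _).hasFDerivAt
  have h5 : HasDerivAt (fun s : ℝ => (s, (w : E3))) (1, 0) 0 :=
    (hasDerivAt_id _).prodMk (hasDerivAt_const _ _)
  have h6 := h4.comp_hasDerivAt (0 : ℝ) h5
  have h7 : HasDerivAt (fun s : ℝ => (w : E3) +
      ((Real.cos s - 1) * (w : E3) i - Real.sin s * (w : E3) j) • stdVec i +
        ((Real.cos s - 1) * (w : E3) j + Real.sin s * (w : E3) i) • stdVec j)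
      ((w : E3) i • stdVec j - (w : E3) j • stdVec i) 0 := by
    have hc := (Real.hasDerivAt_cos 0).sub_const (1 : ℝ)
    have hs := Real.hasDerivAt_sin 0
    have h8 := (((((hc.mul_const ((w : E3) i)).sub (hs.mul_const ((w : E3) j))).smul_const
      (stdVec i)).const_add (w : E3))).add
      (((hc.mul_const ((w : E3) j)).add (hs.mul_const ((w : E3) i))).smul_const (stdVec j))
    refine h8.congr_deriv ?_
    simp
    module
  change fderiv ℝ f w _ = fderiv ℝ (f ∘ g) (0, (w : E3)) (1, 0)
  rw [(h3.comp _ h4).fderiv, h7.unique h6]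
  rfl

/-- The divergence theorem for tangential vector fields on the sphere. -/
theorem integral_divergence_eq_zero {X : E3 → E3} (hX : ∀ w : Sphere2, ContDiffAt ℝ 1 X w)
    (htan : ∀ w : Sphere2, inner ℝ (w : E3) (X w) = 0)
    (hrad : ∀ w : Sphere2, fderiv ℝ X w w = 0) :
    ∫ w : Sphere2, ∑ k, fderiv ℝ X w (stdVec k) k ∂sphArea = 0 := by
  have hXk : ∀ (w : Sphere2) (k : Fin 3), ContDiffAt ℝ 1 (fun x => X x k) w := fun w k =>
    (EuclideanSpace.proj (𝕜 := ℝ) k).contDiff.contDiffAt.comp _ (hX w)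
  have hu : ∀ (i j : Fin 3) (w : Sphere2), ContDiffAt ℝ 1 (fun x : E3 => x i * X x j) w :=
    fun i j w => ((EuclideanSpace.proj (𝕜 := ℝ) i).contDiff.contDiffAt).mul (hXk w j)
  have hint : ∀ i j : Fin 3, Integrable (fun w : Sphere2 => fderiv ℝ (fun x : E3 => x i * X x j) w
      ((w : E3) i • stdVec j - (w : E3) j • stdVec i)) sphArea := by
    intro i j
    refine Continuous.integrable_of_hasCompactSupport ?_ (HasCompactSupport.of_compactSpace _)
    refine continuous_iff_continuousAt.2 fun w => ?_
    have h1 : ContinuousAt (fderiv ℝ (fun x : E3 => x i * X x j)) w :=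
      ((hu i j w).fderiv_right (m := 0) (by simp)).continuousAt
    refine (h1.comp (f := fun w : Sphere2 => (w : E3)) continuous_subtype_val.continuousAt).clm_apply ?_
    have h2 : ∀ k : Fin 3, Continuous fun w : Sphere2 => (w : E3) k := fun k =>
      (EuclideanSpace.proj (𝕜 := ℝ) k).continuous.comp continuous_subtype_val
    exact (((h2 i).smul continuous_const).sub ((h2 j).smul continuous_const)).continuousAt
  -- Summing the rotational derivatives of `xᵢ Xⱼ` over all `i, j` gives `|w|² div X - ⟨w, DX w⟩ - 2
  -- ⟨w, X⟩`. On the unit sphere this is `div X`, by `hrad` and `htan`.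
  have h0 : ∫ w : Sphere2, ∑ i, ∑ j, fderiv ℝ (fun x : E3 => x i * X x j) w
      ((w : E3) i • stdVec j - (w : E3) j • stdVec i) ∂sphArea = 0 := by
    rw [integral_finsetSum _ fun i _ => integrable_finsetSum _ fun j _ => hint i j]
    refine Finset.sum_eq_zero fun i _ => ?_
    rw [integral_finsetSum _ fun j _ => hint i j]
    exact Finset.sum_eq_zero fun j _ => integral_fderiv_rotation (hu i j) i j
  rw [← h0]
  refine integral_congr_ae (Eventually.of_forall fun w => ?_)
  dsimp only
  have hd : ∀ (i j : Fin 3) (v : E3), fderiv ℝ (fun x : E3 => x i * X x j) w v =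
      (w : E3) i * fderiv ℝ X w v j + v i * X w j := by
    intro i j v
    have h1 : HasFDerivAt (fun x : E3 => X x j)
        ((EuclideanSpace.proj (𝕜 := ℝ) j).comp (fderiv ℝ X w)) (w : E3) :=
      (EuclideanSpace.proj (𝕜 := ℝ) (ι := Fin 3) j).hasFDerivAt.comp (w : E3)
        ((hX w).differentiableAt (by simp)).hasFDerivAt
    have h2 : HasFDerivAt (fun x : E3 => x i) (EuclideanSpace.proj (𝕜 := ℝ) (ι := Fin 3) i) (w : E3) :=
      (EuclideanSpace.proj (𝕜 := ℝ) (ι := Fin 3) i).hasFDerivAt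
    have h3 : HasFDerivAt (fun x : E3 => x i * X x j) _ (w : E3) := h2.mul h1
    rw [h3.fderiv]
    simp [mul_comm]
  have hw : (w : E3) = ∑ k, (w : E3) k • stdVec k := by
    ext l
    fin_cases l <;> simp [Fin.sum_univ_three]
  have hn : (w : E3) 0 ^ 2 + (w : E3) 1 ^ 2 + (w : E3) 2 ^ 2 = 1 := by
    have := EuclideanSpace.real_norm_sq_eq (w : E3)
    rw [Fin.sum_univ_three, mem_sphere_zero_iff_norm.1 w.2] at this
    linarith
  have ht : (w : E3) 0 * X w 0 + (w : E3) 1 * X w 1 + (w : E3) 2 * X w 2 = 0 := by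
    have := htan w
    rw [PiLp.inner_apply, Fin.sum_univ_three] at this
    simp at this
    linarith
  have hr : ∀ l : Fin 3, (w : E3) 0 * fderiv ℝ X w (stdVec 0) l +
      (w : E3) 1 * fderiv ℝ X w (stdVec 1) l + (w : E3) 2 * fderiv ℝ X w (stdVec 2) l = 0 := by
    intro l
    have h1 := hrad w
    nth_rewrite 2 [hw] at h1
    rw [map_sum, Fin.sum_univ_three] at h1
    simp only [map_smul] at h1
    have := congrArg (fun v : E3 => v l) h1
    simpa using this
  simp only [hd, Fin.sum_univ_three, map_sub, map_smul]
  simp only [PiLp.sub_apply, PiLp.smul_apply, smul_eq_mul, PiLp.single_apply]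
  simp
  have r0 := hr 0
  have r1 := hr 1
  have r2 := hr 2
  generalize fderiv ℝ X w (stdVec 0) = D0 at *
  generalize fderiv ℝ X w (stdVec 1) = D1 at *
  generalize fderiv ℝ X w (stdVec 2) = D2 at *
  linear_combination (-(D0 0 + D1 1 + D2 2)) * hn + 2 * ht + (w : E3) 0 * r0 + (w : E3) 1 * r1 +
    (w : E3) 2 * r2

/-! ### The first variation of the area of a deformation of the sphere -/

/-- The Gram matrix of the partial derivatives of the map `(h, d)`, completed in the radial
direction. -/
def completedGram (h : ℝ × E3 → ℝ) (d : ℝ × E3 → E3) (z : ℝ × E3) : Matrix (Fin 3) (Fin 3) ℝ :=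
  Matrix.of fun k l => fderiv ℝ h z (0, stdVec k) * fderiv ℝ h z (0, stdVec l) +
    inner ℝ (fderiv ℝ d z (0, stdVec k)) (fderiv ℝ d z (0, stdVec l)) + z.2 k * z.2 l

theorem contDiffAt_det_completedGram {h : ℝ × E3 → ℝ} {d : ℝ × E3 → E3} {z : ℝ × E3}
    (hh : ContDiffAt ℝ 2 h z) (hd : ContDiffAt ℝ 2 d z) :
    ContDiffAt ℝ 1 (fun z => (completedGram h d z).det) z := by
  have h1 : ∀ k, ContDiffAt ℝ 1 (fun z => fderiv ℝ h z (0, stdVec k)) z := fun k =>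
    (hh.fderiv_right (m := 1) (by norm_num)).clm_apply contDiffAt_const
  have h2 : ∀ k, ContDiffAt ℝ 1 (fun z => fderiv ℝ d z (0, stdVec k)) z := fun k =>
    (hd.fderiv_right (m := 1) (by norm_num)).clm_apply contDiffAt_const
  have h3 : ∀ k : Fin 3, ContDiffAt ℝ 1 (fun z : ℝ × E3 => z.2 k) z := fun k =>
    ((EuclideanSpace.proj (𝕜 := ℝ) k).contDiff.comp contDiff_snd).contDiffAt
  have h4 : ∀ k l, ContDiffAt ℝ 1 (fun z => completedGram h d z k l) z := fun k l =>
    (((h1 k).mul (h1 l)).add ((h2 k).inner ℝ (h2 l))).add ((h3 k).mul (h3 l))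
  simp only [Matrix.det_fin_three]
  exact (((((((h4 0 0).mul (h4 1 1)).mul (h4 2 2)).sub (((h4 0 0).mul (h4 1 2)).mul (h4 2 1))).sub
    (((h4 0 1).mul (h4 1 0)).mul (h4 2 2))).add (((h4 0 1).mul (h4 1 2)).mul (h4 2 0))).add
    (((h4 0 2).mul (h4 1 0)).mul (h4 2 1))).sub (((h4 0 2).mul (h4 1 1)).mul (h4 2 0))

/-- At the identity matrix the derivative of the determinant is the trace. -/
theorem hasDerivAt_sqrt_det {B : ℝ → Matrix (Fin 3) (Fin 3) ℝ} {B' : Matrix (Fin 3) (Fin 3) ℝ}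
    (hB : ∀ k l, HasDerivAt (fun s => B s k l) (B' k l) 0) (h0 : B 0 = 1) :
    HasDerivAt (fun s => √(B s).det) (B'.trace / 2) 0 := by
  have hdet : HasDerivAt (fun s => (B s).det) B'.trace 0 := by
    simp only [Matrix.det_fin_three]
    have h := (((((((hB 0 0).mul (hB 1 1)).mul (hB 2 2)).sub
      (((hB 0 0).mul (hB 1 2)).mul (hB 2 1))).sub
      (((hB 0 1).mul (hB 1 0)).mul (hB 2 2))).add (((hB 0 1).mul (hB 1 2)).mul (hB 2 0))).add
      (((hB 0 2).mul (hB 1 0)).mul (hB 2 1))).sub (((hB 0 2).mul (hB 1 1)).mul (hB 2 0))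
    refine h.congr_deriv ?_
    simp [h0, Matrix.trace, Fin.sum_univ_three]
  have h := hdet.sqrt (by simp [h0])
  refine h.congr_deriv ?_
  simp [h0]

theorem inner_stdVec (x : E3) (k : Fin 3) : inner ℝ x (stdVec k) = x k := by
  simp [EuclideanSpace.inner_single_right]

theorem inner_stdVec_stdVec (k l : Fin 3) :
    inner ℝ (stdVec k) (stdVec l) = (1 : Matrix (Fin 3) (Fin 3) ℝ) k l := by
  rw [inner_stdVec]
  simp [Matrix.one_apply, PiLp.single_apply, eq_comm]

theorem sum_coord_smul_stdVec (x : E3) : ∑ k, x k • stdVec k = x := by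
  ext l
  fin_cases l <;> simp [Fin.sum_univ_three]

/-- At time `0` the differential of `d` is the projection to the tangent plane and the radial term
completes its Gram matrix to the identity. So the integrand varies by half the trace of the
derivative of that matrix. The height contributes only to second order because it is initially
constant, and what is left is the divergence of the tangential variation field `∂ₛ d`. -/
theorem hasDerivAt_integral_sqrt_det_completedGram {h : ℝ × E3 → ℝ} {d : ℝ × E3 → E3}
    (hh : ∀ w : Sphere2, ContDiffAt ℝ 2 h (0, (w : E3)))
    (hd : ∀ w : Sphere2, ContDiffAt ℝ 2 d (0, (w : E3)))
    (hh0 : ∀ (w : Sphere2) (v : E3), fderiv ℝ h (0, (w : E3)) (0, v) = 0)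
    (hd0 : ∀ (w : Sphere2) (v : E3),
      fderiv ℝ d (0, (w : E3)) (0, v) = v - inner ℝ (w : E3) v • (w : E3))
    (htan : ∀ w : Sphere2, inner ℝ (w : E3) (fderiv ℝ d (0, (w : E3)) (1, 0)) = 0)
    (hrad : ∀ w : Sphere2, fderiv ℝ (fun x => fderiv ℝ d (0, x) (1, 0)) (w : E3) w = 0) :
    HasDerivAt (fun s => ∫ w : Sphere2, √(completedGram h d (s, (w : E3))).det ∂sphArea) 0 0 ∧
      ∀ᶠ s in 𝓝 (0 : ℝ), Continuous fun w : Sphere2 => √(completedGram h d (s, (w : E3))).det := by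
  have hone : ∀ w : Sphere2, completedGram h d (0, (w : E3)) = 1 := by
    intro w
    ext k l
    have hw : inner ℝ (w : E3) (w : E3) = 1 := by
      rw [real_inner_self_eq_norm_sq, mem_sphere_zero_iff_norm.1 w.2, one_pow]
    rw [completedGram, Matrix.of_apply, hh0, hh0, hd0, hd0, inner_sub_left, inner_sub_right,
      inner_sub_right, real_inner_smul_left, real_inner_smul_right, real_inner_smul_right,
      real_inner_smul_left, hw, inner_stdVec_stdVec, real_inner_comm (w : E3) (stdVec k),
      inner_stdVec (w : E3), inner_stdVec (w : E3)]
    ring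
  have hF : ∀ w : Sphere2, ContDiffAt ℝ 1 (fun z => √(completedGram h d z).det) (0, (w : E3)) :=
    fun w => (contDiffAt_det_completedGram (hh w) (hd w)).sqrt (by simp [hone])
  refine ⟨?_, ?_⟩
  · have hX : ∀ w : Sphere2, ContDiffAt ℝ 1 (fun x => fderiv ℝ d (0, x) (1, 0)) (w : E3) :=
      fun w => ContDiffAt.clm_apply (((hd w).fderiv_right (m := 1) (by norm_num)).comp (w : E3)
        (contDiffAt_const.prodMk contDiffAt_id)) contDiffAt_const
    have h1 := hasDerivAt_integral_sphere hF
    refine h1.congr_deriv (Eq.trans ?_ (integral_divergence_eq_zero hX htan hrad))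
    refine integral_congr_ae (Eventually.of_forall fun w => ?_)
    have hs : HasDerivAt (fun s : ℝ => (s, (w : E3))) (1, 0) 0 :=
      (hasDerivAt_id _).prodMk (hasDerivAt_const _ _)
    have hFw : HasDerivAt (fun s => √(completedGram h d (s, (w : E3))).det)
        (fderiv ℝ (fun z => √(completedGram h d z).det) (0, (w : E3)) (1, 0)) 0 := by
      have h2 := ((hF w).differentiableAt (by simp)).hasFDerivAt
      exact h2.comp_hasDerivAt (0 : ℝ) hs
    have hh2 : ∀ k, HasDerivAt (fun s => fderiv ℝ h (s, (w : E3)) (0, stdVec k))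
        (fderiv ℝ (fderiv ℝ h) (0, (w : E3)) (1, 0) (0, stdVec k)) 0 := fun k => by
      have h2 := ((((hh w).fderiv_right (m := 1) (by norm_num)).differentiableAt
        (by simp)).hasFDerivAt).comp_hasDerivAt (0 : ℝ) hs
      exact (h2.clm_apply (hasDerivAt_const (0 : ℝ) ((0 : ℝ), stdVec k))).congr_deriv (by simp)
    have hd2 : ∀ k, HasDerivAt (fun s => fderiv ℝ d (s, (w : E3)) (0, stdVec k))
        (fderiv ℝ (fderiv ℝ d) (0, (w : E3)) (1, 0) (0, stdVec k)) 0 := fun k => by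
      have h2 := ((((hd w).fderiv_right (m := 1) (by norm_num)).differentiableAt
        (by simp)).hasFDerivAt).comp_hasDerivAt (0 : ℝ) hs
      exact (h2.clm_apply (hasDerivAt_const (0 : ℝ) ((0 : ℝ), stdVec k))).congr_deriv (by simp)
    have h3 := hasDerivAt_sqrt_det (B := fun s => completedGram h d (s, (w : E3)))
      (B' := Matrix.of fun k l => _) (fun k l =>
      (((hh2 k).mul (hh2 l)).add ((hd2 k).inner ℝ (hd2 l))).add_const
        ((w : E3) k * (w : E3) l)) (hone w)
    dsimp only
    rw [← h3.unique hFw]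
    -- Symmetry of the second derivative exchanges the derivatives in time and space.
    have hXd : ∀ v : E3, fderiv ℝ (fun x => fderiv ℝ d (0, x) (1, 0)) (w : E3) v =
        fderiv ℝ (fderiv ℝ d) (0, (w : E3)) (1, 0) (0, v) := by
      intro v
      have h4 : HasFDerivAt (fun x : E3 => ((0 : ℝ), x)) (ContinuousLinearMap.inr ℝ ℝ E3) (w : E3) :=
        hasFDerivAt_prodMk_right _ _
      have h5 := ((((hd w).fderiv_right (m := 1) (by norm_num)).differentiableAt
        (by simp)).hasFDerivAt).comp (w : E3) h4
      have h6 := h5.clm_apply (hasFDerivAt_const ((1 : ℝ), (0 : E3)) (w : E3))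
      have h7 : HasFDerivAt (fun x => fderiv ℝ d (0, x) (1, 0)) _ (w : E3) := h6
      rw [h7.fderiv]
      have h8 := (hd w).isSymmSndFDerivAt (by simp) (0, v) (1, 0)
      simpa using h8
    have hr := hrad w
    simp only [hXd] at hr ⊢
    have e1 : ∀ k, inner ℝ (stdVec k - inner ℝ (w : E3) (stdVec k) • (w : E3))
        (fderiv ℝ (fderiv ℝ d) (0, (w : E3)) (1, 0) (0, stdVec k)) =
        fderiv ℝ (fderiv ℝ d) (0, (w : E3)) (1, 0) (0, stdVec k) k -
          inner ℝ (w : E3) (fderiv ℝ (fderiv ℝ d) (0, (w : E3)) (1, 0) (0, (w : E3) k • stdVec k)) := by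
      intro k
      have : ((0 : ℝ), (w : E3) k • stdVec k) = (w : E3) k • ((0 : ℝ), stdVec k) := by simp
      rw [this, map_smul, inner_sub_left, real_inner_smul_left, real_inner_smul_right, inner_stdVec,
        real_inner_comm, inner_stdVec]
    -- The correction terms of `e1` add up to the radial derivative of the variation field, which is
    -- zero.
    have e2 : ∑ k, inner ℝ (w : E3)
        (fderiv ℝ (fderiv ℝ d) (0, (w : E3)) (1, 0) (0, (w : E3) k • stdVec k)) = 0 := by
      rw [← inner_sum, ← map_sum]
      have : ∑ k, ((0 : ℝ), (w : E3) k • stdVec k) = (0, (w : E3)) := by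
        rw [Prod.ext_iff, Prod.fst_sum, Prod.snd_sum]
        exact ⟨by simp, sum_coord_smul_stdVec _⟩
      rw [this, hr, inner_zero_right]
    simp only [Matrix.trace, Matrix.diag, Matrix.of_apply, hh0, hd0, zero_mul, mul_zero,
      add_zero]
    rw [Finset.sum_div]
    have e3 : ∀ k, (inner ℝ (stdVec k - inner ℝ (w : E3) (stdVec k) • (w : E3))
        (fderiv ℝ (fderiv ℝ d) (0, (w : E3)) (1, 0) (0, stdVec k)) +
        inner ℝ (fderiv ℝ (fderiv ℝ d) (0, (w : E3)) (1, 0) (0, stdVec k))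
        (stdVec k - inner ℝ (w : E3) (stdVec k) • (w : E3))) / 2 =
        fderiv ℝ (fderiv ℝ d) (0, (w : E3)) (1, 0) (0, stdVec k) k -
          inner ℝ (w : E3) (fderiv ℝ (fderiv ℝ d) (0, (w : E3)) (1, 0) (0, (w : E3) k • stdVec k)) := by
      intro k
      rw [← e1, real_inner_comm]
      ring
    refine (Finset.sum_congr rfl fun k _ =>
      (congrArg (· / 2) (zero_add _)).trans (e3 k)).trans ?_
    rw [Finset.sum_sub_distrib, e2, sub_zero]
  · have h1 := eventually_forall_contDiffAt_sphere (n := 1) (by simpa using hF)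
    filter_upwards [h1] with s hs
    refine continuous_iff_continuousAt.2 fun w => ?_
    exact (hs w).continuousAt.comp (f := fun w : Sphere2 => (s, (w : E3)))
      (by fun_prop : Continuous fun w : Sphere2 => (s, (w : E3))).continuousAt

/-! ### Gram determinants of planes. -/

theorem exists_orthonormal_areaFactor_eq {T T' : Type*} [NormedAddCommGroup T]
    [InnerProductSpace ℝ T] [NormedAddCommGroup T'] [InnerProductSpace ℝ T'] (P : Submodule ℝ T)
    [FiniteDimensional ℝ P] (hP : Module.finrank ℝ P = 2) (L : T → T') :
    ∃ b : Fin 2 → T, Orthonormal ℝ b ∧ (∀ i, b i ∈ P) ∧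
      areaFactor P L = √(Matrix.of fun i j => inner ℝ (L (b i)) (L (b j))).det := by
  let b₀ := stdOrthonormalBasis ℝ P
  let e : Fin 2 ≃ Fin (Module.finrank ℝ P) := finCongr hP.symm
  refine ⟨fun i => b₀ (e i), ?_, fun i => (b₀ (e i)).2, ?_⟩
  · exact (b₀.orthonormal.comp_linearIsometry P.subtypeₗᵢ).comp e e.injective
  · rw [areaFactor, ← Matrix.det_submatrix_equiv_self e]
    rfl

/-- Completing a Gram matrix of a plane in `ℝ³` by a unit normal vector. -/
theorem det_gram_eq_det_completed (β : E3 →ₗ[ℝ] E3 →ₗ[ℝ] ℝ) {u : Fin 2 → E3} {w : E3}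
    (hu : Orthonormal ℝ u) (hw : ‖w‖ = 1) (huw : ∀ i, inner ℝ w (u i) = 0)
    (h1 : ∀ v, β w v = 0) (h2 : ∀ v, β v w = 0) :
    (Matrix.of fun i j => β (u i) (u j)).det =
      (Matrix.of fun k l => β (stdVec k) (stdVec l) + w k * w l).det := by
  -- The orthogonal matrix with these rows transforms the completed matrix into one with the Gram
  -- block of `u` and a `1` in the direction of `w`. The mixed entries vanish as `w` lies in both
  -- kernels of `β`.
  let r : Fin 3 → E3 := ![u 0, u 1, w]
  let M : Matrix (Fin 3) (Fin 3) ℝ := Matrix.of fun i k => r i k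
  have hu' := orthonormal_iff_ite.1 hu
  have hr : ∀ i j, inner ℝ (r i) (r j) = (1 : Matrix (Fin 3) (Fin 3) ℝ) i j := by
    intro i j
    fin_cases i <;> fin_cases j <;> simp [r, hu', hu.1, hw, huw, real_inner_comm w]
  have hMM : M * M.transpose = 1 := by
    ext i j
    rw [← hr i j, Matrix.mul_apply, PiLp.inner_apply]
    refine Finset.sum_congr rfl fun k _ => ?_
    simp [M, mul_comm]
  have hdet : M.det * M.det = 1 := by
    have := congrArg Matrix.det hMM
    rwa [Matrix.det_mul, Matrix.det_transpose, Matrix.det_one] at this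
  have hβ : ∀ x y : E3, ∑ l, (∑ k, x k * (β (stdVec k) (stdVec l) + w k * w l)) * y l =
      β x y + inner ℝ w x * inner ℝ w y := by
    intro x y
    have e1 : β x y = β (∑ k, x k • stdVec k) (∑ k, y k • stdVec k) := by
      rw [sum_coord_smul_stdVec, sum_coord_smul_stdVec]
    rw [e1, PiLp.inner_apply, PiLp.inner_apply]
    simp only [Fin.sum_univ_three, map_add, LinearMap.add_apply, map_smul, LinearMap.smul_apply,
      smul_eq_mul, RCLike.inner_apply, conj_trivial]
    ring
  have hB : M * (Matrix.of fun k l => β (stdVec k) (stdVec l) + w k * w l) * M.transpose =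
      Matrix.of fun i j => β (r i) (r j) + inner ℝ w (r i) * inner ℝ w (r j) := by
    ext i j
    rw [Matrix.mul_apply, Matrix.of_apply, ← hβ]
    refine Finset.sum_congr rfl fun l _ => ?_
    rw [Matrix.mul_apply]
    rfl
  have hB' := congrArg Matrix.det hB
  rw [Matrix.det_mul, Matrix.det_mul, Matrix.det_transpose, mul_right_comm, hdet, one_mul] at hB'
  rw [hB', Matrix.det_fin_two, Matrix.det_fin_three]
  simp [r, h1, h2, huw, hw]

/-! ### The radial projection to the sphere -/

open Classical in
/-- The radial projection onto the sphere. -/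
def sphProj (x : E3) : Sphere2 :=
  if h : x = 0 then ⟨stdVec 0, by simp⟩ else ⟨‖x‖⁻¹ • x, by simp [norm_smul, h]⟩

theorem coe_sphProj {x : E3} (h : x ≠ 0) : (sphProj x : E3) = ‖x‖⁻¹ • x := by
  rw [sphProj, dif_neg h]

theorem coe_sphere_ne_zero (w : Sphere2) : (w : E3) ≠ 0 := by
  rw [← norm_ne_zero_iff, mem_sphere_zero_iff_norm.1 w.2]
  exact one_ne_zero

theorem sphProj_coe (w : Sphere2) : sphProj w = w := Subtype.ext (by
  rw [coe_sphProj (coe_sphere_ne_zero w), mem_sphere_zero_iff_norm.1 w.2, inv_one, one_smul])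

theorem sphProj_smul {c : ℝ} (hc : 0 < c) {x : E3} (hx : x ≠ 0) : sphProj (c • x) = sphProj x :=
  Subtype.ext (by
    rw [coe_sphProj hx, coe_sphProj (smul_ne_zero hc.ne' hx), norm_smul, Real.norm_eq_abs,
      abs_of_pos hc, smul_smul, mul_inv_rev, mul_assoc, inv_mul_cancel₀ hc.ne', mul_one])

theorem contMDiffAt_sphProj {x : E3} (hx : x ≠ 0) :
    ContMDiffAt 𝓘(ℝ, E3) (𝓡 2) ∞ sphProj x := by
  -- `ContMDiff.codRestrict_sphere` concerns globally smooth maps, hence the passage to the open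
  -- submanifold of nonzero vectors.
  let U : TopologicalSpace.Opens E3 := ⟨{x | x ≠ 0}, isOpen_ne⟩
  refine (contMDiffAt_subtype_iff (U := U) (x := ⟨x, hx⟩)).1 ?_
  have h1 : ContMDiff 𝓘(ℝ, E3) 𝓘(ℝ, E3) ∞ fun y : U => (sphProj y : E3) := by
    intro y
    refine (contMDiffAt_subtype_iff (U := U) (f := fun y : E3 => (sphProj y : E3))).2 ?_
    have h2 : ContDiffAt ℝ ∞ (fun y : E3 => ‖y‖⁻¹ • y) y :=
      ((contDiffAt_norm ℝ y.2).inv (norm_ne_zero_iff.2 y.2)).smul contDiffAt_id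
    refine h2.contMDiffAt.congr_of_eventuallyEq ?_
    filter_upwards [isOpen_ne.mem_nhds y.2] with z hz
    exact coe_sphProj hz
  exact (ContMDiff.codRestrict_sphere h1 fun y => (sphProj y).2).contMDiffAt

theorem hasFDerivAt_coe_sphProj (w : Sphere2) :
    HasFDerivAt (fun x => (sphProj x : E3))
      (ContinuousLinearMap.id ℝ E3 - (innerSL ℝ (w : E3)).smulRight (w : E3)) (w : E3) := by
  have h0 := coe_sphere_ne_zero w
  have hn : ‖(w : E3)‖ = 1 := mem_sphere_zero_iff_norm.1 w.2
  have h1 : HasFDerivAt (fun x : E3 => ‖x‖) (innerSL ℝ (w : E3)) (w : E3) := by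
    have h2 := ((hasStrictFDerivAt_norm_sq (w : E3)).hasFDerivAt).sqrt (by simp [hn])
    have h3 : HasFDerivAt (fun x : E3 => ‖x‖) _ (w : E3) :=
      h2.congr_of_eventuallyEq (Eventually.of_forall fun x => by
        dsimp only
        rw [Real.sqrt_sq (norm_nonneg x)])
    refine h3.congr_fderiv ?_
    ext v
    simp [hn]
  have h4 : HasFDerivAt (fun x : E3 => ‖x‖⁻¹ • x) _ (w : E3) :=
    ((hasDerivAt_inv (norm_ne_zero_iff.2 h0)).comp_hasFDerivAt (w : E3) h1).smul
      (hasFDerivAt_id (w : E3))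
  have h5 : HasFDerivAt (fun x => (sphProj x : E3)) _ (w : E3) :=
    h4.congr_of_eventuallyEq (by
      filter_upwards [isOpen_ne.mem_nhds h0] with z hz
      exact coe_sphProj hz)
  refine h5.congr_fderiv ?_
  ext v : 1
  simp [hn, sub_eq_add_neg]

/-! ### Lifting a flow to the cylinder -/

open Classical in
/-- The point of the cylinder over `y` in the direction of `w`. -/
def sphLift (w : Sphere2) (y : QuotCyl) : Cylinder :=
  if h : ∃ p : Cylinder, proj p = y ∧ 0 < inner ℝ (p.2 : E3) (w : E3) then h.choose
  else (originInterval, w)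

theorem sphLift_proj {w : Sphere2} {p : Cylinder} (h : 0 < inner ℝ (p.2 : E3) (w : E3)) :
    sphLift w (proj p) = p := by
  have h1 : ∃ q : Cylinder, proj q = proj p ∧ 0 < inner ℝ (q.2 : E3) (w : E3) := ⟨p, rfl, h⟩
  rw [sphLift, dif_pos h1]
  obtain ⟨h2, h3⟩ := h1.choose_spec
  rcases proj_eq_iff.1 h2.symm with h4 | ⟨-, h4⟩
  · exact h4
  · rw [h4] at h3
    change 0 < inner ℝ (-(p.2 : E3)) (w : E3) at h3
    rw [inner_neg_left] at h3
    linarith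

section Flow

variable {ψ : ℝ → QuotCyl → QuotCyl} (t : OpenInterval)

variable (ψ) in
/-- The deformation of a slice, extended radially to `ℝ³`. -/
def radialFlow (z : ℝ × E3) : QuotCyl := ψ z.1 (sliceMap t (sphProj z.2))

variable (ψ) in
/-- The lift of the deformation of a slice to the cylinder. -/
def liftedFlow (z : ℝ × E3) : Cylinder := sphLift (sphProj z.2) (radialFlow ψ t z)

theorem radialFlow_smul (s : ℝ) {c : ℝ} (hc : 0 < c) (w : Sphere2) :
    radialFlow ψ t (s, c • (w : E3)) = radialFlow ψ t (s, w) := by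
  rw [radialFlow, radialFlow, sphProj_smul hc (coe_sphere_ne_zero w)]

theorem liftedFlow_smul (s : ℝ) {c : ℝ} (hc : 0 < c) (w : Sphere2) :
    liftedFlow ψ t (s, c • (w : E3)) = liftedFlow ψ t (s, w) := by
  rw [liftedFlow, liftedFlow, sphProj_smul hc (coe_sphere_ne_zero w), radialFlow_smul t s hc]

theorem contMDiffAt_radialFlow
    (hψ : ContMDiff (𝓘(ℝ, ℝ).prod cylModel) cylModel ∞ fun q : ℝ × QuotCyl => ψ q.1 q.2)
    {z : ℝ × E3} (hz : z.2 ≠ 0) :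
    ContMDiffAt 𝓘(ℝ, ℝ × E3) cylModel ∞ (radialFlow ψ t) z := by
  have h1 : ContMDiffAt 𝓘(ℝ, ℝ × E3) 𝓘(ℝ, ℝ) ∞ (Prod.fst : ℝ × E3 → ℝ) z :=
    contDiff_fst.contMDiff.contMDiffAt
  have h2 : ContMDiffAt 𝓘(ℝ, ℝ × E3) 𝓘(ℝ, E3) ∞ (Prod.snd : ℝ × E3 → E3) z :=
    contDiff_snd.contMDiff.contMDiffAt
  have h3 : ContMDiffAt 𝓘(ℝ, ℝ × E3) cylModel ∞
      (fun z : ℝ × E3 => sliceMap t (sphProj z.2)) z :=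
    ((contMDiff_sliceMap t).contMDiffAt).comp z ((contMDiffAt_sphProj hz).comp z h2)
  exact hψ.contMDiffAt.comp z (h1.prodMk h3)

end Flow

section Flow

variable {ψ : ℝ → QuotCyl → QuotCyl} (t : OpenInterval)

theorem radialFlow_zero (h0 : ∀ x, ψ 0 x = x) (x : E3) :
    radialFlow ψ t (0, x) = proj (t, sphProj x) := h0 _

theorem liftedFlow_zero (h0 : ∀ x, ψ 0 x = x) (x : E3) :
    liftedFlow ψ t (0, x) = (t, sphProj x) := by
  rw [liftedFlow, radialFlow_zero t h0]
  refine sphLift_proj ?_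
  change 0 < inner ℝ (sphProj x : E3) (sphProj x : E3)
  rw [real_inner_self_eq_norm_sq, mem_sphere_zero_iff_norm.1 (sphProj x).2]
  norm_num

/-- Near time `0` the lift by the fixed inverse branch has a direction close to the initial one, so
it is the lift selected by `sphLift`. This makes `liftedFlow`, defined by a choice, a smooth map
there. -/
theorem eventually_liftedFlow
    (hψ : ContMDiff (𝓘(ℝ, ℝ).prod cylModel) cylModel ∞ fun q : ℝ × QuotCyl => ψ q.1 q.2)
    (h0 : ∀ x, ψ 0 x = x) (w : Sphere2) :
    ∀ᶠ z in 𝓝 ((0 : ℝ), (w : E3)), radialFlow ψ t z ∈ (cylInverse (t, w)).source ∧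
      liftedFlow ψ t z = cylInverse (t, w) (radialFlow ψ t z) := by
  have hm := contMDiffAt_radialFlow t hψ (z := ((0 : ℝ), (w : E3))) (coe_sphere_ne_zero w)
  have hm0 : radialFlow ψ t (0, (w : E3)) = proj (t, w) := by
    rw [radialFlow_zero t h0, sphProj_coe]
  have hsrc : radialFlow ψ t (0, (w : E3)) ∈ (cylInverse (t, w)).source := by
    rw [hm0]; exact proj_mem_cylInverse_source (mem_cylInverse_target _)
  have hc1 : ContinuousAt (fun z => cylInverse (t, w) (radialFlow ψ t z)) ((0 : ℝ), (w : E3)) :=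
    ContinuousAt.comp ((contMDiffAt_cylInverse hsrc).continuousAt) hm.continuousAt
  have hc2 : ContinuousAt (fun z : ℝ × E3 => sphProj z.2) ((0 : ℝ), (w : E3)) :=
    ContinuousAt.comp (f := Prod.snd) (x := ((0 : ℝ), (w : E3)))
      (contMDiffAt_sphProj (coe_sphere_ne_zero w)).continuousAt continuousAt_snd
  have hc3 : ContinuousAt (fun z : ℝ × E3 =>
      inner ℝ ((cylInverse (t, w) (radialFlow ψ t z)).2 : E3) (sphProj z.2 : E3))
      ((0 : ℝ), (w : E3)) :=
    (continuous_subtype_val.continuousAt.comp (continuous_snd.continuousAt.comp hc1)).inner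
      (continuous_subtype_val.continuousAt.comp hc2)
  have hpos : 0 < inner ℝ ((cylInverse (t, w) (radialFlow ψ t (0, (w : E3)))).2 : E3)
      (sphProj (w : E3) : E3) := by
    rw [hm0, cylInverse_proj (mem_cylInverse_target _), sphProj_coe]
    dsimp only
    rw [real_inner_self_eq_norm_sq, mem_sphere_zero_iff_norm.1 w.2]
    norm_num
  filter_upwards [hm.continuousAt ((cylInverse (t, w)).open_source.mem_nhds hsrc),
    hc3 (isOpen_Ioi.mem_nhds hpos)] with z hz1 hz2
  refine ⟨hz1, ?_⟩
  have h1 : proj (cylInverse (t, w) (radialFlow ψ t z)) = radialFlow ψ t z :=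
    (cylInverse_eventually_section hz1).self_of_nhds
  have h2 : sphLift (sphProj z.2) (proj (cylInverse (t, w) (radialFlow ψ t z))) =
    cylInverse (t, w) (radialFlow ψ t z) := sphLift_proj hz2
  rwa [h1] at h2

theorem contMDiffAt_liftedFlow
    (hψ : ContMDiff (𝓘(ℝ, ℝ).prod cylModel) cylModel ∞ fun q : ℝ × QuotCyl => ψ q.1 q.2)
    {p₀ : Cylinder} {z : ℝ × E3} (hz0 : z.2 ≠ 0)
    (hz : ∀ᶠ z in 𝓝 z, radialFlow ψ t z ∈ (cylInverse p₀).source ∧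
      liftedFlow ψ t z = cylInverse p₀ (radialFlow ψ t z)) :
    ContMDiffAt 𝓘(ℝ, ℝ × E3) cylModel ∞ (liftedFlow ψ t) z :=
  ((contMDiffAt_cylInverse hz.self_of_nhds.1).comp z
    (contMDiffAt_radialFlow t hψ hz0)).congr_of_eventuallyEq (hz.mono fun _ h => h.2)

/-- Both sides are the differential on the sphere of the same function, factored once through `N`
and once through `ℝ³`. It turns the Jacobian of the flow into ordinary partial derivatives. -/
theorem mvfderiv_comp_cylInverse_flow
    (hψ : ContMDiff (𝓘(ℝ, ℝ).prod cylModel) cylModel ∞ fun q : ℝ × QuotCyl => ψ q.1 q.2)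
    {p₀ : Cylinder} {s : ℝ} {w : Sphere2}
    (hz : ∀ᶠ z in 𝓝 (s, (w : E3)), radialFlow ψ t z ∈ (cylInverse p₀).source ∧
      liftedFlow ψ t z = cylInverse p₀ (radialFlow ψ t z))
    {F : Type} [NormedAddCommGroup F] [NormedSpace ℝ F] {f : Cylinder → F}
    (hf : ContMDiff cylModel 𝓘(ℝ, F) ∞ f) (u : TangentSpace (𝓡 2) w) :
    mvfderiv cylModel (f ∘ cylInverse p₀) (ψ s (sliceMap t w))
      (mfderiv cylModel cylModel (ψ s) (sliceMap t w) (mfderiv (𝓡 2) cylModel (sliceMap t) w u)) =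
    fderiv ℝ (f ∘ liftedFlow ψ t) (s, (w : E3))
      (0, mfderiv (𝓡 2) 𝓘(ℝ, E3) (Subtype.val : Sphere2 → E3) w u) := by
  have hy : ψ s (sliceMap t w) ∈ (cylInverse p₀).source := by
    have := hz.self_of_nhds.1
    rwa [radialFlow, sphProj_coe] at this
  have h1 : HasMFDerivAt cylModel 𝓘(ℝ, F) (f ∘ cylInverse p₀) (ψ s (sliceMap t w))
      (mvfderiv cylModel (f ∘ cylInverse p₀) (ψ s (sliceMap t w))) :=
    ((hf.contMDiffAt.comp _ (contMDiffAt_cylInverse hy)).mdifferentiableAt (by simp)).hasMFDerivAt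
  have hψs : ContMDiff cylModel cylModel ∞ (ψ s) :=
    hψ.comp (contMDiff_const.prodMk contMDiff_id)
  have h2 : HasMFDerivAt cylModel cylModel (ψ s) (sliceMap t w)
      (mfderiv cylModel cylModel (ψ s) (sliceMap t w)) :=
    (hψs.mdifferentiableAt (by simp)).hasMFDerivAt
  have h3 : HasMFDerivAt (𝓡 2) cylModel (sliceMap t) w (mfderiv (𝓡 2) cylModel (sliceMap t) w) :=
    ((contMDiff_sliceMap t).mdifferentiableAt (by simp)).hasMFDerivAt
  have h4 := h1.comp w (h2.comp w h3)
  have h5 : HasMFDerivAt 𝓘(ℝ, ℝ × E3) 𝓘(ℝ, F) (f ∘ liftedFlow ψ t) (s, (w : E3))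
      (fderiv ℝ (f ∘ liftedFlow ψ t) (s, (w : E3))) := by
    have := hf.contMDiffAt.comp _ (contMDiffAt_liftedFlow t hψ (coe_sphere_ne_zero w) hz)
    exact ((contMDiffAt_iff_contDiffAt.1 this).differentiableAt (by simp)).hasFDerivAt.hasMFDerivAt
  have h6 : HasMFDerivAt 𝓘(ℝ, E3) 𝓘(ℝ, ℝ × E3) (fun x : E3 => (s, x)) (w : E3)
      (ContinuousLinearMap.inr ℝ ℝ E3) := (hasFDerivAt_prodMk_right s (w : E3)).hasMFDerivAt
  have h7 : HasMFDerivAt (𝓡 2) 𝓘(ℝ, E3) (Subtype.val : Sphere2 → E3) w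
      (mfderiv (𝓡 2) 𝓘(ℝ, E3) (Subtype.val : Sphere2 → E3) w) :=
    ((contMDiff_coe_sphere (m := ∞)).mdifferentiableAt (by simp)).hasMFDerivAt
  have h8 := h5.comp w (h6.comp w h7)
  have hev : (f ∘ cylInverse p₀) ∘ ψ s ∘ sliceMap t =ᶠ[𝓝 w]
      (f ∘ liftedFlow ψ t) ∘ (fun x : E3 => (s, x)) ∘ (Subtype.val : Sphere2 → E3) := by
    have hc : Continuous fun w : Sphere2 => (s, (w : E3)) := by fun_prop
    filter_upwards [(hc.tendsto w).eventually hz] with v hv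
    have := hv.2
    simp only [Function.comp]
    rw [this, radialFlow, sphProj_coe]
  have h9 := hasMFDerivAt_unique (h4.congr_of_eventuallyEq hev.symm) h8
  exact DFunLike.congr_fun h9 u

/-- The lifted flow is constant along rays from the origin. -/
theorem fderiv_liftedFlow_radial
    (hψ : ContMDiff (𝓘(ℝ, ℝ).prod cylModel) cylModel ∞ fun q : ℝ × QuotCyl => ψ q.1 q.2)
    {p₀ : Cylinder} {s : ℝ} {w : Sphere2}
    (hz : ∀ᶠ z in 𝓝 (s, (w : E3)), radialFlow ψ t z ∈ (cylInverse p₀).source ∧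
      liftedFlow ψ t z = cylInverse p₀ (radialFlow ψ t z))
    {F : Type} [NormedAddCommGroup F] [NormedSpace ℝ F] {f : Cylinder → F}
    (hf : ContMDiff cylModel 𝓘(ℝ, F) ∞ f) :
    fderiv ℝ (f ∘ liftedFlow ψ t) (s, (w : E3)) (0, (w : E3)) = 0 := by
  have h5 : HasFDerivAt (f ∘ liftedFlow ψ t)
      (fderiv ℝ (f ∘ liftedFlow ψ t) (s, (w : E3))) (s, (1 : ℝ) • (w : E3)) := by
    have := hf.contMDiffAt.comp _ (contMDiffAt_liftedFlow t hψ (coe_sphere_ne_zero w) hz)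
    rw [one_smul]
    exact ((contMDiffAt_iff_contDiffAt.1 this).differentiableAt (by simp)).hasFDerivAt
  have h6 : HasDerivAt (fun c : ℝ => (s, c • (w : E3))) (0, (w : E3)) 1 :=
    (hasDerivAt_const _ _).prodMk (by simpa using (hasDerivAt_id (1 : ℝ)).smul_const (w : E3))
  have h7 := h5.comp_hasDerivAt (1 : ℝ) h6
  refine h7.unique ((hasDerivAt_const (1 : ℝ) (f (liftedFlow ψ t (s, w)))).congr_of_eventuallyEq ?_)
  filter_upwards [isOpen_Ioi.mem_nhds (zero_lt_one (α := ℝ))] with c hc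
  simp only [Function.comp]
  rw [liftedFlow_smul t s hc]

end Flow

theorem inner_quotCyl_eq {p₀ : Cylinder} {y : QuotCyl} (hy : y ∈ (cylInverse p₀).source)
    (a b : TangentSpace cylModel y) :
    inner ℝ a b = mvfderiv cylModel (height ∘ cylInverse p₀) y a *
        mvfderiv cylModel (height ∘ cylInverse p₀) y b +
      inner ℝ (mvfderiv cylModel (direction ∘ cylInverse p₀) y a)
        (mvfderiv cylModel (direction ∘ cylInverse p₀) y b) := by
  rw [inner_tangentSpace_quotCyl, quotMetric_eq_of_section y (cylInverse p₀)
    (contMDiffAt_cylInverse hy) (cylInverse_eventually_section hy), mul_comm]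
  rfl

/-- Along a slice the height is constant and the direction is the inclusion of the sphere, so slices
are isometric immersions. -/
theorem inner_mfderiv_sliceMap (t : OpenInterval) (w : Sphere2) (u v : TangentSpace (𝓡 2) w) :
    inner ℝ (mfderiv (𝓡 2) cylModel (sliceMap t) w u) (mfderiv (𝓡 2) cylModel (sliceMap t) w v) =
      inner ℝ (mfderiv (𝓡 2) 𝓘(ℝ, E3) (Subtype.val : Sphere2 → E3) w u : E3)
        (mfderiv (𝓡 2) 𝓘(ℝ, E3) (Subtype.val : Sphere2 → E3) w v : E3) := by
  have hy : sliceMap t w ∈ (cylInverse (t, w)).source :=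
    proj_mem_cylInverse_source (mem_cylInverse_target _)
  have hsl : HasMFDerivAt (𝓡 2) cylModel (sliceMap t) w (mfderiv (𝓡 2) cylModel (sliceMap t) w) :=
    ((contMDiff_sliceMap t).mdifferentiableAt (by simp)).hasMFDerivAt
  have hev : ∀ᶠ v in 𝓝 w, cylInverse (t, w) (sliceMap t v) = (t, v) := by
    have hc : Continuous fun v : Sphere2 => (t, v) := by fun_prop
    filter_upwards [hc.continuousAt ((cylInverse (t, w)).open_target.mem_nhds
      (mem_cylInverse_target (t, w)))] with v hv
    exact cylInverse_proj hv
  have e1 : ∀ u, mvfderiv cylModel (height ∘ cylInverse (t, w)) (sliceMap t w)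
      (mfderiv (𝓡 2) cylModel (sliceMap t) w u) = 0 := by
    intro u
    have h1 := (((contMDiff_height.contMDiffAt.comp _ (contMDiffAt_cylInverse hy)).mdifferentiableAt
      (by simp)).hasMFDerivAt).comp w hsl
    have h2 : HasMFDerivAt (𝓡 2) 𝓘(ℝ, ℝ) ((height ∘ cylInverse (t, w)) ∘ sliceMap t) w
        (0 : TangentSpace (𝓡 2) w →L[ℝ] ℝ) :=
      (hasMFDerivAt_const (t : ℝ) w).congr_of_eventuallyEq (by
        filter_upwards [hev] with v hv
        simp only [Function.comp, hv]
        rfl)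
    exact DFunLike.congr_fun (hasMFDerivAt_unique h1 h2) u
  have e2 : ∀ u, mvfderiv cylModel (direction ∘ cylInverse (t, w)) (sliceMap t w)
      (mfderiv (𝓡 2) cylModel (sliceMap t) w u) =
      mfderiv (𝓡 2) 𝓘(ℝ, E3) (Subtype.val : Sphere2 → E3) w u := by
    intro u
    have h1 := (((contMDiff_direction.contMDiffAt.comp _
      (contMDiffAt_cylInverse hy)).mdifferentiableAt (by simp)).hasMFDerivAt).comp w hsl
    have h2 : HasMFDerivAt (𝓡 2) 𝓘(ℝ, E3) ((direction ∘ cylInverse (t, w)) ∘ sliceMap t) w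
        (mfderiv (𝓡 2) 𝓘(ℝ, E3) (Subtype.val : Sphere2 → E3) w) :=
      (((contMDiff_coe_sphere (m := ∞)).mdifferentiableAt
        (by simp)).hasMFDerivAt).congr_of_eventuallyEq (by
        filter_upwards [hev] with v hv
        simp only [Function.comp, hv]
        rfl)
    exact DFunLike.congr_fun (hasMFDerivAt_unique h1 h2) u
  rw [inner_quotCyl_eq hy, e1, e2, e2, zero_mul, zero_add]
  rfl

theorem inner_coe_mfderiv_coe_sphere (w : Sphere2) (u : TangentSpace (𝓡 2) w) :
    inner ℝ (w : E3) (mfderiv (𝓡 2) 𝓘(ℝ, E3) (Subtype.val : Sphere2 → E3) w u : E3) = 0 := by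
  have h7 : HasMFDerivAt (𝓡 2) 𝓘(ℝ, E3) (Subtype.val : Sphere2 → E3) w
      (mfderiv (𝓡 2) 𝓘(ℝ, E3) (Subtype.val : Sphere2 → E3) w) :=
    ((contMDiff_coe_sphere (m := ∞)).mdifferentiableAt (by simp)).hasMFDerivAt
  have h8 := (hasStrictFDerivAt_norm_sq (w : E3)).hasFDerivAt.hasMFDerivAt.comp w h7
  have h9 : HasMFDerivAt (𝓡 2) 𝓘(ℝ, ℝ) ((fun x : E3 => ‖x‖ ^ 2) ∘ (Subtype.val : Sphere2 → E3)) w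
      (0 : TangentSpace (𝓡 2) w →L[ℝ] ℝ) :=
    (hasMFDerivAt_const (1 : ℝ) w).congr_of_eventuallyEq (Eventually.of_forall fun v => by
      simp only [Function.comp]
      rw [mem_sphere_zero_iff_norm.1 v.2, one_pow])
  have h10 := DFunLike.congr_fun (hasMFDerivAt_unique h8 h9) u
  have h11 : (2 : ℕ) • inner ℝ (w : E3)
    (mfderiv (𝓡 2) 𝓘(ℝ, E3) (Subtype.val : Sphere2 → E3) w u : E3) = 0 := h10
  simpa using h11

/-! ### The slices are stationary -/

/-- An orthonormal basis of the tangent plane comes from an orthonormal tangent basis of the sphere,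
and the Gram matrix of its image under the flow is that of the form `β`. The radial direction lies
in the kernel of `β`, so `det_gram_eq_det_completed` replaces the basis by the standard one of `ℝ³`.
-/
theorem planeJacobian_slicePlane {ψ : ℝ → QuotCyl → QuotCyl} (t : OpenInterval)
    (hψ : ContMDiff (𝓘(ℝ, ℝ).prod cylModel) cylModel ∞ fun q : ℝ × QuotCyl => ψ q.1 q.2)
    {p₀ : Cylinder} {s : ℝ} {w : Sphere2}
    (hz : ∀ᶠ z in 𝓝 (s, (w : E3)), radialFlow ψ t z ∈ (cylInverse p₀).source ∧
      liftedFlow ψ t z = cylInverse p₀ (radialFlow ψ t z)) :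
    planeJacobian (ψ s) (slicePlane t w) =
      √(completedGram (height ∘ liftedFlow ψ t) (direction ∘ liftedFlow ψ t) (s, (w : E3))).det := by
  have hy : ψ s (sliceMap t w) ∈ (cylInverse p₀).source := by
    have := hz.self_of_nhds.1
    rwa [radialFlow, sphProj_coe] at this
  have : FiniteDimensional ℝ (TangentSpace cylModel (slicePlane t w).base) :=
    inferInstanceAs (FiniteDimensional ℝ (ℝ × EuclideanSpace ℝ (Fin 2)))
  let a : E3 →L[ℝ] ℝ := (fderiv ℝ (height ∘ liftedFlow ψ t) (s, (w : E3))).comp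
    (ContinuousLinearMap.inr ℝ ℝ E3)
  let b : E3 →L[ℝ] E3 := (fderiv ℝ (direction ∘ liftedFlow ψ t) (s, (w : E3))).comp
    (ContinuousLinearMap.inr ℝ ℝ E3)
  let β : E3 →ₗ[ℝ] E3 →ₗ[ℝ] ℝ := LinearMap.mk₂ ℝ (fun x y => a x * a y + inner ℝ (b x) (b y))
    (fun x x' y => by rw [map_add, map_add, inner_add_left]; ring)
    (fun c x y => by
      rw [map_smul, map_smul, real_inner_smul_left, smul_eq_mul, smul_eq_mul]; ring)
    (fun x y y' => by rw [map_add, map_add, inner_add_right]; ring)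
    (fun c x y => by
      rw [map_smul, map_smul, real_inner_smul_right, smul_eq_mul, smul_eq_mul]; ring)
  have ha : a (w : E3) = 0 := fderiv_liftedFlow_radial t hψ hz contMDiff_height
  have hb : b (w : E3) = 0 := fderiv_liftedFlow_radial t hψ hz contMDiff_direction
  obtain ⟨e, he, heP, hJ⟩ := exists_orthonormal_areaFactor_eq (slicePlane t w).plane
    (slicePlane t w).finrank_plane (mfderiv cylModel cylModel (ψ s) (slicePlane t w).base)
  have hJ' : planeJacobian (ψ s) (slicePlane t w) = _ := hJ
  choose v hv using heP
  let D : TangentSpace (𝓡 2) w →L[ℝ] E3 := mfderiv (𝓡 2) 𝓘(ℝ, E3) (Subtype.val : Sphere2 → E3) w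
  have hev : ∀ i, e i = mfderiv (𝓡 2) cylModel (sliceMap t) w (v i) := fun i => (hv i).symm
  have hu : Orthonormal ℝ fun i => D (v i) := by
    rw [orthonormal_iff_ite]
    intro i j
    rw [← orthonormal_iff_ite.1 he i j, hev, hev]
    exact (inner_mfderiv_sliceMap t w (v i) (v j)).symm
  have hG : ∀ i j, inner ℝ
      (mfderiv cylModel cylModel (ψ s) (slicePlane t w).base (e i))
      (mfderiv cylModel cylModel (ψ s) (slicePlane t w).base (e j)) = β (D (v i)) (D (v j)) := by
    intro i j
    have h1 := fun i => mvfderiv_comp_cylInverse_flow t hψ hz contMDiff_height (v i)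
    have h2 := fun i => mvfderiv_comp_cylInverse_flow t hψ hz contMDiff_direction (v i)
    rw [hev, hev]
    refine (inner_quotCyl_eq hy _ _).trans ?_
    erw [h1 i, h1 j, h2 i, h2 j]
    rfl
  rw [hJ']
  refine congrArg Real.sqrt (Eq.trans ?_ (det_gram_eq_det_completed β hu
    (mem_sphere_zero_iff_norm.1 w.2) (fun i => inner_coe_mfderiv_coe_sphere w (v i)) ?_ ?_))
  · refine congrArg Matrix.det ?_
    ext i j
    exact hG i j
  · intro x
    change a (w : E3) * a x + inner ℝ (b (w : E3)) (b x) = 0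
    rw [ha, hb, zero_mul, inner_zero_left, add_zero]
  · intro x
    change a x * a (w : E3) + inner ℝ (b x) (b (w : E3)) = 0
    rw [ha, hb, mul_zero, inner_zero_right, add_zero]

/-- For small times the mass is the integral treated in
`hasDerivAt_integral_sqrt_det_completedGram`, applied to the height and the direction of the lifted
flow. The facts `g1` to `g4` are its hypotheses. -/
theorem isStationary_slicePlane (t : OpenInterval) :
    IsStationary (sphArea.map (slicePlane t)) := by
  intro χ _ _ ψ hflow
  have hψ := hflow.contMDiff
  have h0 := hflow.map_zero
  have hloc := fun w => eventually_liftedFlow t hψ h0 w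
  have hsm : ∀ {F : Type} [NormedAddCommGroup F] [NormedSpace ℝ F] {f : Cylinder → F},
      ContMDiff cylModel 𝓘(ℝ, F) ∞ f → ∀ w : Sphere2,
      ContDiffAt ℝ 2 (f ∘ liftedFlow ψ t) ((0 : ℝ), (w : E3)) := by
    intro F _ _ f hf w
    have := hf.contMDiffAt.comp _ (contMDiffAt_liftedFlow t hψ
      (z := ((0 : ℝ), (w : E3))) (coe_sphere_ne_zero w) (hloc w))
    exact (contMDiffAt_iff_contDiffAt.1 this).of_le (WithTop.coe_le_coe.2 (le_top (a := (2 : ℕ∞))))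
  have hH := hsm contMDiff_height
  have hD := hsm contMDiff_direction
  have hinr : ∀ w : Sphere2, HasFDerivAt (fun x : E3 => ((0 : ℝ), x))
      (ContinuousLinearMap.inr ℝ ℝ E3) (w : E3) := fun w => hasFDerivAt_prodMk_right _ _
  have hinl : ∀ x : E3, HasDerivAt (fun s : ℝ => (s, x)) (1, 0) 0 := fun x =>
    (hasDerivAt_id _).prodMk (hasDerivAt_const _ _)
  have hnorm : ∀ p : Cylinder, ‖direction p‖ = 1 := fun p => mem_sphere_zero_iff_norm.1 p.2.2
  have hder : ∀ {x : E3}, DifferentiableAt ℝ (direction ∘ liftedFlow ψ t) ((0 : ℝ), x) →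
      HasDerivAt (fun s => direction (liftedFlow ψ t (s, x)))
        (fderiv ℝ (direction ∘ liftedFlow ψ t) ((0 : ℝ), x) (1, 0)) 0 := fun {x} h =>
    HasFDerivAt.comp_hasDerivAt (0 : ℝ) (f := fun s : ℝ => (s, x))
      (l := direction ∘ liftedFlow ψ t) h.hasFDerivAt (hinl x)
  have hdiffD : ∀ w : Sphere2, DifferentiableAt ℝ (direction ∘ liftedFlow ψ t) ((0 : ℝ), (w : E3)) :=
    fun w => (hD w).differentiableAt (by simp)
  have g1 : ∀ (w : Sphere2) (v : E3),
      fderiv ℝ (height ∘ liftedFlow ψ t) ((0 : ℝ), (w : E3)) (0, v) = 0 := by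
    intro w v
    have h1 := ((hH w).differentiableAt (by simp)).hasFDerivAt.comp (w : E3) (hinr w)
    have h2 : HasFDerivAt ((height ∘ liftedFlow ψ t) ∘ fun x : E3 => ((0 : ℝ), x))
        (0 : E3 →L[ℝ] ℝ) (w : E3) :=
      (hasFDerivAt_const (t : ℝ) (w : E3)).congr_of_eventuallyEq (Eventually.of_forall fun x => by
        simp only [Function.comp, liftedFlow_zero t h0]
        rfl)
    exact DFunLike.congr_fun (h1.unique h2) v
  have g2 : ∀ (w : Sphere2) (v : E3),
      fderiv ℝ (direction ∘ liftedFlow ψ t) ((0 : ℝ), (w : E3)) (0, v) =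
        v - inner ℝ (w : E3) v • (w : E3) := by
    intro w v
    have h1 := (hdiffD w).hasFDerivAt.comp (w : E3) (hinr w)
    have h2 := (hasFDerivAt_coe_sphProj w).congr_of_eventuallyEq
      (f₁ := (direction ∘ liftedFlow ψ t) ∘ fun x : E3 => ((0 : ℝ), x))
      (Eventually.of_forall fun x => by
        simp only [Function.comp, liftedFlow_zero t h0]
        rfl)
    exact DFunLike.congr_fun (h1.unique h2) v
  -- The direction has norm one at all times, so its velocity is tangential.
  have g3 : ∀ w : Sphere2, inner ℝ (w : E3)
      (fderiv ℝ (direction ∘ liftedFlow ψ t) ((0 : ℝ), (w : E3)) (1, 0)) = 0 := by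
    intro w
    have h1 := (hder (hdiffD w)).norm_sq
    have h2 : HasDerivAt (fun s => ‖direction (liftedFlow ψ t (s, (w : E3)))‖ ^ 2) 0 0 :=
      (hasDerivAt_const (0 : ℝ) (1 : ℝ)).congr_of_eventuallyEq (Eventually.of_forall fun s => by
        dsimp only
        rw [hnorm, one_pow])
    have h3 := h1.unique h2
    rw [liftedFlow_zero t h0, sphProj_coe] at h3
    have h4 : 2 * inner ℝ (w : E3)
      (fderiv ℝ (direction ∘ liftedFlow ψ t) ((0 : ℝ), (w : E3)) (1, 0)) = 0 := h3
    linarith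
  -- The variation field inherits the invariance under scaling of the lifted flow.
  have g4 : ∀ w : Sphere2, fderiv ℝ
      (fun x => fderiv ℝ (direction ∘ liftedFlow ψ t) ((0 : ℝ), x) (1, 0)) (w : E3) w = 0 := by
    intro w
    have hX : ContDiffAt ℝ 1 (fun x => fderiv ℝ (direction ∘ liftedFlow ψ t) (0, x) (1, 0))
        ((1 : ℝ) • (w : E3)) := by
      rw [one_smul]
      exact ContDiffAt.clm_apply (((hD w).fderiv_right (m := 1) (by norm_num)).comp (w : E3)
        (contDiffAt_const.prodMk contDiffAt_id)) contDiffAt_const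
    have h1 : HasDerivAt (fun c : ℝ => c • (w : E3)) (w : E3) 1 := by
      simpa using (hasDerivAt_id (1 : ℝ)).smul_const (w : E3)
    have h2 := (hX.differentiableAt (by simp)).hasFDerivAt.comp_hasDerivAt (1 : ℝ) h1
    rw [one_smul] at h2
    refine h2.unique ((hasDerivAt_const (1 : ℝ) (fderiv ℝ (direction ∘ liftedFlow ψ t)
      (0, (w : E3)) (1, 0))).congr_of_eventuallyEq ?_)
    have hc : ContinuousAt (fun c : ℝ => ((0 : ℝ), c • (w : E3))) 1 := by fun_prop
    have hev : ∀ᶠ z in 𝓝 ((0 : ℝ), (1 : ℝ) • (w : E3)),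
        ContDiffAt ℝ 2 (direction ∘ liftedFlow ψ t) z := by
      rw [one_smul]
      exact (hD w).eventually (by simp)
    filter_upwards [isOpen_Ioi.mem_nhds (zero_lt_one (α := ℝ)), hc.eventually hev] with c hc0 hc2
    have h3 := hder (hc2.differentiableAt (by simp))
    have h4 : (fun s => direction (liftedFlow ψ t (s, c • (w : E3)))) =
        fun s => direction (liftedFlow ψ t (s, (w : E3))) := funext fun s => by
      rw [liftedFlow_smul t s hc0]
    rw [h4] at h3
    exact h3.unique (hder (hdiffD w))
  obtain ⟨hmain, hcont⟩ := hasDerivAt_integral_sqrt_det_completedGram hH hD g1 g2 g3 g4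
  refine hmain.congr_of_eventuallyEq ?_
  -- The pointwise formula holds on a neighbourhood of each point of `{0} × S²`. Compactness gives
  -- one time interval for the whole sphere.
  have hJ : ∀ᶠ s in 𝓝 (0 : ℝ), ∀ w ∈ (univ : Set Sphere2),
      planeJacobian (ψ s) (slicePlane t w) =
      √(completedGram (height ∘ liftedFlow ψ t) (direction ∘ liftedFlow ψ t)
        (s, (w : E3))).det := by
    refine isCompact_univ.eventually_forall_of_forall_eventually (P := fun s w =>
      planeJacobian (ψ s) (slicePlane t w) =
      √(completedGram (height ∘ liftedFlow ψ t) (direction ∘ liftedFlow ψ t)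
        (s, (w : E3))).det) fun w _ => ?_
    have hc : Continuous fun z : ℝ × Sphere2 => (z.1, (z.2 : E3)) := by fun_prop
    filter_upwards [(hc.tendsto (0, w)).eventually (hloc w).eventually_nhds] with z hz
    exact planeJacobian_slicePlane t hψ hz
  filter_upwards [hJ, hcont] with s hs hcs
  have he : (fun w => planeJacobian (ψ s) (slicePlane t w)) = fun w : Sphere2 =>
      √(completedGram (height ∘ liftedFlow ψ t) (direction ∘ liftedFlow ψ t)
        (s, (w : E3))).det := funext fun w => hs w (mem_univ w)
  rw [integral_map_slicePlane t (f := planeJacobian (ψ s)) (by rw [he]; exact hcs), he]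

/-! ### A criterion for orientability -/

section Orientability

variable {E : Type*} [NormedAddCommGroup E] [NormedSpace ℝ E] [FiniteDimensional ℝ E] {n : ℕ}

/-- The determinant of the rows `ν, A b₁, …, A bₙ`. -/
def frameDet (b : Module.Basis (Fin n) ℝ E) (ν : Fin (n + 1) → ℝ)
    (A : E →L[ℝ] (Fin (n + 1) → ℝ)) : ℝ :=
  Matrix.det (Matrix.of (Matrix.vecCons ν fun i => A (b i)))

/-- With `ν` and `A` fixed, the determinant is an alternating form of top degree on `E`, hence a
multiple of the determinant in the basis `b`. -/
theorem frameDet_comp (b : Module.Basis (Fin n) ℝ E) (ν : Fin (n + 1) → ℝ)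
    (A : E →L[ℝ] (Fin (n + 1) → ℝ)) (T : E →L[ℝ] E) :
    frameDet b ν (A.comp T) = T.det * frameDet b ν A := by
  let f : E [⋀^Fin n]→ₗ[ℝ] ℝ :=
    ((Matrix.detRowAlternating (R := ℝ) (n := Fin (n + 1))).curryLeft ν).compLinearMap A.toLinearMap
  have hf : ∀ v : Fin n → E,
      f v = Matrix.det (Matrix.of (Matrix.vecCons ν fun i => A (v i))) := fun v => rfl
  have h1 : frameDet b ν (A.comp T) = f (T ∘ b) := rfl
  have h2 : frameDet b ν A = f b := rfl
  have h3 := congrArg (fun g : E [⋀^Fin n]→ₗ[ℝ] ℝ => g (T ∘ b)) (f.eq_smul_basis_det b)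
  have h4 : b.det (T ∘ b) = LinearMap.det (T : E →ₗ[ℝ] E) * b.det b :=
    b.det_comp (T : E →ₗ[ℝ] E) b
  rw [b.det_self, mul_one] at h4
  rw [h1, h2]
  refine h3.trans ?_
  simp only [AlternatingMap.smul_apply, h4, smul_eq_mul]
  rw [mul_comm]

theorem frameDet_smul (b : Module.Basis (Fin n) ℝ E) (ν : Fin (n + 1) → ℝ)
    (A : E →L[ℝ] (Fin (n + 1) → ℝ)) (c : ℝ) :
    frameDet b (c • ν) (c • A) = c ^ (n + 1) * frameDet b ν A := by
  have h := Matrix.det_smul (Matrix.of (Matrix.vecCons ν fun i => A (b i))) c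
  rw [Fintype.card_fin] at h
  rw [frameDet, frameDet, ← h]
  congr 1
  funext i j
  refine Fin.cases ?_ (fun i => ?_) i <;> rfl

/-- In a linear relation between the rows, pairing with `ν` kills its own coefficient. Injectivity
of `A` then kills the others. -/
theorem frameDet_ne_zero (b : Module.Basis (Fin n) ℝ E) {ν : Fin (n + 1) → ℝ}
    {A : E →L[ℝ] (Fin (n + 1) → ℝ)} (hν : ν ≠ 0) (hA : Function.Injective A)
    (hνA : ∀ v, ν ⬝ᵥ A v = 0) : frameDet b ν A ≠ 0 := by
  intro h
  obtain ⟨c, hc, h1⟩ := Matrix.exists_vecMul_eq_zero_iff.2 h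
  have h2 : c 0 • ν + A (∑ i, c i.succ • b i) = 0 := by
    rw [← h1, Matrix.vecMul_eq_sum, Fin.sum_univ_succ]
    simp only [map_sum, map_smul]
    rfl
  have h3 := congrArg (fun v => ν ⬝ᵥ v) h2
  simp only [dotProduct_add, dotProduct_smul, hνA, add_zero, dotProduct_zero, smul_eq_mul] at h3
  have hc0 : c 0 = 0 := by
    rcases mul_eq_zero.1 h3 with h4 | h4
    · exact h4
    · exact absurd (dotProduct_self_eq_zero.1 h4) hν
  rw [hc0, zero_smul, zero_add] at h2
  have h5 : ∑ i, c i.succ • b i = 0 := hA (by rw [h2, map_zero])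
  have h6 := (Fintype.linearIndependent_iff.1 b.linearIndependent) _ h5
  exact hc (funext fun i => Fin.cases hc0 h6 i)

theorem continuousAt_frameDet {X : Type*} [TopologicalSpace X] (b : Module.Basis (Fin n) ℝ E)
    {ν : X → Fin (n + 1) → ℝ} {A : X → E →L[ℝ] (Fin (n + 1) → ℝ)} {x : X}
    (hν : ContinuousAt ν x) (hA : ContinuousAt A x) :
    ContinuousAt (fun x => frameDet b (ν x) (A x)) x := by
  have h : Continuous fun p : (Fin (n + 1) → ℝ) × (E →L[ℝ] (Fin (n + 1) → ℝ)) =>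
      frameDet b p.1 p.2 := by
    refine Continuous.matrix_det (continuous_pi fun i => continuous_pi fun j => ?_)
    refine Fin.cases ?_ (fun i => ?_) i
    · exact (continuous_apply j).comp continuous_fst
    · exact (continuous_apply j).comp (continuous_snd.clm_apply continuous_const)
  exact h.continuousAt.comp (hν.prodMk hA)

theorem exists_continuousLinearEquiv_det_neg (b : Module.Basis (Fin (n + 1)) ℝ E) :
    ∃ L : E ≃L[ℝ] E, (L : E →L[ℝ] E).det < 0 := by
  let d : Fin (n + 1) → ℝ := fun i => if i = 0 then -1 else 1
  have hd : Matrix.toLin b b (Matrix.diagonal d) ∘ₗ Matrix.toLin b b (Matrix.diagonal d) =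
      LinearMap.id := by
    rw [← Matrix.toLin_mul, Matrix.diagonal_mul_diagonal, ← Matrix.toLin_one b,
      ← Matrix.diagonal_one]
    congr 2
    funext i
    by_cases h : i = 0 <;> simp [d, h]
  refine ⟨(LinearEquiv.ofInvolutive (Matrix.toLin b b (Matrix.diagonal d))
    fun x => LinearMap.congr_fun hd x).toContinuousLinearEquiv, ?_⟩
  have h : LinearMap.det (Matrix.toLin b b (Matrix.diagonal d)) < 0 := by
    rw [LinearMap.det_toLin, Matrix.det_diagonal, Fin.prod_univ_succ]
    simp [d]
  exact h

variable {H : Type*} [TopologicalSpace H] {I : ModelWithCorners ℝ E H} [I.Boundaryless]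
  {M : Type*} [TopologicalSpace M] [ChartedSpace H M] [IsManifold I ∞ M]

theorem contMDiffAt_extend_symm_of_mem_maximalAtlas {e : OpenPartialHomeomorph M H}
    (he : e ∈ IsManifold.maximalAtlas I ∞ M) {x : M} (hx : x ∈ e.source) :
    ContMDiffAt 𝓘(ℝ, E) I ∞ (e.extend I).symm (e.extend I x) := by
  refine (contMDiffOn_extend_symm he).contMDiffAt ?_
  refine Filter.mem_of_superset (e.isOpen_extend_target.mem_nhds
    ((e.extend I).map_source (by rw [e.extend_source]; exact hx))) ?_
  rw [OpenPartialHomeomorph.extend_target, ← I.image_eq]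

/-- The determinant of the normal vector `ν` and of the partial derivatives at `x`, in the chart
`e`, of the map `g`. -/
def chartDet (I : ModelWithCorners ℝ E H) (b : Module.Basis (Fin n) ℝ E) (ν : Fin (n + 1) → ℝ)
    (g : M → Fin (n + 1) → ℝ) (e : OpenPartialHomeomorph M H) (x : M) : ℝ :=
  frameDet b ν (fderiv ℝ (g ∘ (e.extend I).symm) (e.extend I x))

variable {b : Module.Basis (Fin n) ℝ E} {ν : Fin (n + 1) → ℝ} {g : M → Fin (n + 1) → ℝ}
  {e e' : OpenPartialHomeomorph M H} {x : M}

theorem contDiffAt_comp_extend_symm (hg : ContMDiffAt I 𝓘(ℝ, Fin (n + 1) → ℝ) ∞ g x)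
    (he : e ∈ IsManifold.maximalAtlas I ∞ M) (hx : x ∈ e.source) :
    ContDiffAt ℝ ∞ (g ∘ (e.extend I).symm) (e.extend I x) := by
  refine contMDiffAt_iff_contDiffAt.1 (ContMDiffAt.comp _ ?_ (contMDiffAt_extend_symm_of_mem_maximalAtlas he hx))
  rwa [e.extend_left_inv hx]

/-- By the chain rule the Jacobian determinant of a transition map is a quotient of two chart
determinants, so signs of transitions can be read off pointwise signs. -/
theorem chartDet_eq_det_mul (hg : ContMDiffAt I 𝓘(ℝ, Fin (n + 1) → ℝ) ∞ g x)
    (he : e ∈ IsManifold.maximalAtlas I ∞ M) (he' : e' ∈ IsManifold.maximalAtlas I ∞ M)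
    (hx : x ∈ e.source) (hx' : x ∈ e'.source) :
    chartDet I b ν g e x = (fderiv ℝ (e'.extend I ∘ (e.extend I).symm) (e.extend I x)).det *
      chartDet I b ν g e' x := by
  rw [chartDet, chartDet, ← frameDet_comp]
  refine congrArg (frameDet b ν) ?_
  have h1 : HasFDerivAt (e'.extend I ∘ (e.extend I).symm)
      (fderiv ℝ (e'.extend I ∘ (e.extend I).symm) (e.extend I x)) (e.extend I x) := by
    have : ContMDiffAt 𝓘(ℝ, E) 𝓘(ℝ, E) ∞ (e'.extend I ∘ (e.extend I).symm) (e.extend I x) :=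
      ContMDiffAt.comp _ (by
        rw [e.extend_left_inv hx]
        exact OpenPartialHomeomorph.contMDiffAt_extend he' hx') (contMDiffAt_extend_symm_of_mem_maximalAtlas he hx)
    exact ((contMDiffAt_iff_contDiffAt.1 this).differentiableAt (by simp)).hasFDerivAt
  have h2 : HasFDerivAt (g ∘ (e'.extend I).symm)
      (fderiv ℝ (g ∘ (e'.extend I).symm) (e'.extend I x))
      ((e'.extend I ∘ (e.extend I).symm) (e.extend I x)) := by
    rw [Function.comp_apply, e.extend_left_inv hx]
    exact ((contDiffAt_comp_extend_symm hg he' hx').differentiableAt (by simp)).hasFDerivAt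
  refine ((h2.comp _ h1).congr_of_eventuallyEq ?_).fderiv
  have hc : ContinuousAt (e.extend I).symm (e.extend I x) :=
    (contMDiffAt_extend_symm_of_mem_maximalAtlas he hx).continuousAt
  have hn : e'.source ∈ 𝓝 ((e.extend I).symm (e.extend I x)) := by
    rw [e.extend_left_inv hx]; exact e'.open_source.mem_nhds hx'
  filter_upwards [hc hn] with y hy
  simp only [Function.comp]
  rw [e'.extend_left_inv hy]

theorem chartDet_ne_zero (hg : ContMDiffAt I 𝓘(ℝ, Fin (n + 1) → ℝ) ∞ g x) (hν : ν ≠ 0)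
    (hinj : Function.Injective (mfderiv I 𝓘(ℝ, Fin (n + 1) → ℝ) g x))
    (hperp : ∀ v, ν ⬝ᵥ (mfderiv I 𝓘(ℝ, Fin (n + 1) → ℝ) g x v : Fin (n + 1) → ℝ) = 0)
    (he : e ∈ IsManifold.maximalAtlas I ∞ M) (hx : x ∈ e.source) :
    chartDet I b ν g e x ≠ 0 := by
  have h1 : HasMFDerivAt 𝓘(ℝ, E) I (e.extend I).symm (e.extend I x)
      (mfderiv 𝓘(ℝ, E) I (e.extend I).symm (e.extend I x)) :=
    ((contMDiffAt_extend_symm_of_mem_maximalAtlas he hx).mdifferentiableAt (by simp)).hasMFDerivAt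
  have h2 : HasMFDerivAt I 𝓘(ℝ, Fin (n + 1) → ℝ) g ((e.extend I).symm (e.extend I x))
      (mfderiv I 𝓘(ℝ, Fin (n + 1) → ℝ) g x) := by
    rw [e.extend_left_inv hx]
    exact (hg.mdifferentiableAt (by simp)).hasMFDerivAt
  let A : E →L[ℝ] (Fin (n + 1) → ℝ) := (mfderiv I 𝓘(ℝ, Fin (n + 1) → ℝ) g x).comp
    (mfderiv 𝓘(ℝ, E) I (e.extend I).symm (e.extend I x))
  have h3' : HasFDerivAt (g ∘ (e.extend I).symm) A (e.extend I x) := (h2.comp _ h1).hasFDerivAt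
  have h3 := h3'.fderiv
  have h4 : HasMFDerivAt I 𝓘(ℝ, E) (e.extend I) ((e.extend I).symm (e.extend I x))
      (mfderiv I 𝓘(ℝ, E) (e.extend I) x) := by
    rw [e.extend_left_inv hx]
    exact ((OpenPartialHomeomorph.contMDiffAt_extend he hx).mdifferentiableAt
      (by simp)).hasMFDerivAt
  have h5 : HasMFDerivAt 𝓘(ℝ, E) 𝓘(ℝ, E) (e.extend I ∘ (e.extend I).symm) (e.extend I x)
      (ContinuousLinearMap.id ℝ (TangentSpace 𝓘(ℝ, E) (e.extend I x))) := by
    refine (hasMFDerivAt_id (e.extend I x)).congr_of_eventuallyEq ?_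
    filter_upwards [e.isOpen_extend_target.mem_nhds
      ((e.extend I).map_source (by rw [e.extend_source]; exact hx))] with y hy
    exact (e.extend I).right_inv hy
  have h6 := hasMFDerivAt_unique (h4.comp _ h1) h5
  have hinj' : Function.Injective (mfderiv 𝓘(ℝ, E) I (e.extend I).symm (e.extend I x)) := by
    intro u v huv
    have e1 := DFunLike.congr_fun h6 u
    have e2 := DFunLike.congr_fun h6 v
    have e3 : mfderiv I 𝓘(ℝ, E) (e.extend I) x
      (mfderiv 𝓘(ℝ, E) I (e.extend I).symm (e.extend I x) u) =
      mfderiv I 𝓘(ℝ, E) (e.extend I) x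
      (mfderiv 𝓘(ℝ, E) I (e.extend I).symm (e.extend I x) v) := congrArg _ huv
    exact (e1.symm.trans e3).trans e2
  have h7 : ∀ v, fderiv ℝ (g ∘ (e.extend I).symm) (e.extend I x) v =
      mfderiv I 𝓘(ℝ, Fin (n + 1) → ℝ) g x
        (mfderiv 𝓘(ℝ, E) I (e.extend I).symm (e.extend I x) v) := fun v => DFunLike.congr_fun h3 v
  exact frameDet_ne_zero b hν
    (fun u v huv => hinj' (hinj (((h7 u).symm.trans huv).trans (h7 v))))
    fun v => (congrArg (fun z => ν ⬝ᵥ z) (h7 v)).trans (hperp _)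

theorem continuousAt_chartDet (hg : ContMDiffAt I 𝓘(ℝ, Fin (n + 1) → ℝ) ∞ g x)
    {ν' : M → Fin (n + 1) → ℝ} (hν' : ContinuousAt ν' x)
    (he : e ∈ IsManifold.maximalAtlas I ∞ M) (hx : x ∈ e.source) :
    ContinuousAt (fun y => chartDet I b (ν' y) g e y) x :=
  continuousAt_frameDet b hν' (ContinuousAt.comp (g := fderiv ℝ (g ∘ (e.extend I).symm))
    ((contDiffAt_comp_extend_symm hg he hx).fderiv_right (m := 0) (by simp)).continuousAt
    (OpenPartialHomeomorph.contMDiffAt_extend he hx).continuousAt)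

/-- The power of `c` decides both orientability questions: for `c = -1` it is `1` when the manifold
has dimension three and `-1` when it has dimension two. -/
theorem chartDet_smul {g' : M → Fin (n + 1) → ℝ}
    (hg : ContMDiffAt I 𝓘(ℝ, Fin (n + 1) → ℝ) 1 g x) {c : ℝ} (hg' : g' =ᶠ[𝓝 x] c • g)
    (he : e ∈ IsManifold.maximalAtlas I ∞ M) (hx : x ∈ e.source) :
    chartDet I b (c • ν) g' e x = c ^ (n + 1) * chartDet I b ν g e x := by
  rw [chartDet, chartDet, ← frameDet_smul]
  refine congrArg (frameDet b (c • ν)) ?_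
  have hd : ContDiffAt ℝ 1 (g ∘ (e.extend I).symm) (e.extend I x) := by
    refine contMDiffAt_iff_contDiffAt.1 (ContMDiffAt.comp _ ?_
      ((contMDiffAt_extend_symm_of_mem_maximalAtlas he hx).of_le (by simp)))
    rwa [e.extend_left_inv hx]
  rw [← fderiv_const_smul (hd.differentiableAt (by simp))]
  refine Filter.EventuallyEq.fderiv_eq ?_
  have hcs : ContinuousAt (e.extend I).symm (e.extend I x) :=
    (contMDiffAt_extend_symm_of_mem_maximalAtlas he hx).continuousAt
  have hg'' : ∀ᶠ z in 𝓝 ((e.extend I).symm (e.extend I x)), g' z = (c • g) z := by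
    rwa [e.extend_left_inv hx]
  exact hcs.eventually hg''

/-- A manifold is orientable if it has local immersions `g x` into a Euclidean space of one
dimension more, with normal vectors `ν x`, which are unique up to scalars of determinant one. -/
theorem isOrientableOn_univ_of_immersions (b : Module.Basis (Fin n) ℝ E)
    (L : E ≃L[ℝ] E) (hL : (L : E →L[ℝ] E).det < 0)
    (g : M → M → Fin (n + 1) → ℝ) (ν : M → Fin (n + 1) → ℝ)
    (hg : ∀ x, ContMDiffAt I 𝓘(ℝ, Fin (n + 1) → ℝ) ∞ (g x) x) (hν : ∀ x, ν x ≠ 0)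
    (hinj : ∀ x, Function.Injective (mfderiv I 𝓘(ℝ, Fin (n + 1) → ℝ) (g x) x))
    (hperp : ∀ x v, ν x ⬝ᵥ (mfderiv I 𝓘(ℝ, Fin (n + 1) → ℝ) (g x) x v : Fin (n + 1) → ℝ) = 0)
    (hcomp : ∀ x, ∃ ν' : M → Fin (n + 1) → ℝ, ContinuousAt ν' x ∧ ∀ᶠ y in 𝓝 x, ∃ c : ℝ,
      c ^ (n + 1) = 1 ∧ g y =ᶠ[𝓝 y] c • g x ∧ ν y = c • ν' y) :
    IsOrientableOn I (univ : Set M) := by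
  -- The oriented atlas will consist of the charts with positive `θ`. Although `g x` changes with
  -- `x`, `θ e` is continuous since the scalars in `hcomp` satisfy `c ^ (n + 1) = 1`.
  let θ : OpenPartialHomeomorph M H → M → ℝ := fun e x => chartDet I b (ν x) (g x) e x
  have htrans : ∀ {e e' : OpenPartialHomeomorph M H}, e ∈ IsManifold.maximalAtlas I ∞ M →
      e' ∈ IsManifold.maximalAtlas I ∞ M → ∀ {x}, x ∈ e.source → x ∈ e'.source →
      θ e x = (fderiv ℝ (e'.extend I ∘ (e.extend I).symm) (e.extend I x)).det * θ e' x :=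
    fun he he' x hx hx' => chartDet_eq_det_mul (hg x) he he' hx hx'
  have hcont : ∀ {e : OpenPartialHomeomorph M H}, e ∈ IsManifold.maximalAtlas I ∞ M →
      ∀ {x}, x ∈ e.source → ContinuousAt (θ e) x := by
    intro e he x hx
    obtain ⟨ν', hν', hev⟩ := hcomp x
    refine (continuousAt_chartDet (b := b) (hg x) hν' he hx).congr ?_
    filter_upwards [hev, e.open_source.mem_nhds hx,
      (contMDiffAt_iff_contMDiffAt_nhds (by simp)).1 ((hg x).of_le (m := 1) (by simp))] with y ⟨c, hc, hgy, hνy⟩ hy hd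
    change chartDet I b (ν' y) (g x) e y = chartDet I b (ν y) (g y) e y
    rw [hνy, chartDet_smul hd hgy he hy, hc, one_mul]
  -- Composition with `R` reverses the sign of charts which have the wrong one.
  let R : H ≃ₜ H := (I.toHomeomorph.trans L.toHomeomorph).trans I.toHomeomorph.symm
  have hIsymm : ContMDiff 𝓘(ℝ, E) I ∞ I.symm := by
    rw [← contMDiffOn_univ, ← I.range_eq_univ]
    exact I.contMDiffOn_symm
  have hR : ContMDiff I I ∞ R := hIsymm.comp (L.contDiff.contMDiff.comp I.contMDiff)
  have hR' : ContMDiff I I ∞ R.symm := hIsymm.comp (L.symm.contDiff.contMDiff.comp I.contMDiff)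
  have hRL : ∀ y, I (R y) = L (I y) := fun y =>
    I.right_inv (by rw [I.range_eq_univ]; exact mem_univ _)
  have hrestr : ∀ (e : OpenPartialHomeomorph M H) (s : Set M), θ (e.restr s) = θ e :=
    fun e s => rfl
  refine ⟨{e | e ∈ IsManifold.maximalAtlas I ∞ M ∧ ∀ x ∈ e.source, 0 < θ e x}, fun e he => he.1,
    fun e _ => subset_univ _, fun x _ => ?_, ?_⟩
  · have key : ∀ e ∈ IsManifold.maximalAtlas I ∞ M, x ∈ e.source → 0 < θ e x →
        ∃ e ∈ {e | e ∈ IsManifold.maximalAtlas I ∞ M ∧ ∀ x ∈ e.source, 0 < θ e x},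
          x ∈ e.source := by
      intro e he hx hpos
      obtain ⟨W, hW, hWo, hxW⟩ := mem_nhds_iff.1 ((hcont he hx) (isOpen_Ioi.mem_nhds hpos))
      refine ⟨e.restr W, ⟨restr_mem_maximalAtlas _ he hWo, fun y hy => ?_⟩, ?_⟩
      · rw [hrestr]
        rw [e.restr_source, hWo.interior_eq] at hy
        exact hW hy.2
      · rw [e.restr_source, hWo.interior_eq]
        exact ⟨hx, hxW⟩
    have hc : chartAt H x ∈ IsManifold.maximalAtlas I ∞ M := IsManifold.chart_mem_maximalAtlas x
    have hx : x ∈ (chartAt H x).source := mem_chart_source H x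
    rcases lt_or_gt_of_ne (chartDet_ne_zero (b := b) (hg x) (hν x) (hinj x) (hperp x) hc hx)
      with hneg | hpos
    · have he' : chartAt H x ≫ₕ R.toOpenPartialHomeomorph ∈ IsManifold.maximalAtlas I ∞ M := by
        refine trans_mem_maximalAtlas (contMDiffOn_of_mem_maximalAtlas hc)
          (contMDiffOn_symm_of_mem_maximalAtlas hc)
          (mem_maximalAtlas_of_contMDiffOn hR.contMDiffOn hR'.contMDiffOn)
      have hx' : x ∈ (chartAt H x ≫ₕ R.toOpenPartialHomeomorph).source := by
        simp [hx]
      refine key _ he' hx' ?_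
      have h1 := htrans hc he' hx hx'
      have h2 : fderiv ℝ ((chartAt H x ≫ₕ R.toOpenPartialHomeomorph).extend I ∘
          ((chartAt H x).extend I).symm) ((chartAt H x).extend I x) = (L : E →L[ℝ] E) := by
        refine ((L : E →L[ℝ] E).hasFDerivAt.congr_of_eventuallyEq ?_).fderiv
        filter_upwards [(chartAt H x).isOpen_extend_target.mem_nhds
          (((chartAt H x).extend I).map_source (by rw [OpenPartialHomeomorph.extend_source]; exact hx))] with y hy
        have h3 := ((chartAt H x).extend I).right_inv hy
        refine Eq.trans ?_ (congrArg L h3)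
        exact hRL _
      rw [h2] at h1
      have hneg' : θ (chartAt H x) x < 0 := hneg
      rw [h1] at hneg'
      exact pos_of_mul_neg_right hneg' hL.le
    · exact key _ hc hx hpos
  · rintro e ⟨he, hpos⟩ e' ⟨he', hpos'⟩ y hy
    simp only [mfld_simps] at hy
    have hx : e.symm y ∈ e.source := e.map_target hy.1
    have h1 := htrans he he' hx hy.2
    have hy' : e.extend I (e.symm y) = I y := congrArg I (e.right_inv hy.1)
    rw [I.range_eq_univ, fderivWithin_univ]
    rw [hy'] at h1
    have h2 := hpos _ hx
    rw [h1] at h2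
    exact pos_of_mul_pos_left h2 (hpos' _ hy.2).le

end Orientability

/-! ### The orientability of the sphere and of the quotient -/

/-- The inclusion into `ℝ³` serves both as the immersion and as the normal field. -/
theorem isOrientableOn_sphere : IsOrientableOn (𝓡 2) (univ : Set Sphere2) := by
  let b := (EuclideanSpace.basisFun (Fin 2) ℝ).toBasis
  obtain ⟨L, hL⟩ := exists_continuousLinearEquiv_det_neg b
  let κ : E3 ≃L[ℝ] (Fin 3 → ℝ) := EuclideanSpace.equiv (Fin 3) ℝ
  let D : ∀ w : Sphere2, TangentSpace (𝓡 2) w →L[ℝ] E3 := fun w =>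
    mfderiv (𝓡 2) 𝓘(ℝ, E3) (Subtype.val : Sphere2 → E3) w
  have hκ : ContMDiff (𝓡 2) 𝓘(ℝ, Fin 3 → ℝ) ∞ fun w : Sphere2 => κ (w : E3) :=
    κ.contDiff.contMDiff.comp contMDiff_coe_sphere
  have hder : ∀ w : Sphere2, mfderiv (𝓡 2) 𝓘(ℝ, Fin 3 → ℝ) (fun w : Sphere2 => κ (w : E3)) w =
      (κ : E3 →L[ℝ] (Fin 3 → ℝ)).comp (D w) := by
    intro w
    have h1 : HasMFDerivAt (𝓡 2) 𝓘(ℝ, E3) (Subtype.val : Sphere2 → E3) w (D w) :=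
      ((contMDiff_coe_sphere (m := ∞)).mdifferentiableAt (by simp)).hasMFDerivAt
    exact (κ.hasFDerivAt.hasMFDerivAt.comp w h1).mfderiv
  refine isOrientableOn_univ_of_immersions b L hL (fun _ w => κ (w : E3)) (fun w => κ (w : E3))
    (fun w => hκ.contMDiffAt) ?_ ?_ ?_ ?_
  · intro w h
    exact coe_sphere_ne_zero w (κ.map_eq_zero_iff.1 h)
  · intro w
    rw [hder]
    exact κ.injective.comp (injective_mvfderiv_subtypeVal_sphere w)
  · intro w v
    rw [hder]
    have h : inner ℝ (w : E3) (D w v) = 0 := inner_coe_mfderiv_coe_sphere w v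
    rw [PiLp.inner_apply] at h
    rw [← h]
    exact Finset.sum_congr rfl fun i _ => mul_comm _ _
  · intro w
    have hc : Continuous fun w : Sphere2 => κ (w : E3) := hκ.continuous
    exact ⟨_, hc.continuousAt, Eventually.of_forall fun v =>
      ⟨1, one_pow _, by rw [one_smul], by rw [one_smul]⟩⟩

/-- The coordinates of `ℝ × ℝ³`. -/
def coordEquiv : (ℝ × E3) →L[ℝ] (Fin 4 → ℝ) :=
  LinearMap.toContinuousLinearMap
    { toFun := fun p => Matrix.vecCons p.1 p.2
      map_add' := fun p q => by
        funext i
        refine Fin.cases ?_ (fun i => ?_) i <;> rfl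
      map_smul' := fun c p => by
        funext i
        refine Fin.cases ?_ (fun i => ?_) i <;> rfl }

theorem dotProduct_coordEquiv (p q : ℝ × E3) :
    coordEquiv p ⬝ᵥ coordEquiv q = p.1 * q.1 + inner ℝ p.2 q.2 := by
  rw [dotProduct, Fin.sum_univ_succ, PiLp.inner_apply]
  refine congrArg₂ (· + ·) rfl (Finset.sum_congr rfl fun i _ => ?_)
  exact mul_comm _ _

theorem coordEquiv_injective : Function.Injective coordEquiv := by
  rw [injective_iff_map_eq_zero]
  intro p hp
  have h := dotProduct_coordEquiv p p
  rw [hp, zero_dotProduct, real_inner_self_eq_norm_sq] at h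
  have h1 : p.1 = 0 := by nlinarith [sq_nonneg ‖p.2‖, mul_self_nonneg p.1]
  have h2 : ‖p.2‖ = 0 := by nlinarith [sq_nonneg ‖p.2‖, mul_self_nonneg p.1]
  exact Prod.ext h1 (norm_eq_zero.1 h2)

/-- Local sections immerse `N` locally into `ℝ × ℝ³` with normal `(0, ω)`. Two sections differ by a
sign acting on all four coordinates and on the normal, and the fourth power of the sign is `1`. -/
theorem isOrientableOn_quotCyl : IsOrientableOn cylModel (univ : Set QuotCyl) := by
  let b : Module.Basis (Fin 3) ℝ (ℝ × EuclideanSpace ℝ (Fin 2)) :=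
    (Module.finBasisOfFinrankEq ℝ (ℝ × EuclideanSpace ℝ (Fin 2)) (by simp))
  obtain ⟨L, hL⟩ := exists_continuousLinearEquiv_det_neg b
  let G : Cylinder → ℝ × E3 := fun p => (height p, direction p)
  have hG : ContMDiff cylModel 𝓘(ℝ, ℝ × E3) ∞ G := contMDiff_height.prodMk_space contMDiff_direction
  have hGs : ∀ x, ContMDiffAt cylModel 𝓘(ℝ, ℝ × E3) ∞ (G ∘ localSection x) x := fun x =>
    hG.contMDiffAt.comp x (contMDiffAt_localSection x)
  let D : ∀ x : QuotCyl, TangentSpace cylModel x →L[ℝ] (ℝ × E3) := fun x =>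
    ContinuousLinearMap.prod (mvfderiv cylModel (height ∘ localSection x) x)
      (mvfderiv cylModel (direction ∘ localSection x) x)
  have hder : ∀ x, mfderiv cylModel 𝓘(ℝ, Fin 4 → ℝ) (coordEquiv ∘ G ∘ localSection x) x =
      coordEquiv.comp (D x) := by
    intro x
    have h1 : HasMFDerivAt cylModel 𝓘(ℝ, ℝ × E3) (G ∘ localSection x) x (D x) := by
      have h2 := ((contMDiff_height.contMDiffAt.comp x
        (contMDiffAt_localSection x)).mdifferentiableAt (by simp)).hasMFDerivAt
      have h3 := ((contMDiff_direction.contMDiffAt.comp x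
        (contMDiffAt_localSection x)).mdifferentiableAt (by simp)).hasMFDerivAt
      exact ⟨h2.1.prodMk h3.1, h2.2.prodMk h3.2⟩
    exact (coordEquiv.hasFDerivAt.hasMFDerivAt.comp x h1).mfderiv
  refine isOrientableOn_univ_of_immersions b L hL (fun x => coordEquiv ∘ G ∘ localSection x)
    (fun x => coordEquiv (0, direction (localSection x x)))
    (fun x => coordEquiv.contDiff.contMDiff.contMDiffAt.comp x (hGs x)) ?_ ?_ ?_ ?_
  · intro x h
    have h1 := coordEquiv_injective (h.trans (map_zero coordEquiv).symm)
    exact coe_sphere_ne_zero (localSection x x).2 (congrArg Prod.snd h1)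
  · intro x
    rw [hder]
    refine coordEquiv_injective.comp ?_
    change Function.Injective (D x)
    rw [injective_iff_map_eq_zero]
    intro v hv
    have h1 : mvfderiv cylModel (height ∘ localSection x) x v = 0 := congrArg Prod.fst hv
    have h2 : mvfderiv cylModel (direction ∘ localSection x) x v = 0 := congrArg Prod.snd hv
    have h3 : inner ℝ v v = (0 : ℝ) := by
      rw [inner_tangentSpace_quotCyl, quotMetric_eq_of_section x (localSection x)
        (contMDiffAt_localSection x) (proj_localSection x)]
      simp only [add_apply, pullForm_apply, euclForm_apply, h1, h2]
      simp
    exact inner_self_eq_zero.1 h3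
  · intro x v
    rw [hder]
    have h0 := dotProduct_coordEquiv (0, direction (localSection x x)) (D x v)
    refine h0.trans ?_
    rw [zero_mul, zero_add]
    have h3 := ((contMDiff_direction.contMDiffAt.comp x
        (contMDiffAt_localSection x)).mdifferentiableAt (by simp)).hasMFDerivAt
    have h8 := (hasStrictFDerivAt_norm_sq (direction (localSection x x))).hasFDerivAt.hasMFDerivAt.comp x h3
    have h9 : HasMFDerivAt cylModel 𝓘(ℝ, ℝ) ((fun x : E3 => ‖x‖ ^ 2) ∘ direction ∘ localSection x) x
        (0 : TangentSpace cylModel x →L[ℝ] ℝ) :=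
      (hasMFDerivAt_const (1 : ℝ) x).congr_of_eventuallyEq (Eventually.of_forall fun v => by
        simp only [Function.comp]
        rw [show ‖direction (localSection x v)‖ = 1 from
          mem_sphere_zero_iff_norm.1 (localSection x v).2.2, one_pow])
    have h10 := DFunLike.congr_fun (hasMFDerivAt_unique h8 h9) v
    have h11 : (2 : ℕ) • inner ℝ (direction (localSection x x)) (D x v).2 = 0 := h10
    simpa using h11
  · intro x
    refine ⟨fun y => coordEquiv (0, direction (localSection x y)), ?_, ?_⟩
    · exact coordEquiv.continuous.continuousAt.comp (continuousAt_const.prodMk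
        (contMDiff_direction.continuous.continuousAt.comp (contMDiffAt_localSection x).continuousAt))
    · filter_upwards [(localSection x).open_source.mem_nhds (mem_localSection_source x),
        (proj_localSection x).eventually_nhds] with y hy hy'
      obtain ⟨u, hu⟩ := exists_localSection_eventuallyEq y (localSection x)
        ((localSection x).continuousAt hy) hy'
      refine ⟨signVal u, ?_, ?_, ?_⟩
      · have := signVal_mul_self u
        calc signVal u ^ 4 = (signVal u * signVal u) * (signVal u * signVal u) := by ring
          _ = 1 := by rw [this, one_mul]
      · filter_upwards [hu] with z hz
        simp only [Function.comp, hz, Pi.smul_apply]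
        rw [← map_smul]
        rfl
      · rw [hu.self_of_nhds, ← map_smul, Prod.smul_mk, smul_zero]
        rfl

/-! ### The projective plane is not orientable -/

/-- A local section of the projection of the sphere onto the projective plane, through `w`. -/
def planeSection (w : Sphere2) : OpenPartialHomeomorph ProjPlane Sphere2 :=
  (isLocalHomeomorph_quotientProj (M := Sphere2) (G := ℤˣ)).localInverseAt w

theorem mem_planeSection_source (w : Sphere2) :
    quotientProj Sphere2 ℤˣ w ∈ (planeSection w).source :=
  (isLocalHomeomorph_quotientProj (M := Sphere2) (G := ℤˣ)).apply_self_mem_localInverseAt_source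

theorem quotientProj_planeSection {w : Sphere2} {y : ProjPlane}
    (hy : y ∈ (planeSection w).source) : quotientProj Sphere2 ℤˣ (planeSection w y) = y :=
  (isLocalHomeomorph_quotientProj (M := Sphere2) (G := ℤˣ)).apply_localInverseAt_of_mem hy

theorem planeSection_quotientProj (w : Sphere2) :
    planeSection w (quotientProj Sphere2 ℤˣ w) = w :=
  (isLocalHomeomorph_quotientProj (M := Sphere2) (G := ℤˣ)).injOn_localInverseAt_target (x := w)
    ((planeSection w).map_source (mem_planeSection_source w))
    (isLocalHomeomorph_quotientProj (M := Sphere2) (G := ℤˣ)).self_mem_localInverseAt_target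
    (quotientProj_planeSection (mem_planeSection_source w))

theorem contMDiffAt_planeSection {w : Sphere2} {y : ProjPlane}
    (hy : y ∈ (planeSection w).source) : ContMDiffAt (𝓡 2) (𝓡 2) ∞ (planeSection w) y :=
  (contMDiffOn_localInverse_quotientProj (𝓡 2) ∞ (fun u => contMDiff_smul_sphere u) w).contMDiffAt
    ((planeSection w).open_source.mem_nhds hy)

/-- Two sections agree up to sign at each point. The sign is that of their inner product, which is
locally constant by continuity. -/
theorem planeSection_eventuallyEq {v w : Sphere2} {y : ProjPlane}
    (hv : y ∈ (planeSection v).source) (hw : y ∈ (planeSection w).source) {c : ℝ}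
    (hc : c = 1 ∨ c = -1) (h : (planeSection v y : E3) = c • (planeSection w y : E3)) :
    ∀ᶠ z in 𝓝 y, (planeSection v z : E3) = c • (planeSection w z : E3) := by
  have h1 : ContinuousAt (fun z => c * inner ℝ (planeSection v z : E3) (planeSection w z : E3)) y :=
    continuousAt_const.mul ((continuous_subtype_val.continuousAt.comp
      ((planeSection v).continuousAt hv)).inner (continuous_subtype_val.continuousAt.comp
      ((planeSection w).continuousAt hw)))
  have hnorm : ∀ a : Sphere2, inner ℝ (a : E3) (a : E3) = 1 := fun a => by
    rw [real_inner_self_eq_norm_sq, mem_sphere_zero_iff_norm.1 a.2, one_pow]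
  have hcc : c * c = 1 := by rcases hc with rfl | rfl <;> norm_num
  have hpos : 0 < c * inner ℝ (planeSection v y : E3) (planeSection w y : E3) := by
    rw [h, real_inner_smul_left, hnorm, mul_one, hcc]
    exact one_pos
  filter_upwards [h1 (isOpen_Ioi.mem_nhds hpos), (planeSection v).open_source.mem_nhds hv,
    (planeSection w).open_source.mem_nhds hw] with z hz hzv hzw
  have h2 : 0 < c * inner ℝ (planeSection v z : E3) (planeSection w z : E3) := hz
  rcases quotientProj_sphere_eq_iff.1 ((quotientProj_planeSection hzw).trans
    (quotientProj_planeSection hzv).symm) with h3 | h3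
  · rw [h3, hnorm, mul_one] at h2
    rcases hc with rfl | rfl
    · rw [h3, one_smul]
    · linarith
  · have h4 : (planeSection v z : E3) = -(planeSection w z : E3) := congrArg Subtype.val h3
    rw [h4, inner_neg_left, hnorm] at h2
    rcases hc with rfl | rfl
    · linarith
    · rw [h4, neg_one_smul]

theorem preconnectedSpace_sphere : PreconnectedSpace Sphere2 :=
  Subtype.preconnectedSpace (isPreconnected_sphere (by
    rw [← Module.finrank_eq_rank, finrank_euclideanSpace_fin]
    norm_num) _ _)

/-- With an oriented atlas, the sign of the determinant `θ e w` would depend only on `w`, not on the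
chart (`hind`). It is continuous and never zero, and changes under `w ↦ -w` because `(-1)³ = -1`
(`hneg`). So the points of positive sign would form a clopen set of the connected sphere, exchanged
with its complement by the antipodal map. -/
theorem not_isOrientableOn_projPlane : ¬ IsOrientableOn (𝓡 2) (univ : Set ProjPlane) := by
  rintro ⟨A, hA, -, hcov, hpos⟩
  let b := (EuclideanSpace.basisFun (Fin 2) ℝ).toBasis
  let κ : E3 ≃L[ℝ] (Fin 3 → ℝ) := EuclideanSpace.equiv (Fin 3) ℝ
  let q := quotientProj Sphere2 ℤˣ
  have hq : Continuous q := continuous_quotientProj_sphere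
  let g : Sphere2 → ProjPlane → Fin 3 → ℝ := fun w y => κ (planeSection w y : E3)
  let θ : OpenPartialHomeomorph ProjPlane (EuclideanSpace ℝ (Fin 2)) → Sphere2 → ℝ := fun e w =>
    chartDet (𝓡 2) b (κ (w : E3)) (g w) e (q w)
  have hκ : ContMDiff (𝓡 2) 𝓘(ℝ, Fin 3 → ℝ) ∞ fun w : Sphere2 => κ (w : E3) :=
    κ.contDiff.contMDiff.comp contMDiff_coe_sphere
  have hg : ∀ (w : Sphere2) {y}, y ∈ (planeSection w).source →
      ContMDiffAt (𝓡 2) 𝓘(ℝ, Fin 3 → ℝ) ∞ (g w) y := fun w y hy =>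
    hκ.contMDiffAt.comp y (contMDiffAt_planeSection hy)
  have hne : ∀ {e}, e ∈ A → ∀ {w}, q w ∈ e.source → θ e w ≠ 0 := by
    intro e he w hw
    let D : TangentSpace (𝓡 2) w →L[ℝ] E3 := mfderiv (𝓡 2) 𝓘(ℝ, E3) (Subtype.val : Sphere2 → E3) w
    let S : TangentSpace (𝓡 2) (q w) →L[ℝ] TangentSpace (𝓡 2) w :=
      mfderiv (𝓡 2) (𝓡 2) (planeSection w) (q w)
    have hsw : planeSection w (q w) = w := planeSection_quotientProj w
    have h1 : HasMFDerivAt (𝓡 2) 𝓘(ℝ, E3) (Subtype.val : Sphere2 → E3) (planeSection w (q w)) D := by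
      rw [hsw]
      exact ((contMDiff_coe_sphere (m := ∞)).mdifferentiableAt (by simp)).hasMFDerivAt
    have h2 : HasMFDerivAt (𝓡 2) (𝓡 2) (planeSection w) (q w) S :=
      ((contMDiffAt_planeSection (mem_planeSection_source w)).mdifferentiableAt
        (by simp)).hasMFDerivAt
    have hder : ∀ v, mfderiv (𝓡 2) 𝓘(ℝ, Fin 3 → ℝ) (g w) (q w) v = κ (D (S v)) := fun v =>
      DFunLike.congr_fun (κ.hasFDerivAt.hasMFDerivAt.comp (q w) (h1.comp (q w) h2)).mfderiv v
    have hqs : ContMDiff (𝓡 2) (𝓡 2) ∞ q :=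
      contMDiff_quotientProj (𝓡 2) ∞ fun u => contMDiff_smul_sphere u
    have h3 : HasMFDerivAt (𝓡 2) (𝓡 2) q (planeSection w (q w)) (mfderiv (𝓡 2) (𝓡 2) q w) := by
      rw [hsw]
      exact (hqs.mdifferentiableAt (by simp)).hasMFDerivAt
    have h4 : HasMFDerivAt (𝓡 2) (𝓡 2) (q ∘ planeSection w) (q w)
        (ContinuousLinearMap.id ℝ (TangentSpace (𝓡 2) (q w))) := by
      refine (hasMFDerivAt_id (q w)).congr_of_eventuallyEq ?_
      filter_upwards [(planeSection w).open_source.mem_nhds (mem_planeSection_source w)] with y hy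
      exact quotientProj_planeSection hy
    have h5 := hasMFDerivAt_unique (h3.comp (q w) h2) h4
    have hS : Function.Injective S := by
      intro u v huv
      have e1 := DFunLike.congr_fun h5 u
      have e2 := DFunLike.congr_fun h5 v
      exact (e1.symm.trans (congrArg (mfderiv (𝓡 2) (𝓡 2) q w) huv)).trans e2
    refine chartDet_ne_zero (hg w (mem_planeSection_source w))
      (fun h => coe_sphere_ne_zero w (κ.map_eq_zero_iff.1 h)) ?_ ?_ (hA he) hw
    · intro u v huv
      have h6 := κ.injective (((hder u).symm.trans huv).trans (hder v))
      exact hS (injective_mvfderiv_subtypeVal_sphere w h6)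
    · intro v
      refine (congrArg (fun z => κ (w : E3) ⬝ᵥ z) (hder v)).trans ?_
      have h : inner ℝ (w : E3) (D (S v)) = 0 := inner_coe_mfderiv_coe_sphere w (S v)
      rw [PiLp.inner_apply] at h
      rw [← h]
      exact Finset.sum_congr rfl fun i _ => mul_comm _ _
  have hind : ∀ {e e'}, e ∈ A → e' ∈ A → ∀ {w}, q w ∈ e.source → q w ∈ e'.source →
      0 < θ e w → 0 < θ e' w := by
    intro e e' he he' w hw hw' h
    have h1 := chartDet_eq_det_mul (b := b) (ν := κ (w : E3)) (hg w (mem_planeSection_source w))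
      (hA he') (hA he) hw' hw
    have h2 := hpos e' he' e he (e' (q w)) (by
      simp only [mfld_simps]
      exact ⟨e'.map_source hw', by rwa [e'.left_inv hw']⟩)
    rw [(𝓡 2).range_eq_univ, fderivWithin_univ] at h2
    exact (mul_pos h2 h).trans_eq h1.symm
  have hcont : ∀ {e}, e ∈ A → ∀ {w}, q w ∈ e.source → ContinuousAt (θ e) w := by
    intro e he w hw
    have hν' : ContinuousAt (g w) (q w) := (hg w (mem_planeSection_source w)).continuousAt
    have h1 : ContinuousAt (fun v => chartDet (𝓡 2) b (g w (q v)) (g w) e (q v)) w :=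
      ContinuousAt.comp (g := fun y => chartDet (𝓡 2) b (g w y) (g w) e y)
        (continuousAt_chartDet (hg w (mem_planeSection_source w)) hν' (hA he) hw) hq.continuousAt
    have hs : ContinuousAt (fun v => planeSection w (q v)) w :=
      ((planeSection w).continuousAt (mem_planeSection_source w)).comp hq.continuousAt
    -- The section followed after `q` is locally the action of a group element; it fixes `w`, and
    -- the action is free, so it is the identity.
    have hev : ∀ᶠ v in 𝓝 w, planeSection w (q v) = v := by
      have hloc := localInverse_comp_proj_eventuallyEq (G := ℤˣ) w w (mem_planeSection_source w)
      obtain ⟨u, hu⟩ := hloc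
      have hu1 : u • w = (1 : ℤˣ) • w :=
        (hu.self_of_nhds.symm.trans (planeSection_quotientProj w)).trans (one_smul _ _).symm
      obtain rfl := smul_sphere_cancel _ _ _ hu1
      filter_upwards [hu] with v hv
      exact hv.trans (one_smul _ _)
    refine h1.congr ?_
    filter_upwards [hev, hq.continuousAt ((planeSection w).open_source.mem_nhds
      (mem_planeSection_source w)), hq.continuousAt (e.open_source.mem_nhds hw)] with v hv hv' hve
    have h2 := planeSection_eventuallyEq (mem_planeSection_source v) hv' (Or.inl rfl) (by
      rw [one_smul, planeSection_quotientProj]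
      exact congrArg Subtype.val hv.symm)
    have h3 := chartDet_smul (b := b) (ν := κ (v : E3)) (g' := g v) (c := 1)
      ((hg w hv').of_le (by simp)) (by
        filter_upwards [h2] with z hz
        exact (congrArg κ hz).trans (map_smul κ _ _)) (hA he) hve
    rw [one_smul, one_pow, one_mul] at h3
    refine Eq.trans ?_ h3.symm
    have h4 : g w (q v) = κ (v : E3) := congrArg (fun a : Sphere2 => κ (a : E3)) hv
    simp only [h4]
  have hneg : ∀ {e}, e ∈ A → ∀ {w}, q w ∈ e.source → θ e (-w) = -θ e w := by
    intro e he w hw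
    have hqw : q (-w) = q w := quotientProj_sphere_eq_iff.2 (Or.inr (neg_neg w).symm)
    have hsrc : q w ∈ (planeSection (-w)).source := by
      rw [← hqw]; exact mem_planeSection_source (-w)
    have hval : planeSection (-w) (q w) = -w := by
      rw [← hqw]; exact planeSection_quotientProj (-w)
    have h2 := planeSection_eventuallyEq hsrc (mem_planeSection_source w) (Or.inr rfl) (by
      rw [hval, planeSection_quotientProj, neg_one_smul]
      rfl)
    have h3 := chartDet_smul (b := b) (ν := κ (w : E3)) (g' := g (-w)) (c := -1)
      ((hg w (mem_planeSection_source w)).of_le (by simp)) (by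
        filter_upwards [h2] with z hz
        exact (congrArg κ hz).trans (map_smul κ _ _)) (hA he) hw
    have h4 : κ ((-w : Sphere2) : E3) = (-1 : ℝ) • κ (w : E3) := by
      rw [← map_smul, neg_one_smul]
      rfl
    change chartDet (𝓡 2) b (κ ((-w : Sphere2) : E3)) (g (-w)) e (q (-w)) = _
    rw [hqw, h4, h3]
    norm_num
    rfl
  let P : Set Sphere2 := {w | ∃ e ∈ A, q w ∈ e.source ∧ 0 < θ e w}
  have hopen : IsOpen P := by
    refine isOpen_iff_mem_nhds.2 fun w hw => ?_
    obtain ⟨e, he, hw, h⟩ := hw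
    filter_upwards [hcont he hw (isOpen_Ioi.mem_nhds h),
      hq.continuousAt (e.open_source.mem_nhds hw)] with v hv hv'
    exact ⟨e, he, hv', hv⟩
  have hcompl : ∀ w, w ∈ P ↔ -w ∉ P := by
    intro w
    obtain ⟨e, he, hw⟩ := hcov (q w) (mem_univ _)
    have hqw : q (-w) = q w := quotientProj_sphere_eq_iff.2 (Or.inr (neg_neg w).symm)
    have hw' : q (-w) ∈ e.source := by rwa [hqw]
    have h1 : w ∈ P ↔ 0 < θ e w := ⟨fun ⟨e', he', h1, h2⟩ => hind he' he h1 hw h2,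
      fun h => ⟨e, he, hw, h⟩⟩
    have h2 : -w ∈ P ↔ 0 < θ e (-w) := ⟨fun ⟨e', he', h1, h2⟩ => hind he' he h1 hw' h2,
      fun h => ⟨e, he, hw', h⟩⟩
    rw [h1, h2, hneg he hw, neg_pos, not_lt]
    exact ⟨le_of_lt, fun h => lt_of_le_of_ne h (hne he hw).symm⟩
  have hclopen : IsClopen P := by
    refine ⟨⟨?_⟩, hopen⟩
    have : Pᶜ = (fun w => -w) ⁻¹' P := by
      ext w
      rw [mem_compl_iff, hcompl, not_not]
      rfl
    rw [this]
    exact hopen.preimage (contMDiff_neg_sphere (m := 0) (n := 2)).continuous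
  have := preconnectedSpace_sphere
  let w₀ : Sphere2 := sphProj 0
  rcases isClopen_iff.1 hclopen with h | h
  · have h1 := (hcompl w₀).2 (by rw [h]; exact notMem_empty _)
    rw [h] at h1
    exact h1
  · exact (hcompl w₀).1 (by rw [h]; exact mem_univ _) (by rw [h]; exact mem_univ _)

/-! ### The genus of the sphere and of the projective plane -/

theorem genus_eq_componentGenus_univ (S : Type) [TopologicalSpace S]
    [ChartedSpace (EuclideanSpace ℝ (Fin 2)) S] [PreconnectedSpace S] [Nonempty S] :
    genus S = componentGenus (univ : Set S) := by
  have hsub : Subsingleton (ConnectedComponents S) := inferInstance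
  let c₀ : ConnectedComponents S := ((Classical.arbitrary S : S) : ConnectedComponents S)
  have : Unique (ConnectedComponents S) := ⟨⟨c₀⟩, fun c => Subsingleton.elim c c₀⟩
  rw [genus, finsum_unique]
  congr 1
  ext x
  exact ⟨fun _ => mem_univ _, fun _ => Subsingleton.elim _ _⟩

theorem genus_sphere : genus Sphere2 = 0 := by
  have := preconnectedSpace_sphere
  have : Nonempty Sphere2 := ⟨sphProj 0⟩
  rw [genus_eq_componentGenus_univ, componentGenus, if_pos isOrientableOn_sphere]
  exact Nat.sInf_eq_zero.2 (Or.inl (.sphere _ ⟨Homeomorph.Set.univ Sphere2⟩))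

/-! ### Stereographic projection and the cross cap. -/

theorem sq_add_sq_add_sq_sphere (w : Sphere2) :
    (w : E3) 0 ^ 2 + (w : E3) 1 ^ 2 + (w : E3) 2 ^ 2 = 1 := by
  have := EuclideanSpace.real_norm_sq_eq (w : E3)
  rw [Fin.sum_univ_three, mem_sphere_zero_iff_norm.1 w.2] at this
  linarith

theorem continuous_coord_sphere (i : Fin 3) : Continuous fun w : Sphere2 => (w : E3) i :=
  (EuclideanSpace.proj (𝕜 := ℝ) i).continuous.comp continuous_subtype_val

/-- The inverse of the stereographic projection from the north pole. -/
def invStereographic (z : ℂ) : Sphere2 :=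
  ⟨!₂[2 * z.re / (1 + (z.re ^ 2 + z.im ^ 2)), 2 * z.im / (1 + (z.re ^ 2 + z.im ^ 2)),
    (z.re ^ 2 + z.im ^ 2 - 1) / (1 + (z.re ^ 2 + z.im ^ 2))], by
    have h : 1 + (z.re ^ 2 + z.im ^ 2) ≠ 0 := by positivity
    rw [mem_sphere_zero_iff_norm, ← sq_eq_sq₀ (norm_nonneg _) zero_le_one,
      EuclideanSpace.real_norm_sq_eq, Fin.sum_univ_three]
    simp
    field_simp
    ring⟩

theorem invStereographic_zero (z : ℂ) : (invStereographic z : E3) 0 =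
    2 * z.re / (1 + (z.re ^ 2 + z.im ^ 2)) := rfl

theorem invStereographic_one (z : ℂ) : (invStereographic z : E3) 1 =
    2 * z.im / (1 + (z.re ^ 2 + z.im ^ 2)) := rfl

theorem invStereographic_two (z : ℂ) : (invStereographic z : E3) 2 =
    (z.re ^ 2 + z.im ^ 2 - 1) / (1 + (z.re ^ 2 + z.im ^ 2)) := rfl

theorem sphere_ext {v w : Sphere2} (h0 : (v : E3) 0 = (w : E3) 0) (h1 : (v : E3) 1 = (w : E3) 1)
    (h2 : (v : E3) 2 = (w : E3) 2) : v = w := by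
  refine Subtype.ext ?_
  ext i
  fin_cases i
  exacts [h0, h1, h2]

theorem invStereographic_eq {w : Sphere2} (hw : (w : E3) 2 ≠ 1) :
    invStereographic ⟨(w : E3) 0 / (1 - (w : E3) 2), (w : E3) 1 / (1 - (w : E3) 2)⟩ = w := by
  have h := sq_add_sq_add_sq_sphere w
  have h' : 1 - (w : E3) 2 ≠ 0 := sub_ne_zero.2 hw.symm
  have h2 : 1 + (((w : E3) 0 / (1 - (w : E3) 2)) ^ 2 + ((w : E3) 1 / (1 - (w : E3) 2)) ^ 2) =
      2 / (1 - (w : E3) 2) := by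
    field_simp
    linear_combination h
  refine sphere_ext ?_ ?_ ?_
  · rw [invStereographic_zero, h2]
    field_simp
  · rw [invStereographic_one, h2]
    field_simp
  · rw [invStereographic_two, h2]
    field_simp
    linear_combination h

/-- The inverse of the stereographic projection as an open partial homeomorphism. -/
def invStereographicHomeomorph : OpenPartialHomeomorph ℂ Sphere2 where
  toFun := invStereographic
  invFun w := ⟨(w : E3) 0 / (1 - (w : E3) 2), (w : E3) 1 / (1 - (w : E3) 2)⟩
  source := univ
  target := {w | (w : E3) 2 ≠ 1}
  map_source' z _ := by
    change (invStereographic z : E3) 2 ≠ 1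
    have h : 1 + (z.re ^ 2 + z.im ^ 2) ≠ 0 := by positivity
    rw [invStereographic_two, Ne, div_eq_one_iff_eq h]
    intro h1
    linarith
  map_target' _ _ := mem_univ _
  left_inv' z _ := by
    have h : 1 + (z.re ^ 2 + z.im ^ 2) ≠ 0 := by positivity
    have h1 : 1 - (invStereographic z : E3) 2 = 2 / (1 + (z.re ^ 2 + z.im ^ 2)) := by
      rw [invStereographic_two]
      field_simp
      ring
    refine Complex.ext ?_ ?_
    · change (invStereographic z : E3) 0 / (1 - (invStereographic z : E3) 2) = z.re
      rw [h1, invStereographic_zero]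
      field_simp
    · change (invStereographic z : E3) 1 / (1 - (invStereographic z : E3) 2) = z.im
      rw [h1, invStereographic_one]
      field_simp
  right_inv' w hw := invStereographic_eq hw
  open_source := isOpen_univ
  open_target := isOpen_ne_fun (continuous_coord_sphere 2) continuous_const
  continuousOn_toFun := by
    refine Continuous.continuousOn (continuous_induced_rng.2 ?_)
    have hd : ∀ z : ℂ, 1 + (z.re ^ 2 + z.im ^ 2) ≠ 0 := fun z => by positivity
    refine (PiLp.continuous_toLp 2 _).comp (continuous_pi fun i => ?_)
    have hc : Continuous fun z : ℂ => 1 + (z.re ^ 2 + z.im ^ 2) := by fun_prop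
    fin_cases i
    · exact (continuous_const.mul Complex.continuous_re).div hc hd
    · exact (continuous_const.mul Complex.continuous_im).div hc hd
    · exact (((Complex.continuous_re.pow 2).add (Complex.continuous_im.pow 2)).sub
        continuous_const).div hc hd
  continuousOn_invFun := by
    have hc : ∀ i : Fin 3, ContinuousOn (fun w : Sphere2 => (w : E3) i / (1 - (w : E3) 2))
        {w : Sphere2 | (w : E3) 2 ≠ 1} := fun i =>
      (continuous_coord_sphere i).continuousOn.div
        (continuous_const.sub (continuous_coord_sphere 2)).continuousOn
        fun w hw => sub_ne_zero.2 (Ne.symm hw)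
    exact Complex.equivRealProdCLM.symm.continuous.comp_continuousOn ((hc 0).prodMk (hc 1))

theorem isOpenEmbedding_invStereographic : Topology.IsOpenEmbedding invStereographic :=
  invStereographicHomeomorph.isOpenEmbedding rfl

/-- The disc removed for the cross cap is the open southern hemisphere, and its boundary is the
equator. -/
theorem mem_image_ball_iff {w : Sphere2} :
    w ∈ invStereographic '' Metric.ball 0 1 ↔ (w : E3) 2 < 0 := by
  have hn : ∀ z : ℂ, z ∈ Metric.ball (0 : ℂ) 1 ↔ z.re ^ 2 + z.im ^ 2 < 1 := fun z => by
    rw [mem_ball_zero_iff, ← sq_lt_sq₀ (norm_nonneg _) zero_le_one, Complex.sq_norm,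
      Complex.normSq_apply]
    constructor <;> intro h <;> nlinarith
  constructor
  · rintro ⟨z, hz, rfl⟩
    rw [invStereographic_two]
    have := (hn z).1 hz
    exact div_neg_of_neg_of_pos (by linarith) (by positivity)
  · intro h
    refine ⟨_, (hn _).2 ?_, invStereographic_eq (by linarith)⟩
    have h1 := sq_add_sq_add_sq_sphere w
    have h2 : 0 < 1 - (w : E3) 2 := by linarith
    rw [div_pow, div_pow, ← add_div, div_lt_one (by positivity)]
    nlinarith

theorem invStereographic_equator {z : ℂ} (hz : ‖z‖ = 1) :
    (invStereographic z : E3) = !₂[z.re, z.im, 0] := by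
  have h : z.re ^ 2 + z.im ^ 2 = 1 := by
    have := Complex.sq_norm z
    rw [hz, Complex.normSq_apply] at this
    linarith
  ext i
  fin_cases i
  · refine (invStereographic_zero z).trans ?_
    rw [h]
    simp
    ring
  · refine (invStereographic_one z).trans ?_
    rw [h]
    simp
    ring
  · refine (invStereographic_two z).trans ?_
    rw [h]
    simp

theorem invStereographic_neg {z : ℂ} (hz : ‖z‖ = 1) :
    invStereographic (-z) = -invStereographic z := by
  refine Subtype.ext ?_
  change (invStereographic (-z) : E3) = -(invStereographic z : E3)
  rw [invStereographic_equator hz, invStereographic_equator (by rwa [norm_neg])]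
  ext i
  fin_cases i <;> simp

/-- The closed northern hemisphere meets every antipodal pair, and contains both points exactly when
they lie on the equator, where negation in `ℂ` is the antipodal map. The resulting continuous
bijection goes from a compact to a Hausdorff space, hence is a homeomorphism. -/
theorem isCrosscapAttachment_projPlane : IsCrosscapAttachment Sphere2 ProjPlane := by
  refine ⟨invStereographic, isOpenEmbedding_invStereographic, ?_⟩
  let X := {x : Sphere2 // x ∉ invStereographic '' Metric.ball 0 1}
  let r : X → X → Prop := fun a b =>
    ∃ z : ℂ, ‖z‖ = 1 ∧ (a : Sphere2) = invStereographic z ∧ (b : Sphere2) = invStereographic (-z)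
  let F : Quot r → ProjPlane := Quot.lift (fun a => quotientProj Sphere2 ℤˣ a.1) (by
    rintro a b ⟨z, hz, ha, hb⟩
    refine quotientProj_sphere_eq_iff.2 (Or.inr ?_)
    rw [ha, hb, invStereographic_neg hz])
  have hF : Continuous F := continuous_quot_lift _
    (continuous_quotientProj_sphere.comp continuous_subtype_val)
  have hX : CompactSpace X := by
    refine isCompact_iff_compactSpace.1 (IsClosed.isCompact ?_)
    exact (isOpenEmbedding_invStereographic.isOpenMap _ Metric.isOpen_ball).isClosed_compl
  have hQ : CompactSpace (Quot r) := inferInstance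
  have hmem : ∀ w : Sphere2, w ∉ invStereographic '' Metric.ball 0 1 ↔ 0 ≤ (w : E3) 2 := fun w => by
    rw [mem_image_ball_iff, not_lt]
  have hneg : ∀ w : Sphere2, ((-w : Sphere2) : E3) 2 = -(w : E3) 2 := fun w => rfl
  have hbij : Function.Bijective F := by
    constructor
    · rintro ⟨a⟩ ⟨b⟩ hab
      rcases quotientProj_sphere_eq_iff.1 hab with h | h
      · exact congrArg (Quot.mk r) (Subtype.ext h.symm)
      · refine Quot.sound ?_
        have ha := (hmem a.1).1 a.2
        have hb := (hmem b.1).1 b.2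
        rw [h, hneg] at hb
        have h0 : (a.1 : E3) 2 = 0 := by linarith
        have h1 := invStereographic_eq (w := a.1) (by rw [h0]; exact zero_ne_one)
        have hz : ‖(⟨(a.1 : E3) 0 / (1 - (a.1 : E3) 2), (a.1 : E3) 1 / (1 - (a.1 : E3) 2)⟩ : ℂ)‖
            = 1 := by
          rw [← sq_eq_sq₀ (norm_nonneg _) zero_le_one, Complex.sq_norm, Complex.normSq_apply]
          have := sq_add_sq_add_sq_sphere a.1
          rw [h0] at this ⊢
          simp only [sub_zero, div_one]
          linarith
        exact ⟨_, hz, h1.symm, by rw [h, invStereographic_neg hz, h1]⟩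
    · intro y
      obtain ⟨w, rfl⟩ := quotientProj_surjective (M := Sphere2) (G := ℤˣ) y
      rcases le_total 0 ((w : E3) 2) with h | h
      · exact ⟨Quot.mk r ⟨w, (hmem w).2 h⟩, rfl⟩
      · refine ⟨Quot.mk r ⟨-w, (hmem (-w)).2 (by rw [hneg]; linarith)⟩, ?_⟩
        exact quotientProj_sphere_eq_iff.2 (Or.inr (neg_neg w).symm)
  exact ⟨(hF.homeoOfEquivCompactToT2 (f := Equiv.ofBijective F hbij)).symm⟩

/-- Once non-orientability is known, the genus is a minimum over `k ≥ 1`, so one cross cap suffices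
and the lower bound is automatic. -/
theorem genus_projPlane : genus ProjPlane = 1 := by
  have := preconnectedSpace_sphere
  have : Nonempty Sphere2 := ⟨sphProj 0⟩
  have hconn : PreconnectedSpace ProjPlane :=
    (quotientProj_surjective (M := Sphere2) (G := ℤˣ)).denseRange.preconnectedSpace
      continuous_quotientProj_sphere
  have : Nonempty ProjPlane := ⟨quotientProj Sphere2 ℤˣ (sphProj 0)⟩
  rw [genus_eq_componentGenus_univ, componentGenus, if_neg not_isOrientableOn_projPlane]
  have hcap : IsSphereWithCrosscaps 1 (univ : Set ProjPlane) := by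
    refine .attach 0 Sphere2 _ (.sphere _ ⟨Homeomorph.refl _⟩) ?_
    obtain ⟨d, hd, ⟨f⟩⟩ := isCrosscapAttachment_projPlane
    exact ⟨d, hd, ⟨(Homeomorph.Set.univ ProjPlane).trans f⟩⟩
  refine le_antisymm (Nat.sInf_le ⟨le_rfl, hcap⟩) ?_
  exact (Nat.sInf_mem (s := {k | 1 ≤ k ∧ IsSphereWithCrosscaps k (univ : Set ProjPlane)})
    ⟨1, le_rfl, hcap⟩).1

end

end GenusBound

open GenusBound Manifold MeasureTheory Filter in
theorem mainTheorem12 (t : ℕ → OpenInterval) (ht_pos : ∀ j, 0 < (t j : ℝ)) (ht_anti : Antitone t)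
    (ht_lim : Tendsto (fun j => (t j : ℝ)) atTop (𝓝 0)) :
    IsOrientableOn cylModel (univ : Set QuotCyl) ∧
    ∃ (hS : ∀ j, IsSmoothEmbedding (𝓡 2) cylModel ∞ (sliceMap (t j)))
      (hP : IsSmoothEmbedding (𝓡 2) cylModel ∞ planeMap),
      (∀ j, (sphereSurface (t j) (hS j)).toSet = proj '' {p | p.1 = t j}) ∧
      (planeSurface hP).toSet = proj '' {p | (p.1 : ℝ) = 0} ∧
      (∀ j, (sphereSurface (t j) (hS j)).IsTotallyGeodesic ∧
        IsFiniteMeasure (sphereSurface (t j) (hS j)).varifold ∧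
        IsStationary (sphereSurface (t j) (hS j)).varifold) ∧
      IsAlmostMinimizingInSmallAnnuli (fun j => sphereSurface (t j) (hS j)) ∧
      IsFiniteMeasure (planeSurface hP).varifold ∧
      VarifoldTendsto cylModel (fun j => (sphereSurface (t j) (hS j)).varifold)
        (2 • (planeSurface hP).varifold) ∧
      (∀ j, (sphereSurface (t j) (hS j)).IsOrientable ∧ (sphereSurface (t j) (hS j)).gen = 0) ∧
      ¬ (planeSurface hP).IsOrientable ∧ (planeSurface hP).gen = 1 ∧
      ¬ ((planeSurface hP).gen : ℝ≥0∞) ≤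
        liminf (fun j => ((sphereSurface (t j) (hS j)).gen : ℝ≥0∞)) atTop ∧
      ¬ StrongerEstimate (fun _ : Unit => 2) (fun _ => planeSurface hP)
        (fun j => sphereSurface (t j) (hS j)) := by
  have hS : ∀ j, IsSmoothEmbedding (𝓡 2) cylModel ∞ (sliceMap (t j)) := fun j =>
    isSmoothEmbedding_sliceMap (ht_pos j)
  have hP := isSmoothEmbedding_planeMap
  have hvS : ∀ j, (sphereSurface (t j) (hS j)).varifold = sphArea.map (slicePlane (t j)) :=
    fun j => varifold_sphereSurface (ht_pos j) (hS j)
  have hvP := two_smul_varifold_planeSurface hP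
  have hgenS : ∀ j, (sphereSurface (t j) (hS j)).gen = 0 := fun j => genus_sphere
  have hgenP : (planeSurface hP).gen = 1 := genus_projPlane
  have hnor : ¬ (planeSurface hP).IsOrientable := not_isOrientableOn_projPlane
  refine ⟨isOrientableOn_quotCyl, hS, hP, fun j => ?_, ?_, fun j => ⟨?_, ?_, ?_⟩, ⟨?_, ?_⟩, ?_, ?_,
    fun j => ⟨isOrientableOn_sphere, hgenS j⟩, hnor, hgenP, ?_, ?_⟩
  · ext y
    constructor
    · rintro ⟨w, rfl⟩
      exact ⟨(t j, w), rfl, rfl⟩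
    · rintro ⟨⟨s, w⟩, h, rfl⟩
      obtain rfl : s = t j := h
      exact ⟨w, rfl⟩
  · ext y
    constructor
    · rintro ⟨x, rfl⟩
      obtain ⟨w, rfl⟩ := quotientProj_surjective (M := Sphere2) (G := ℤˣ) x
      exact ⟨(originInterval, w), rfl, rfl⟩
    · rintro ⟨⟨s, w⟩, h, rfl⟩
      obtain rfl : s = originInterval := Subtype.ext h
      exact ⟨quotientProj Sphere2 ℤˣ w, rfl⟩
  · exact isTotallyGeodesic_sphereSurface (t j) (hS j)
  · rw [hvS]
    infer_instance
  · rw [hvS]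
    exact isStationary_slicePlane (t j)
  · choose r hr hmin using exists_radius_isAlmostMinimizing ht_pos ht_lim
    exact ⟨r, hr, hmin⟩
  -- The limit is the central slice parametrised by the sphere, with multiplicity two built in; its
  -- stationarity is the case `t = 0` of the general one.
  · refine ⟨sphArea.map (slicePlane originInterval), inferInstance,
      isStationary_slicePlane originInterval, ?_⟩
    simp only [hvS]
    exact varifoldTendsto_slicePlane ht_lim
  -- The varifold of the plane is bounded by its double, which is an image of the finite measure
  -- `sphArea`.
  · refine ⟨lt_of_le_of_lt ?_ (measure_lt_top (sphArea.map (slicePlane originInterval)) univ)⟩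
    rw [← hvP, two_smul]
    exact le_self_add
  · rw [hvP]
    simp only [hvS]
    exact varifoldTendsto_slicePlane ht_lim
  · simp only [hgenS, hgenP]
    simp
  -- Only the non-orientable sum contributes: half of multiplicity two times genus one is `1`,
  -- against a lower limit of `0`.
  · have h2 : (1 / 2 : ℝ≥0∞) * 2 = 1 := by
      rw [one_div, ENNReal.inv_mul_cancel (by simp) (by simp)]
    simp only [StrongerEstimate, hgenS, hgenP]
    simp [hnor, ENNReal.inv_mul_cancel]
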